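/- Let $N\ge 3$ be odd and let $\Lambda=\mathbb Z/N\mathbb Z$. For $\gamma\in\mathbb R$ consider on $\mathbb R^\Lambda$ the potential $$V_\gamma(x)=\sum_{i\in\Lambda}\Bigl(\tfrac14x_i^4-\tfrac12x_i^2\Bigr)+\frac\gamma4\sum_{i\in\Lambda}(x_{i+1}-x_i)^2 .$$ Let $\mathcal S(\gamma)=\{x:\nabla V_\gamma(x)=0\}$ and, for $0\le k\le N$, let $\mathcal S_k(\gamma)$ be the set of those $x\in\mathcal S(\gamma)$ at which the Hessian matrix of $V_\gamma$ has, counting multiplicity, exactly $k$ negative, no vanishing and $N-k$ positive eigenvalues (the $k$-saddles; $\mathcal S_0(\gamma)$ consists of local minima). Put $\gamma_1=\gamma_1(N)=\dfrac1{1-\cos(2\pi/N)}$, $O=(0,\dots,0)$, $I^\pm=\pm(1,\dots,1)$. Let $G$ be the group of transformations of $\mathbb R^\Lambda$ generated by $R(x_1,\dots,x_N)=(x_2,\dots,x_N,x_1)$, $S(x_1,\dots,x_N)=(x_N,\dots,x_1)$ and $C(x)=-x$, and let $O_x=\{gx:g\in G\}$ denote the orbit of $x$. Then there exist $\delta=\delta(N)>0$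 and a constant $K=K(N)$ such that for every $\gamma$ with $\gamma_1-\delta<\gamma<\gamma_1$ the following hold. 1. There is an integer $\ell\ge1$ such that $|\mathcal S(\gamma)|=4\ell N+3$ and $|\mathcal S_1(\gamma)|=|\mathcal S_2(\gamma)|=2\ell N$. 2. $\mathcal S(\gamma)=\mathcal S_0(\gamma)\cup\mathcal S_1(\gamma)\cup\mathcal S_2(\gamma)\cup\mathcal S_3(\gamma)$, with $\mathcal S_0(\gamma)=O_{I^+}=\{I^+,I^-\}$ and $\mathcal S_3(\gamma)=O_O=\{O\}$. 3. Every $A\in\mathcal S_1(\gamma)$ satisfies $\displaystyle\frac{V_\gamma(A)}N=-\frac16\Bigl(1-\frac\gamma{\gamma_1}\Bigr)^2+\mathcal O\Bigl(\bigl(1-\tfrac\gamma{\gamma_1}\bigr)^3\Bigr)$, the absolute value of the error term being at most $K(1-\gamma/\gamma_1)^3$. -/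

import Mathlib

namespace BistableRing

/-- The configuration space `ℝ^Λ` with `Λ = ℤ/Nℤ`, carrying the Euclidean structure. -/
abbrev Config (N : ℕ) : Type := EuclideanSpace ℝ (ZMod N)

/-- The local double-well potential `U(ξ) = ξ⁴/4 - ξ²/2`. -/
noncomputable def localPotential (ξ : ℝ) : ℝ := (1 / 4) * ξ ^ 4 - (1 / 2) * ξ ^ 2

/-- The potential `V_γ(x) = ∑ U(x_i) + (γ/4) ∑ (x_{i+1} - x_i)²`. -/
noncomputable def potential (N : ℕ) [NeZero N] (γ : ℝ) (x : Config N) : ℝ :=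
  ∑ i : ZMod N, localPotential (x i) + γ / 4 * ∑ i : ZMod N, (x (i + 1) - x i) ^ 2

/-- The set `𝒮(γ)` of stationary points of the potential. -/
def stationary (N : ℕ) [NeZero N] (γ : ℝ) : Set (Config N) :=
  {x | gradient (potential N γ) x = 0}

/-- The Hessian matrix of the potential: second derivatives along the standard basis. -/
noncomputable def hessian (N : ℕ) [NeZero N] (γ : ℝ) (x : Config N) :
    Matrix (ZMod N) (ZMod N) ℝ :=
  Matrix.of fun i j =>
    fderiv ℝ (fderiv ℝ (potential N γ)) x
      (EuclideanSpace.single i (1 : ℝ)) (EuclideanSpace.single j (1 : ℝ))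

/-- The eigenvalues of the Hessian at `x`, counted with multiplicity. -/
noncomputable def hessianEigenvalues (N : ℕ) [NeZero N] (γ : ℝ) (x : Config N) :
    Multiset ℝ :=
  (hessian N γ x).charpoly.roots

/-- `x` is of type `(a, b, c)`: the Hessian at `x` has `a` negative, `b` vanishing and `c`
positive eigenvalues, counted with multiplicity. -/
def IsOfType (N : ℕ) [NeZero N] (γ : ℝ) (x : Config N) (a b c : ℕ) : Prop :=
  (hessianEigenvalues N γ x).countP (· < 0) = a ∧
  (hessianEigenvalues N γ x).countP (· = 0) = b ∧
  (hessianEigenvalues N γ x).countP (0 < ·) = c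

/-- The set `𝒮_k(γ)` of stationary points of type `(k, 0, N - k)`. -/
def saddles (N : ℕ) [NeZero N] (γ : ℝ) (k : ℕ) : Set (Config N) :=
  {x | x ∈ stationary N γ ∧ IsOfType N γ x k 0 (N - k)}

/-- The synchronisation threshold `γ₁(N) = 1 / (1 - cos(2π/N))`. -/
noncomputable def gammaOne (N : ℕ) : ℝ := 1 / (1 - Real.cos (2 * Real.pi / N))

/-- The configuration `I⁺ = (1, …, 1)`; the configuration `I⁻` is `-I⁺`. -/
noncomputable def Iplus (N : ℕ) : Config N := WithLp.toLp 2 fun _ => 1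

/-- The cyclic permutation `R(x_1, …, x_N) = (x_2, …, x_N, x_1)`. -/
def rotation (N : ℕ) : Equiv.Perm (Config N) where
  toFun x := WithLp.toLp 2 fun i => x (i + 1)
  invFun x := WithLp.toLp 2 fun i => x (i - 1)
  left_inv x := by ext i; simp
  right_inv x := by ext i; simp

/-- The reflection `S(x_1, …, x_N) = (x_N, …, x_1)`, that is `S(x)_i = x_{N+1-i}`. -/
def reflection (N : ℕ) : Equiv.Perm (Config N) where
  toFun x := WithLp.toLp 2 fun i => x (1 - i)
  invFun x := WithLp.toLp 2 fun i => x (1 - i)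
  left_inv x := by ext i; simp
  right_inv x := by ext i; simp

/-- The inversion `C(x) = -x`. -/
def inversion (N : ℕ) : Equiv.Perm (Config N) := Equiv.neg (Config N)

/-- The symmetry group `G`, generated by `R`, `S` and `C`, acting on configurations. -/
def symmetryGroup (N : ℕ) : Subgroup (Equiv.Perm (Config N)) :=
  Subgroup.closure {rotation N, reflection N, inversion N}

end BistableRing

/-! Put `l = 1 - γ/γ₁`. Stationarity reads `L x = x ^ 3`, where the circulant operator `L = 1 +
(γ/2)Δ` has eigenvalue `1` on constants, `l` on the modes `±1`, and negative eigenvalues bounded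
away from `0` as `l → 0+` on all other modes. A discrete Poincaré inequality for consecutive
differences shows that a nonconstant solution has size `O(√l)`, so everything nonconstant bifurcates
from the origin and can be studied by a Lyapunov–Schmidt reduction to the modes `±1`.

In polar coordinates `x = 2ρ cos(θ + 2πj/N) + (other modes)`. The other modes are slaved to the
first ones, the radial equation gives `l = 3ρ² + O(ρ⁴)`, and the tangential equation decides which
`θ` occur. Expand in powers of `ρ`: the term of degree `d` only has frequencies of the parity of `d`
and of modulus at most `d`. As `N` is odd, aliasing on `ℤ/Nℤ` first breaks rotation invariance at
degree `2N-1`, where the tangential component is `-N · resCoeff · ρ^(2N-1) · sin(2Nθ)`.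

That `resCoeff` is nonzero at `l = 0` is arithmetic. It is the value at `exp(2πi/N)` of an
expression with rational coefficients, so by irreducibility of the cyclotomic polynomial its
vanishing does not depend on the primitive root chosen. At a primitive root closest to `-1` all
relevant denominators are positive, hence so is the coefficient (`cube_cubicSeq_ne_zero`).

Angles are then quantised by symmetry: a solution and its mirror image have the same amplitude, and
comparing their tangential equations forces the two angles to agree, so `θ ∈ (π/2N)ℤ`
(`eventually_angle`). Conversely, for each angle a contraction solves all equations but the
tangential one, and at a symmetric angle uniqueness makes the fixed point mirror invariant, so the
tangential equation holds too (`exists_isPolar`). This gives exactly `4N` nonconstant solutions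
(`exists_branches`).

For the types, the Hessian is negative on constants, at least `ρ²/4` on mean-zero vectors orthogonal
to the tangent wave, and almost neutral along the `θ`-derivative of the approximate solution, where
its form is `-4N² · resCoeff · (-1)^k · ρ^(2N)` to leading order (`exists_tangent_vector`). Hence
the branches are alternately 1-saddles and 2-saddles, and `ℓ = 1`. -/

open Finset Filter Topology

namespace BistableRing

set_option linter.unusedSectionVars false

variable {N : ℕ} [NeZero N]

/-! ### Waves and circulant operators on `ℤ/Nℤ` -/

/-- The wave `cos (α + 2π a / N)`, as a function on `ℤ/Nℤ`. -/
noncomputable def ph (α : ℝ) (a : ZMod N) : ℝ := Real.cos (α + 2 * Real.pi * a.val / N)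

theorem ph_intCast (α : ℝ) (n : ℤ) : ph α (n : ZMod N) = Real.cos (α + 2 * Real.pi * n / N) := by
  have hN : (N : ℝ) ≠ 0 := Nat.cast_ne_zero.2 (NeZero.ne N)
  have h : (((n : ZMod N).val : ℤ)) = n % N := ZMod.val_intCast n
  have h2 : (((n : ZMod N).val : ℝ)) = n - N * ((n / N : ℤ) : ℝ) := by
    have h3 : (((n : ZMod N).val : ℤ)) = n - N * (n / N) := by
      rw [h]; have := Int.emod_add_mul_ediv n N; linarith
    exact_mod_cast h3
  rw [ph, h2, ← Real.cos_sub_int_mul_two_pi (α + 2 * Real.pi * n / N) (n / N)]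
  congr 1
  field_simp
  ring

theorem exists_intCast (a : ZMod N) : ∃ n : ℤ, (n : ZMod N) = a := ⟨a.val, by simp⟩

theorem ph_mul (α β : ℝ) (a b : ZMod N) :
    ph α a * ph β b = (ph (α + β) (a + b) + ph (α - β) (a - b)) / 2 := by
  obtain ⟨n, rfl⟩ := exists_intCast a
  obtain ⟨m, rfl⟩ := exists_intCast b
  rw [← Int.cast_add, ← Int.cast_sub]
  simp only [ph_intCast]
  have e1 : α + β + 2 * Real.pi * ((n + m : ℤ) : ℝ) / N
      = (α + 2 * Real.pi * n / N) + (β + 2 * Real.pi * m / N) := by push_cast; ring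
  have e2 : α - β + 2 * Real.pi * ((n - m : ℤ) : ℝ) / N
      = (α + 2 * Real.pi * n / N) - (β + 2 * Real.pi * m / N) := by push_cast; ring
  rw [e1, e2]
  generalize α + 2 * Real.pi * n / N = u
  generalize β + 2 * Real.pi * m / N = v
  rw [Real.cos_add, Real.cos_sub]; ring

theorem ph_neg (α : ℝ) (a : ZMod N) : ph α (-a) = ph (-α) a := by
  obtain ⟨n, rfl⟩ := exists_intCast a
  rw [← Int.cast_neg, ph_intCast, ph_intCast, ← Real.cos_neg]
  congr 1; push_cast; ring

theorem ph_add (α β : ℝ) (a : ZMod N) :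
    ph (α + β) a = Real.cos β * ph α a + Real.sin β * ph (α + Real.pi / 2) a := by
  simp only [ph]
  rw [show α + β + 2 * Real.pi * a.val / N = (α + 2 * Real.pi * a.val / N) + β by ring,
    show α + Real.pi / 2 + 2 * Real.pi * a.val / N = (α + 2 * Real.pi * a.val / N) + Real.pi / 2
      by ring, Real.cos_add_pi_div_two, Real.cos_add]; ring

theorem ph_zero_right (α : ℝ) : ph α (0 : ZMod N) = Real.cos α := by simp [ph]

theorem abs_ph_le (α : ℝ) (a : ZMod N) : |ph α a| ≤ 1 := Real.abs_cos_le_one _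

/-- `co a = cos (2π a / N)`. -/
noncomputable abbrev co (a : ZMod N) : ℝ := ph 0 a

theorem co_neg (a : ZMod N) : co (-a) = co a := by rw [co, ph_neg, neg_zero]

theorem co_ne_one {a : ZMod N} (ha : a ≠ 0) : co a ≠ 1 := by
  intro h
  apply ha
  have hN : (0 : ℝ) < N := Nat.cast_pos.2 (NeZero.pos N)
  have hv : (a.val : ℝ) < N := by exact_mod_cast ZMod.val_lt a
  have hp := Real.pi_pos
  rw [co, ph, zero_add, Real.cos_eq_one_iff_of_lt_of_lt] at h
  · have h2 : (a.val : ℝ) = 0 := by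
      rcases div_eq_zero_iff.1 h with h | h
      · rcases mul_eq_zero.1 h with h | h
        · linarith
        · exact h
      · linarith
    exact (ZMod.val_eq_zero a).1 (by exact_mod_cast h2)
  · have : 0 ≤ 2 * Real.pi * a.val / N := by positivity
    linarith
  · rw [div_lt_iff₀ hN]; nlinarith

/-- For `a ≠ 0`, averaging the two shifts of the summation variable by `±1` multiplies the sum by
`co a` while leaving it unchanged; since `co a ≠ 1` it vanishes. -/
theorem sum_ph (α : ℝ) (a b : ZMod N) :
    ∑ j : ZMod N, ph α (a * j + b) = if a = 0 then N * ph α b else 0 := by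
  split_ifs with ha
  · simp [ha]
  · set S := ∑ j : ZMod N, ph α (a * j + b) with hS
    have h1 : ∑ j : ZMod N, ph α (a * j + b + a) = S := by
      rw [hS, ← Equiv.sum_comp (Equiv.addRight (1 : ZMod N)) (fun j => ph α (a * j + b))]
      refine sum_congr rfl fun j _ => ?_
      simp only [Equiv.coe_addRight]; congr 1; ring
    have h2 : ∑ j : ZMod N, ph α (a * j + b - a) = S := by
      rw [hS, ← Equiv.sum_comp (Equiv.subRight (1 : ZMod N)) (fun j => ph α (a * j + b))]
      refine sum_congr rfl fun j _ => ?_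
      simp only [Equiv.subRight_apply]; congr 1; ring
    have h3 : co a * S = (S + S) / 2 := by
      rw [show S + S = ∑ j : ZMod N, ph α (a * j + b + a) + ∑ j : ZMod N, ph α (a * j + b - a) by
        rw [h1, h2]]
      rw [hS, mul_sum, ← sum_add_distrib, sum_div]
      refine sum_congr rfl fun j _ => ?_
      rw [mul_comm, co, ph_mul]; simp
    have h4 : (co a - 1) * S = 0 := by linarith
    exact (mul_eq_zero.1 h4).resolve_left (sub_ne_zero.2 (co_ne_one ha))

/-- The circulant operator on `ℝ^Λ` with Fourier symbol `m`. -/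
noncomputable def mult (m : ZMod N → ℝ) : (ZMod N → ℝ) →ₗ[ℝ] (ZMod N → ℝ) where
  toFun x j := (1 / N) * ∑ k : ZMod N, m k * ∑ l : ZMod N, co (k * (j - l)) * x l
  map_add' x y := by
    ext j
    simp only [Pi.add_apply, mul_add, sum_add_distrib]
  map_smul' c x := by
    ext j
    simp only [Pi.smul_apply, smul_eq_mul, RingHom.id_apply, mul_sum]
    refine sum_congr rfl fun k _ => sum_congr rfl fun l _ => ?_
    ring

theorem mult_apply (m : ZMod N → ℝ) (x : ZMod N → ℝ) (j : ZMod N) :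
    mult m x j = (1 / N) * ∑ k : ZMod N, m k * ∑ l : ZMod N, co (k * (j - l)) * x l := rfl

theorem mult_add_symbol (m m' : ZMod N → ℝ) (x : ZMod N → ℝ) :
    mult (m + m') x = mult m x + mult m' x := by
  ext j; simp only [mult_apply, Pi.add_apply, add_mul, sum_add_distrib, mul_add]

theorem mult_smul_symbol (c : ℝ) (m : ZMod N → ℝ) (x : ZMod N → ℝ) :
    mult (c • m) x = c • mult m x := by
  ext j
  simp only [mult_apply, Pi.smul_apply, smul_eq_mul, mul_sum]
  refine sum_congr rfl fun k _ => sum_congr rfl fun l _ => ?_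
  ring

theorem mult_sub_symbol (m m' : ZMod N → ℝ) (x : ZMod N → ℝ) :
    mult (m - m') x = mult m x - mult m' x := by
  rw [sub_eq_add_neg, ← neg_one_smul ℝ, mult_add_symbol, mult_smul_symbol, neg_one_smul,
    sub_eq_add_neg]

theorem mult_one (x : ZMod N → ℝ) : mult 1 x = x := by
  have hN : (N : ℝ) ≠ 0 := Nat.cast_ne_zero.2 (NeZero.ne N)
  ext j
  simp only [mult_apply, Pi.one_apply, one_mul]
  rw [sum_comm]
  have : ∀ l : ZMod N, ∑ k : ZMod N, co (k * (j - l)) * x l = if l = j then N * x j else 0 := by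
    intro l
    rw [← sum_mul]
    have := sum_ph (N := N) 0 (j - l) 0
    simp only [add_zero, mul_comm (j - l)] at this
    rw [this]
    by_cases h : l = j
    · simp [h, ph_zero_right]
    · rw [if_neg (sub_ne_zero.2 (Ne.symm h)), if_neg h, zero_mul]
  simp only [this, sum_ite_eq', mem_univ, if_true]
  field_simp

/-- The kernel is a sum of cosines, so it sees the frequencies `k` and `-k` together. Evenness of
the symbol makes both contribute the same eigenvalue. -/
theorem mult_wave {m : ZMod N → ℝ} (hm : ∀ k, m (-k) = m k) (α : ℝ) (k b : ZMod N) :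
    mult m (fun j => ph α (k * j + b)) = m k • fun j => ph α (k * j + b) := by
  have hN : (N : ℝ) ≠ 0 := Nat.cast_ne_zero.2 (NeZero.ne N)
  ext j
  simp only [mult_apply, Pi.smul_apply, smul_eq_mul]
  have key : ∀ k' : ZMod N, ∑ l : ZMod N, co (k' * (j - l)) * ph α (k * l + b)
      = N / 2 * ((if k' = k then ph α (k * j + b) else 0)
        + if k' = -k then ph α (k * j + b) else 0) := by
    intro k'
    have e : ∀ l : ZMod N, co (k' * (j - l)) * ph α (k * l + b)
        = (ph α ((k - k') * l + (k' * j + b)) + ph (-α) ((-k' - k) * l + (k' * j - b))) / 2 := by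
      intro l
      rw [co, ph_mul, zero_add, zero_sub]
      congr 3 <;> ring
    simp only [e]
    rw [← sum_div, sum_add_distrib, sum_ph, sum_ph]
    have h2 : (if -k' - k = 0 then (N : ℝ) * ph (-α) (k' * j - b) else 0)
        = N * if k' = -k then ph α (k * j + b) else 0 := by
      by_cases h : k' = -k
      · subst h
        rw [if_pos (by ring), if_pos rfl, ← ph_neg]; congr 2; ring
      · rw [if_neg, if_neg h, mul_zero]
        intro h'; apply h; linear_combination -h'
    have h1 : (if k - k' = 0 then (N : ℝ) * ph α (k' * j + b) else 0)
        = N * if k' = k then ph α (k * j + b) else 0 := by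
      by_cases h : k' = k
      · subst h; simp
      · rw [if_neg (sub_ne_zero.2 (Ne.symm h)), if_neg h, mul_zero]
    rw [h1, h2]; ring
  simp only [key, mul_add, sum_add_distrib, mul_ite, mul_zero, sum_ite_eq', mem_univ, if_true, hm]
  field_simp
  ring

theorem mult_expand (m : ZMod N → ℝ) (x : ZMod N → ℝ) :
    mult m x = (1 / N : ℝ) • ∑ k : ZMod N, ∑ l : ZMod N,
      (m k * x l) • fun j => ph 0 (k * j + (-(k * l))) := by
  ext j
  simp only [mult_apply, Pi.smul_apply, Finset.sum_apply, smul_eq_mul, mul_sum]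
  refine sum_congr rfl fun k _ => sum_congr rfl fun l _ => ?_
  rw [show k * j + (-(k * l)) = k * (j - l) by ring]; ring

theorem mult_mult {m : ZMod N → ℝ} (hm : ∀ k, m (-k) = m k) (m' : ZMod N → ℝ) (x : ZMod N → ℝ) :
    mult m (mult m' x) = mult (m * m') x := by
  rw [mult_expand m' x, mult_expand (m * m') x]
  simp only [map_smul, map_sum, mult_wave hm]
  congr 1
  refine sum_congr rfl fun k _ => sum_congr rfl fun l _ => ?_
  rw [smul_smul]
  congr 1
  simp only [Pi.mul_apply]; ring

/-- The waves span `ℝ^Λ`, by the expansion of the identity `mult 1`, so an operator is recognised as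
circulant by its action on them. -/
theorem mult_ext_wave {m : ZMod N → ℝ} (hm : ∀ k, m (-k) = m k)
    (T : (ZMod N → ℝ) →ₗ[ℝ] (ZMod N → ℝ))
    (hT : ∀ k b : ZMod N, T (fun j => ph 0 (k * j + b)) = m k • fun j => ph 0 (k * j + b))
    (x : ZMod N → ℝ) : T x = mult m x := by
  rw [← mult_one x, mult_mult hm, mult_expand 1 x, mult_expand (m * 1) x]
  simp only [map_smul, map_sum, hT]
  congr 1
  refine sum_congr rfl fun k _ => sum_congr rfl fun l _ => ?_
  rw [smul_smul]
  congr 1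
  simp only [Pi.mul_apply]; ring

theorem mult_symm (m : ZMod N → ℝ) (x y : ZMod N → ℝ) :
    mult m x ⬝ᵥ y = x ⬝ᵥ mult m y := by
  simp only [dotProduct, mult_apply, mul_sum, sum_mul]
  rw [sum_comm' (t' := univ) (s' := fun _ => univ) (by simp)]
  conv_rhs => rw [sum_comm' (t' := univ) (s' := fun _ => univ) (by simp)]
  refine sum_congr rfl fun k _ => ?_
  rw [sum_comm]
  refine sum_congr rfl fun j _ => sum_congr rfl fun l _ => ?_
  rw [← co_neg (k * (l - j)), show -(k * (l - j)) = k * (j - l) by ring]; ring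

/-- Parseval: the cosine and sine coefficients of each frequency combine by the addition formula
into the kernel `co (k * (j - l))`. Quadratic form inequalities thereby reduce to inequalities
between symbols. -/
theorem dotProduct_mult_self (m : ZMod N → ℝ) (x : ZMod N → ℝ) :
    x ⬝ᵥ mult m x = (1 / N) * ∑ k : ZMod N, m k * ((∑ j, x j * co (k * j)) ^ 2
      + (∑ j, x j * ph (Real.pi / 2) (k * j)) ^ 2) := by
  have e : ∀ k : ZMod N, (∑ j, x j * co (k * j)) ^ 2 + (∑ j, x j * ph (Real.pi / 2) (k * j)) ^ 2
      = ∑ j, ∑ l, x j * (co (k * (j - l)) * x l) := by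
    intro k
    rw [sq, sq, sum_mul_sum, sum_mul_sum, ← sum_add_distrib]
    refine sum_congr rfl fun j _ => ?_
    rw [← sum_add_distrib]
    refine sum_congr rfl fun l _ => ?_
    have h1 := ph_mul 0 0 (k * j) (k * l)
    have h2 := ph_mul (Real.pi / 2) (Real.pi / 2) (k * j) (k * l)
    have h3 := ph_add (0 : ℝ) Real.pi (k * j + k * l)
    simp only [add_zero, sub_self, Real.cos_pi, Real.sin_pi, zero_add, add_halves] at h1 h2 h3
    rw [h3] at h2
    rw [show k * (j - l) = k * j - k * l by ring]
    linear_combination (x j * x l) * (h1 + h2)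
  simp only [e, dotProduct, mult_apply, mul_sum]
  rw [sum_comm]
  refine sum_congr rfl fun k _ => sum_congr rfl fun j _ => sum_congr rfl fun l _ => ?_
  ring

theorem dotProduct_mult_mono {m m' : ZMod N → ℝ} (x : ZMod N → ℝ)
    (h : ∀ k, m k ≤ m' k) : x ⬝ᵥ mult m x ≤ x ⬝ᵥ mult m' x := by
  rw [dotProduct_mult_self, dotProduct_mult_self]
  refine mul_le_mul_of_nonneg_left (sum_le_sum fun k _ => ?_) (by positivity)
  exact mul_le_mul_of_nonneg_right (h k) (by positivity)

theorem norm_mult_le (m : ZMod N → ℝ) (x : ZMod N → ℝ) :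
    ‖mult m x‖ ≤ (∑ k, |m k|) * ‖x‖ := by
  have hN : (0 : ℝ) < N := Nat.cast_pos.2 (NeZero.pos N)
  refine (pi_norm_le_iff_of_nonneg (by positivity)).2 fun j => ?_
  rw [Real.norm_eq_abs, mult_apply, abs_mul, abs_of_pos (by positivity : (0 : ℝ) < 1 / N)]
  have h1 : ∀ k : ZMod N, |∑ l : ZMod N, co (k * (j - l)) * x l| ≤ N * ‖x‖ := by
    intro k
    refine (abs_sum_le_sum_abs _ _).trans ?_
    refine (sum_le_sum (g := fun _ => ‖x‖) fun l _ => ?_).trans (by simp [ZMod.card])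
    rw [abs_mul]
    have := norm_le_pi_norm x l
    rw [Real.norm_eq_abs] at this
    nlinarith [abs_ph_le 0 (k * (j - l)), abs_nonneg (x l)]
  have h2 : |∑ k : ZMod N, m k * ∑ l : ZMod N, co (k * (j - l)) * x l|
      ≤ ∑ k, |m k| * (N * ‖x‖) := by
    refine (abs_sum_le_sum_abs _ _).trans (sum_le_sum fun k _ => ?_)
    rw [abs_mul]
    exact mul_le_mul_of_nonneg_left (h1 k) (abs_nonneg _)
  rw [← sum_mul] at h2
  calc _ ≤ 1 / N * ((∑ k, |m k|) * (N * ‖x‖)) := by gcongr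
    _ = _ := by field_simp

/-! ### The linear part near threshold: symbol, spectral gap, partial inverse -/

/-- The linear operator `1 + (γ / 2) Δ`. -/
noncomputable def linOp (γ : ℝ) : (ZMod N → ℝ) →ₗ[ℝ] (ZMod N → ℝ) where
  toFun x j := x j + γ / 2 * (x (j + 1) + x (j - 1) - 2 * x j)
  map_add' x y := by ext j; simp only [Pi.add_apply]; ring
  map_smul' c x := by ext j; simp only [Pi.smul_apply, smul_eq_mul, RingHom.id_apply]; ring

theorem linOp_apply (γ : ℝ) (x : ZMod N → ℝ) (j : ZMod N) :
    linOp γ x j = x j + γ / 2 * (x (j + 1) + x (j - 1) - 2 * x j) := rfl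

theorem linOp_eq_mult (γ : ℝ) (x : ZMod N → ℝ) :
    linOp γ x = mult (fun k => 1 - γ * (1 - co k)) x := by
  refine mult_ext_wave (fun k => by rw [co_neg]) _ (fun k b => ?_) x
  ext j
  have h := ph_mul 0 0 (k * j + b) k
  rw [add_zero, sub_zero] at h
  simp only [linOp_apply, Pi.smul_apply, smul_eq_mul]
  rw [show k * (j + 1) + b = k * j + b + k by ring, show k * (j - 1) + b = k * j + b - k by ring]
  linear_combination (-γ) * h

/-- The Fourier symbol of `1 + (γ / 2) Δ` at `γ = (1 - l) γ₁`. -/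
noncomputable def symb (N : ℕ) [NeZero N] (l : ℝ) (k : ZMod N) : ℝ :=
  1 - (1 - l) * gammaOne N * (1 - co k)

theorem symb_neg (l : ℝ) (k : ZMod N) : symb N l (-k) = symb N l k := by rw [symb, co_neg, symb]

theorem co_one : co (1 : ZMod N) = Real.cos (2 * Real.pi / N) := by
  have := ph_intCast (N := N) 0 1
  simpa using this

theorem one_ne_zero_zmod (hN : 3 ≤ N) : (1 : ZMod N) ≠ 0 := by
  intro h
  have : ((1 : ℕ) : ZMod N) = 0 := by simpa using h
  rw [ZMod.natCast_eq_zero_iff] at this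
  have := Nat.le_of_dvd one_pos this
  omega

theorem two_ne_zero_zmod (hN : 3 ≤ N) : (2 : ZMod N) ≠ 0 := by
  intro h
  have : ((2 : ℕ) : ZMod N) = 0 := by simpa using h
  rw [ZMod.natCast_eq_zero_iff] at this
  have := Nat.le_of_dvd two_pos this
  omega

theorem one_ne_neg_one_zmod (hN : 3 ≤ N) : (1 : ZMod N) ≠ -1 := by
  intro h
  apply two_ne_zero_zmod hN
  linear_combination h

theorem co_one_lt_one (hN : 3 ≤ N) : co (1 : ZMod N) < 1 :=
  lt_of_le_of_ne (Real.cos_le_one _) (co_ne_one (one_ne_zero_zmod hN))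

theorem gammaOne_mul (hN : 3 ≤ N) : gammaOne N * (1 - co (1 : ZMod N)) = 1 := by
  have := co_one_lt_one hN
  rw [gammaOne, ← co_one]
  field_simp [(sub_pos.2 this).ne']

theorem gammaOne_pos (hN : 3 ≤ N) : 0 < gammaOne N := by
  have := co_one_lt_one hN
  rw [gammaOne, ← co_one]
  exact one_div_pos.2 (sub_pos.2 this)

theorem symb_zero_right (l : ℝ) : symb N l 0 = 1 := by simp [symb, ph_zero_right]

theorem symb_one (hN : 3 ≤ N) (l : ℝ) : symb N l 1 = l := by
  rw [symb, mul_assoc, gammaOne_mul hN]; ring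

theorem co_lt_co_one_aux {k : ZMod N} (h1 : 2 ≤ k.val) (h2 : 2 * k.val ≤ N) :
    co k < co (1 : ZMod N) := by
  have hN : (0 : ℝ) < N := Nat.cast_pos.2 (NeZero.pos N)
  have hp := Real.pi_pos
  have h1' : (2 : ℝ) ≤ k.val := by exact_mod_cast h1
  have h2' : 2 * (k.val : ℝ) ≤ N := by exact_mod_cast h2
  rw [co_one, co, ph, zero_add]
  refine Real.cos_lt_cos_of_nonneg_of_le_pi (by positivity) ?_ ?_
  · rw [div_le_iff₀ hN]; nlinarith
  · rw [div_lt_div_iff_of_pos_right hN]; nlinarith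

theorem co_lt_co_one {k : ZMod N} (h0 : k ≠ 0) (h1 : k ≠ 1) (h2 : k ≠ -1) :
    co k < co (1 : ZMod N) := by
  have two_le : ∀ m : ZMod N, m ≠ 0 → m ≠ 1 → 2 ≤ m.val := by
    intro m hm0 hm1
    by_contra! h
    have : m.val = 0 ∨ m.val = 1 := by omega
    rcases this with h | h
    · exact hm0 ((ZMod.val_eq_zero m).1 h)
    · apply hm1
      rw [← ZMod.natCast_zmod_val m, h, Nat.cast_one]
  by_cases h : 2 * k.val ≤ N
  · exact co_lt_co_one_aux (two_le k h0 h1) h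
  · rw [← co_neg k]
    have hk : -k ≠ 1 := fun h => h2 (by rw [← h, neg_neg])
    refine co_lt_co_one_aux (two_le _ (neg_ne_zero.2 h0) hk) ?_
    have : NeZero k := ⟨h0⟩
    rw [ZMod.val_neg_of_ne_zero k]
    omega

theorem symb_le (hN : 3 ≤ N) {l : ℝ} (hl : l ≤ 1) {k : ZMod N} (hk : k ≠ 0) : symb N l k ≤ l := by
  have hco : co k ≤ co (1 : ZMod N) := by
    by_cases h1 : k = 1
    · rw [h1]
    · by_cases h2 : k = -1
      · rw [h2, co_neg]
      · exact (co_lt_co_one hk h1 h2).le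
  refine le_of_le_of_eq ?_ (symb_one hN l)
  rw [symb, symb]
  have := mul_nonneg (sub_nonneg.2 hl) (gammaOne_pos hN).le
  nlinarith

theorem continuous_symb (k : ZMod N) : Continuous fun l => symb N l k := by
  unfold symb; fun_prop

theorem symb_zero_neg (hN : 3 ≤ N) {k : ZMod N} (h0 : k ≠ 0) (h1 : k ≠ 1) (h2 : k ≠ -1) :
    symb N 0 k < 0 := by
  refine lt_of_lt_of_eq ?_ (symb_one hN 0)
  rw [symb, symb]
  have := co_lt_co_one h0 h1 h2
  have h3 := gammaOne_pos hN
  nlinarith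

/-- The inequality is strict at `l = 0` for the finitely many modes other than `0, ±1`, and persists
by continuity of the symbol in `l`. -/
theorem exists_gap (hN : 3 ≤ N) : ∃ κ : ℝ, 0 < κ ∧ ∀ᶠ l in 𝓝[>] (0 : ℝ), ∀ k : ZMod N,
    k ≠ 0 → k ≠ 1 → k ≠ -1 → symb N l k ≤ -κ := by
  have h : ∀ᶠ κ in 𝓝[>] (0 : ℝ), ∀ k : ZMod N, k ≠ 0 → k ≠ 1 → k ≠ -1 → symb N 0 k < -κ := by
    rw [eventually_all]
    intro k
    by_cases hk : k ≠ 0 ∧ k ≠ 1 ∧ k ≠ -1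
    · have h := symb_zero_neg hN hk.1 hk.2.1 hk.2.2
      have : ∀ᶠ κ in 𝓝[>] (0 : ℝ), κ < -symb N 0 k :=
        nhdsWithin_le_nhds (eventually_lt_nhds (by linarith))
      filter_upwards [this] with κ hκ _ _ _
      linarith
    · exact Eventually.of_forall fun κ h0 h1 h2 => absurd ⟨h0, h1, h2⟩ hk
  obtain ⟨κ, hκ, hpos⟩ := (h.and self_mem_nhdsWithin).exists
  refine ⟨κ, hpos, ?_⟩
  rw [eventually_all]
  intro k
  by_cases hk : k ≠ 0 ∧ k ≠ 1 ∧ k ≠ -1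
  · have h := hκ k hk.1 hk.2.1 hk.2.2
    have : ∀ᶠ l in 𝓝[>] (0 : ℝ), symb N l k < -κ :=
      nhdsWithin_le_nhds ((continuous_symb k).continuousAt.eventually_lt_const h)
    filter_upwards [this] with l hl _ _ _
    exact hl.le
  · exact Eventually.of_forall fun l h0 h1 h2 => absurd ⟨h0, h1, h2⟩ hk

/-- Symbol of the projection onto the modes other than `±1`. -/
noncomputable def pw (N : ℕ) (k : ZMod N) : ℝ := if k = 1 ∨ k = -1 then 0 else 1

/-- Symbol of the inverse of `1 + (γ / 2) Δ` on the modes other than `±1`. -/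
noncomputable def kap (N : ℕ) [NeZero N] (l : ℝ) (k : ZMod N) : ℝ :=
  if k = 1 ∨ k = -1 then 0 else 1 / symb N l k

theorem pm_one_neg (k : ZMod N) : (-k = 1 ∨ -k = -1) ↔ (k = 1 ∨ k = -1) := by
  rw [neg_eq_iff_eq_neg, neg_inj, or_comm]

theorem kap_neg (l : ℝ) (k : ZMod N) : kap N l (-k) = kap N l k := by
  simp only [kap, pm_one_neg, symb_neg]

/-- All modes other than `±1` are nondegenerate. -/
def NonRes (N : ℕ) [NeZero N] (l : ℝ) : Prop := ∀ k : ZMod N, k ≠ 1 → k ≠ -1 → symb N l k ≠ 0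

theorem eventually_nonRes (hN : 3 ≤ N) : ∀ᶠ l in 𝓝[>] (0 : ℝ), NonRes N l := by
  obtain ⟨κ, hκ, h⟩ := exists_gap hN
  filter_upwards [h] with l hl k h1 h2
  by_cases h0 : k = 0
  · rw [h0, symb_zero_right]; exact one_ne_zero
  · linarith [hl k h0 h1 h2]

theorem symb_mul_kap {l : ℝ} (h : NonRes N l) : symb N l * kap N l = pw N := by
  ext k
  simp only [Pi.mul_apply, kap, pw]
  split_ifs with hk
  · simp
  · push Not at hk
    exact mul_one_div_cancel (h k hk.1 hk.2)

theorem mult_symb_kap {l : ℝ} (h : NonRes N l) (x : ZMod N → ℝ) :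
    mult (symb N l) (mult (kap N l) x) = mult (pw N) x := by
  rw [mult_mult (symb_neg l), symb_mul_kap h]

theorem mult_kap_symb {l : ℝ} (h : NonRes N l) (x : ZMod N → ℝ) :
    mult (kap N l) (mult (symb N l) x) = mult (pw N) x := by
  rw [mult_mult (kap_neg l), mul_comm, symb_mul_kap h]

theorem exists_norm_kap_le (hN : 3 ≤ N) : ∃ C : ℝ, 0 < C ∧ ∀ᶠ l in 𝓝[>] (0 : ℝ),
    ∀ x : ZMod N → ℝ, ‖mult (kap N l) x‖ ≤ C * ‖x‖ := by
  obtain ⟨κ, hκ, h⟩ := exists_gap hN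
  have hN' : (0 : ℝ) < N := Nat.cast_pos.2 (NeZero.pos N)
  refine ⟨N * (1 + 1 / κ), by positivity, ?_⟩
  filter_upwards [h] with l hl x
  refine (norm_mult_le _ _).trans (mul_le_mul_of_nonneg_right ?_ (norm_nonneg _))
  refine (sum_le_sum (g := fun _ => 1 + 1 / κ) fun k _ => ?_).trans (by simp [ZMod.card, mul_add])
  have hk' : 0 < 1 / κ := by positivity
  simp only [kap]
  split_ifs with hk
  · simp; positivity
  · push Not at hk
    by_cases h0 : k = 0
    · rw [h0, symb_zero_right]; simp; positivity
    · have := hl k h0 hk.1 hk.2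
      rw [abs_div, abs_one, abs_of_neg (by linarith)]
      have : 1 / -symb N l k ≤ 1 / κ := one_div_le_one_div_of_le hκ (by linarith)
      linarith

/-! ### The critical modes `±1` and Poincaré inequalities -/

/-- The configuration `cos (θ + 2π j / N)`. -/
noncomputable def wave (N : ℕ) [NeZero N] (θ : ℝ) : ZMod N → ℝ := fun j => ph θ j

theorem mult_wave_one {m : ZMod N → ℝ} (hm : ∀ k, m (-k) = m k) (θ : ℝ) :
    mult m (wave N θ) = m 1 • wave N θ := by
  have := mult_wave hm θ 1 0
  simp only [one_mul, add_zero] at this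
  exact this

theorem mult_kap_wave (l θ : ℝ) : mult (kap N l) (wave N θ) = 0 := by
  rw [mult_wave_one (kap_neg l)]; simp [kap]

theorem mult_symb_wave (hN : 3 ≤ N) (l θ : ℝ) : mult (symb N l) (wave N θ) = l • wave N θ := by
  rw [mult_wave_one (symb_neg l), symb_one hN]

theorem wave_dot_mult_kap (l θ : ℝ) (x : ZMod N → ℝ) : wave N θ ⬝ᵥ mult (kap N l) x = 0 := by
  rw [← mult_symm, mult_kap_wave, zero_dotProduct]

theorem wave_dot_mult_symb (hN : 3 ≤ N) (l θ : ℝ) (x : ZMod N → ℝ) :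
    wave N θ ⬝ᵥ mult (symb N l) x = l * (wave N θ ⬝ᵥ x) := by
  rw [← mult_symm, mult_symb_wave hN, smul_dotProduct, smul_eq_mul]

theorem wave_dot_wave (hN : 3 ≤ N) (α β : ℝ) :
    wave N α ⬝ᵥ wave N β = N / 2 * Real.cos (α - β) := by
  simp only [dotProduct, wave, ph_mul, sub_self, ph_zero_right]
  rw [← sum_div, sum_add_distrib]
  have := sum_ph (N := N) (α + β) 2 0
  rw [if_neg (two_ne_zero_zmod hN)] at this
  have h2 : ∑ x : ZMod N, ph (α + β) (x + x) = 0 := by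
    rw [← this]; exact sum_congr rfl fun j _ => by congr 1; ring
  rw [h2]
  simp [ZMod.card]; ring

theorem norm_wave_le (θ : ℝ) : ‖wave N θ‖ ≤ 1 :=
  (pi_norm_le_iff_of_nonneg zero_le_one).2 fun j => abs_ph_le θ j

theorem wave_add (α β : ℝ) :
    wave N (α + β) = Real.cos β • wave N α + Real.sin β • wave N (α + Real.pi / 2) := by
  ext j; simp only [wave, Pi.add_apply, Pi.smul_apply, smul_eq_mul]; exact ph_add α β j

/-- Orthogonal decomposition into the modes `±1` and the others. -/
theorem sub_mult_pw (hN : 3 ≤ N) (θ : ℝ) (x : ZMod N → ℝ) :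
    x - mult (pw N) x = (2 / N * (wave N θ ⬝ᵥ x)) • wave N θ
      + (2 / N * (wave N (θ + Real.pi / 2) ⬝ᵥ x)) • wave N (θ + Real.pi / 2) := by
  conv_lhs => enter [1]; rw [← mult_one x]
  rw [← mult_sub_symbol]
  ext j
  simp only [mult_apply, Pi.add_apply, Pi.smul_apply, smul_eq_mul, Pi.sub_apply, Pi.one_apply]
  have e : ∀ k : ZMod N, (1 - pw N k) * ∑ l : ZMod N, co (k * (j - l)) * x l
      = (if k = 1 then ∑ l : ZMod N, co (j - l) * x l else 0)
        + if k = -1 then ∑ l : ZMod N, co (j - l) * x l else 0 := by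
    intro k
    simp only [pw]
    by_cases h1 : k = 1
    · subst h1; simp [one_ne_neg_one_zmod hN]
    · by_cases h2 : k = -1
      · subst h2
        rw [if_pos (Or.inr rfl), if_neg (one_ne_neg_one_zmod hN).symm, if_pos rfl]
        simp only [neg_mul, one_mul, co_neg]; ring
      · simp [h1, h2]
  simp only [e, sum_add_distrib, sum_ite_eq', mem_univ, if_true, dotProduct, mul_sum, sum_mul]
  rw [← sum_add_distrib, ← sum_add_distrib, mul_sum]
  refine sum_congr rfl fun l _ => ?_
  simp only [wave]
  have h1 := ph_mul θ θ j l
  have h2 := ph_mul (θ + Real.pi / 2) (θ + Real.pi / 2) j l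
  have h3 : ph (θ + Real.pi / 2 + (θ + Real.pi / 2)) (j + l) = - ph (θ + θ) (j + l) := by
    rw [show θ + Real.pi / 2 + (θ + Real.pi / 2) = θ + θ + Real.pi by ring, ph_add]; simp
  rw [h3] at h2
  simp only [sub_self] at h1 h2
  linear_combination (-2 / N * x l) * (h1 + h2)

/-- Polar coordinates for the modes `±1`. -/
theorem exists_polar (hN : 3 ≤ N) (x : ZMod N → ℝ) :
    ∃ ρ θ : ℝ, 0 ≤ ρ ∧ x = (2 * ρ) • wave N θ + mult (pw N) x := by
  -- The two coefficients on the critical plane form one complex number; its modulus is `2ρ` and its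
  -- argument is `θ`.
  set z : ℂ := ⟨2 / N * (wave N 0 ⬝ᵥ x), 2 / N * (wave N (0 + Real.pi / 2) ⬝ᵥ x)⟩ with hz
  refine ⟨‖z‖ / 2, z.arg, by positivity, ?_⟩
  have h := sub_mult_pw hN 0 x
  have h1 : 2 / N * (wave N 0 ⬝ᵥ x) = ‖z‖ * Real.cos z.arg := by
    rw [Complex.norm_mul_cos_arg]
  have h2 : 2 / N * (wave N (0 + Real.pi / 2) ⬝ᵥ x) = ‖z‖ * Real.sin z.arg := by
    rw [Complex.norm_mul_sin_arg]
  rw [h1, h2, mul_smul, mul_smul, ← smul_add, ← wave_add, zero_add] at h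
  rw [mul_div_cancel₀ _ (two_ne_zero), ← h]; abel

/-- Spectral gap on the orthogonal complement of the modes `0, ±1`. -/
theorem dot_symb_le_neg {l κ : ℝ}
    (h : ∀ k : ZMod N, k ≠ 0 → k ≠ 1 → k ≠ -1 → symb N l k ≤ -κ) {u : ZMod N → ℝ}
    (h0 : ∑ j, u j = 0) (h1 : ∀ θ, wave N θ ⬝ᵥ u = 0) :
    u ⬝ᵥ mult (symb N l) u ≤ -κ * (u ⬝ᵥ u) := by
  have e : u ⬝ᵥ u = u ⬝ᵥ mult (1 : ZMod N → ℝ) u := by rw [mult_one u]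
  rw [e, dotProduct_mult_self, dotProduct_mult_self, mul_left_comm]
  refine mul_le_mul_of_nonneg_left ?_ (by positivity)
  rw [mul_sum]
  refine sum_le_sum fun k _ => ?_
  rw [Pi.one_apply, one_mul]
  have h1' : ∀ θ, ∑ j, u j * ph θ j = 0 := fun θ => by
    rw [← h1 θ, dotProduct]; exact sum_congr rfl fun j _ => mul_comm _ _
  by_cases hk0 : k = 0
  · subst hk0
    simp [ph_zero_right, h0]
  by_cases hk1 : k = 1
  · subst hk1; simp [h1']
  by_cases hk2 : k = -1
  · subst hk2; simp [ph_neg, h1']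
  exact mul_le_mul_of_nonneg_right (h k hk0 hk1 hk2) (by positivity)

/-- A discrete Poincaré inequality. -/
theorem dot_symb_le (hN : 3 ≤ N) {l : ℝ} (hl : l ≤ 1) {u : ZMod N → ℝ} (h0 : ∑ j, u j = 0) :
    u ⬝ᵥ mult (symb N l) u ≤ l * (u ⬝ᵥ u) := by
  have e : u ⬝ᵥ u = u ⬝ᵥ mult (1 : ZMod N → ℝ) u := by rw [mult_one u]
  rw [e, dotProduct_mult_self, dotProduct_mult_self, mul_left_comm]
  refine mul_le_mul_of_nonneg_left ?_ (by positivity)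
  rw [mul_sum]
  refine sum_le_sum fun k _ => ?_
  rw [Pi.one_apply, one_mul]
  by_cases hk0 : k = 0
  · subst hk0
    simp [ph_zero_right, h0]
  exact mul_le_mul_of_nonneg_right (symb_le hN hl hk0) (by positivity)

/-! ### Formal power series solutions of the cubic equation -/

section CubicSeq

variable {R : Type*} [CommSemiring R]

/-- The coefficients of the cube of the power series with coefficients `u`. -/
def cube (u : ℕ → R) (d : ℕ) : R :=
  ∑ p ∈ antidiagonal d, ∑ q ∈ antidiagonal p.2, u p.1 * (u q.1 * u q.2)

/-- The sequence with `u 0 = 0`, `u 1 = a` and `u d = K d (cube u d)` for `2 ≤ d`. -/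
def cubicSeq (a : R) (K : ℕ → R → R) (d : ℕ) : R :=
  if d = 0 then 0 else if d = 1 then a else
    K d (∑ p ∈ antidiagonal d, ∑ q ∈ antidiagonal p.2,
      (if _h : p.1 < d then cubicSeq a K p.1 else 0) *
        ((if _h : q.1 < d then cubicSeq a K q.1 else 0) *
          (if _h : q.2 < d then cubicSeq a K q.2 else 0)))
termination_by d

theorem cubicSeq_zero (a : R) (K : ℕ → R → R) : cubicSeq a K 0 = 0 := by
  rw [cubicSeq, if_pos rfl]

theorem cubicSeq_one (a : R) (K : ℕ → R → R) : cubicSeq a K 1 = a := by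
  rw [cubicSeq, if_neg one_ne_zero, if_pos rfl]

theorem cubicSeq_of_two_le (a : R) (K : ℕ → R → R) {d : ℕ} (hd : 2 ≤ d) :
    cubicSeq a K d = K d (cube (cubicSeq a K) d) := by
  rw [cubicSeq, if_neg (by omega), if_neg (by omega), cube]
  congr 1
  -- The guards of the recursive definition are harmless: an index can reach `d` only if the two
  -- others are `0`, and then the product vanishes because the term of index `0` is `0`.
  refine sum_congr rfl fun p hp => sum_congr rfl fun q hq => ?_
  rw [HasAntidiagonal.mem_antidiagonal] at hp hq
  by_cases h1 : p.1 < d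
  · by_cases h2 : q.1 < d
    · by_cases h3 : q.2 < d
      · simp [h1, h2, h3]
      · have : p.1 = 0 := by omega
        simp [this, cubicSeq_zero]
    · have : p.1 = 0 := by omega
      simp [this, cubicSeq_zero]
  · have : q.1 = 0 := by omega
    simp [this, cubicSeq_zero]

theorem cube_congr_of_zero {u v : ℕ → R} (hu : u 0 = 0) (hv : v 0 = 0) {d : ℕ}
    (h : ∀ i < d, u i = v i) : cube u d = cube v d := by
  refine sum_congr rfl fun p hp => sum_congr rfl fun q hq => ?_
  rw [HasAntidiagonal.mem_antidiagonal] at hp hq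
  by_cases h1 : p.1 < d
  · by_cases h2 : q.1 < d
    · by_cases h3 : q.2 < d
      · simp [h _ h1, h _ h2, h _ h3]
      · have : p.1 = 0 := by omega
        simp [this, hu, hv]
    · have : p.1 = 0 := by omega
      simp [this, hu, hv]
  · have : q.1 = 0 := by omega
    simp [this, hu, hv]

/-- A graded family of additive submonoids, closed under multiplication, that contains the data
contains the sequence. -/
theorem cube_mem_of_forall {Q : ℕ → R → Prop} (h0 : ∀ d, Q d 0)
    (hadd : ∀ d x y, Q d x → Q d y → Q d (x + y))
    (hmul : ∀ i j x y, Q i x → Q j y → Q (i + j) (x * y)) {u : ℕ → R} {d : ℕ} (hu0 : u 0 = 0)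
    (hu : ∀ i < d, Q i (u i)) : Q d (cube u d) := by
  have hsum : ∀ {ι : Type} (s : Finset ι) (f : ι → R), (∀ i ∈ s, Q d (f i)) →
      Q d (∑ i ∈ s, f i) := fun s f hf =>
    Finset.sum_induction f (Q d) (fun x y => hadd d x y) (h0 d) hf
  refine hsum _ _ fun p hp => hsum _ _ fun q hq => ?_
  rw [HasAntidiagonal.mem_antidiagonal] at hp hq
  by_cases h1 : p.1 < d
  · by_cases h2 : q.1 < d
    · by_cases h3 : q.2 < d
      · rw [← hp, ← hq]
        exact hmul _ _ _ _ (hu _ h1) (hmul _ _ _ _ (hu _ h2) (hu _ h3))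
      · have : p.1 = 0 := by omega
        simp [this, hu0, h0]
    · have : p.1 = 0 := by omega
      simp [this, hu0, h0]
  · have : q.1 = 0 := by omega
    simp [this, hu0, h0]

/-- Induction principle behind all uses of the recursion: `Q` is taken to be uniform boundedness,
continuity at `l = 0`, or being a trigonometric polynomial of degree `d`. -/
theorem cubicSeq_mem {Q : ℕ → R → Prop} (h0 : ∀ d, Q d 0)
    (hadd : ∀ d x y, Q d x → Q d y → Q d (x + y))
    (hmul : ∀ i j x y, Q i x → Q j y → Q (i + j) (x * y)) {a : R} (ha : Q 1 a)
    {K : ℕ → R → R} (hK : ∀ d x, Q d x → Q d (K d x)) (d : ℕ) : Q d (cubicSeq a K d) := by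
  induction d using Nat.strong_induction_on with
  | _ d ih =>
    rcases Nat.lt_or_ge d 2 with hd | hd
    · interval_cases d
      · rw [cubicSeq_zero]; exact h0 0
      · rw [cubicSeq_one]; exact ha
    · rw [cubicSeq_of_two_le a K hd]
      exact hK _ _ (cube_mem_of_forall h0 hadd hmul (cubicSeq_zero a K) ih)

theorem map_cube {S F : Type*} [CommSemiring S] [FunLike F R S] [RingHomClass F R S] (φ : F)
    (u : ℕ → R) (d : ℕ) : φ (cube u d) = cube (fun i => φ (u i)) d := by
  simp [cube, map_sum, map_mul]

/-- The recursion is natural in the ring. This transports it along field embeddings, evaluations at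
a parameter, and projections of a product ring. -/
theorem map_cubicSeq {S F : Type*} [CommSemiring S] [FunLike F R S] [RingHomClass F R S] (φ : F)
    {a : R} {K : ℕ → R → R} {K' : ℕ → S → S} (hK : ∀ d x, φ (K d x) = K' d (φ x)) (d : ℕ) :
    φ (cubicSeq a K d) = cubicSeq (φ a) K' d := by
  induction d using Nat.strong_induction_on with
  | _ d ih =>
    rcases Nat.lt_or_ge d 2 with hd | hd
    · interval_cases d
      · rw [cubicSeq_zero, cubicSeq_zero, map_zero]
      · rw [cubicSeq_one, cubicSeq_one]
    · rw [cubicSeq_of_two_le a K hd, cubicSeq_of_two_le _ K' hd, hK, map_cube]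
      congr 1
      exact cube_congr_of_zero (by simp [cubicSeq_zero]) (cubicSeq_zero _ _) ih

/-- Three indices with even sum include an even one, where the sequence vanishes. -/
theorem cube_even {u : ℕ → R} {d : ℕ} (hd : Even d) (h0 : u 0 = 0)
    (hu : ∀ i < d, Even i → u i = 0) : cube u d = 0 := by
  refine sum_eq_zero fun p hp => sum_eq_zero fun q hq => ?_
  rw [HasAntidiagonal.mem_antidiagonal] at hp hq
  have key : ∀ i ≤ d, Even i → (i = d → u p.1 * (u q.1 * u q.2) = 0) → u i = 0 ∨
      u p.1 * (u q.1 * u q.2) = 0 := by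
    intro i hi he hid
    rcases hi.lt_or_eq with h | h
    · exact Or.inl (hu i h he)
    · exact Or.inr (hid h)
  rcases Nat.even_or_odd p.1 with h1 | h1
  · rcases key p.1 (by omega) h1 (fun h => by
      have : q.1 = 0 := by omega
      simp [this, h0]) with h | h
    · simp [h]
    · exact h
  · rcases Nat.even_or_odd q.1 with h2 | h2
    · rcases key q.1 (by omega) h2 (fun h => by
        have : p.1 = 0 := by omega
        simp [this, h0]) with h | h
      · simp [h]
      · exact h
    · have h3 : Even q.2 := by
        rw [← hp, ← hq] at hd
        have := h1.add_odd h2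
        rw [← add_assoc] at hd
        exact (Nat.even_add.1 hd).1 this
      rcases key q.2 (by omega) h3 (fun h => by
        have : p.1 = 0 := by omega
        simp [this, h0]) with h | h
      · simp [h]
      · exact h

theorem cubicSeq_even {a : R} {K : ℕ → R → R} (hK : ∀ d, K d 0 = 0) {d : ℕ} (hd : Even d) :
    cubicSeq a K d = 0 := by
  induction d using Nat.strong_induction_on with
  | _ d ih =>
    rcases Nat.lt_or_ge d 2 with h | h
    · interval_cases d
      · exact cubicSeq_zero a K
      · exact absurd hd (by decide)
    · rw [cubicSeq_of_two_le a K h, cube_even hd (cubicSeq_zero a K) fun i hi he => ih i hi he, hK]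

end CubicSeq

/-! ### Nonvanishing of the leading resonant coefficient -/

section Positivity

/-- All terms are nonnegative and the one with indices `(1, 1, d - 2)` is positive. -/
theorem cube_pos {u : ℕ → ℝ} {d : ℕ} (hd : 3 ≤ d) (h0 : u 0 = 0) (hu : ∀ i < d, 0 ≤ u i)
    (h1 : 0 < u 1) (h2 : 0 < u (d - 2)) : 0 < cube u d := by
  have hterm : ∀ p ∈ antidiagonal d, ∀ q ∈ antidiagonal p.2, 0 ≤ u p.1 * (u q.1 * u q.2) := by
    intro p hp q hq
    rw [HasAntidiagonal.mem_antidiagonal] at hp hq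
    by_cases h1 : p.1 < d
    · by_cases h2 : q.1 < d
      · by_cases h3 : q.2 < d
        · exact mul_nonneg (hu _ h1) (mul_nonneg (hu _ h2) (hu _ h3))
        · have : p.1 = 0 := by omega
          simp [this, h0]
      · have : p.1 = 0 := by omega
        simp [this, h0]
    · have : q.1 = 0 := by omega
      simp [this, h0]
  refine sum_pos' (fun p hp => sum_nonneg fun q hq => hterm p hp q hq) ⟨(1, d - 1), ?_, ?_⟩
  · rw [HasAntidiagonal.mem_antidiagonal]; simp; omega
  · refine sum_pos' (fun q hq => hterm _ (by rw [HasAntidiagonal.mem_antidiagonal]; simp; omega) q hq)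
      ⟨(1, d - 2), ?_, ?_⟩
    · rw [HasAntidiagonal.mem_antidiagonal]; simp; omega
    · simp only; positivity

theorem cubicSeq_pos {m : ℕ → ℝ} {M : ℕ} (hm : ∀ d, Odd d → 3 ≤ d → d ≤ M → 0 < m d) {d : ℕ}
    (hd : d ≤ M) : 0 ≤ cubicSeq (1 : ℝ) (fun d x => x / m d) d ∧
      (Odd d → 0 < cubicSeq (1 : ℝ) (fun d x => x / m d) d) := by
  induction d using Nat.strong_induction_on with
  | _ d ih =>
    rcases Nat.even_or_odd d with he | ho
    · rw [cubicSeq_even (by simp) he]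
      exact ⟨le_rfl, fun h => absurd he (Nat.not_even_iff_odd.2 h)⟩
    · suffices 0 < cubicSeq (1 : ℝ) (fun d x => x / m d) d from ⟨this.le, fun _ => this⟩
      rcases Nat.lt_or_ge d 2 with h | h
      · interval_cases d
        · exact absurd ho (by decide)
        · rw [cubicSeq_one]; exact one_pos
      · have h3 : 3 ≤ d := by
          rcases ho with ⟨k, rfl⟩; omega
        rw [cubicSeq_of_two_le _ _ h]
        refine div_pos (cube_pos h3 (cubicSeq_zero _ _) (fun i hi => (ih i hi (by omega)).1)
          (by rw [cubicSeq_one]; exact one_pos) ((ih (d - 2) (by omega) (by omega)).2 ?_))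
          (hm d ho h3 hd)
        exact Nat.Odd.sub_even (by omega) ho even_two

end Positivity

section Galois

/-- The Fourier symbol at `γ = γ₁` of the mode `d`, as a rational function of the root of unity. -/
noncomputable def rootSymb {F : Type*} [Field F] (η : F) (d : ℕ) : F :=
  (η ^ d + (η⁻¹) ^ d - η - η⁻¹) / (2 - η - η⁻¹)

/-- The resonant coefficient, as a rational function of the root of unity. -/
noncomputable def rootCoeff {F : Type*} [Field F] (N : ℕ) (η : F) : F :=
  cube (cubicSeq (1 : F) fun d x => x / rootSymb η d) (2 * N - 1)

/-- The coefficient is built from the root by field operations alone. Division by zero causes no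
trouble, since field homomorphisms respect the convention `x / 0 = 0`. -/
theorem map_rootCoeff {F F' : Type*} [Field F] [Field F'] (φ : F →+* F') (N : ℕ) (η : F) :
    φ (rootCoeff N η) = rootCoeff N (φ η) := by
  rw [rootCoeff, map_cube, rootCoeff]
  congr 1
  ext d
  rw [map_cubicSeq φ (K' := fun d x => x / rootSymb (φ η) d), map_one]
  intro d x
  simp [rootSymb, map_ofNat]

/-- Both roots are images of one primitive root of the `N`-th cyclotomic field over `ℚ` under
complex embeddings, and an embedding of fields neither creates nor destroys zeros. -/
theorem rootCoeff_eq_zero_iff {N : ℕ} [NeZero N] {η η' : ℂ} (hη : IsPrimitiveRoot η N)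
    (hη' : IsPrimitiveRoot η' N) : rootCoeff N η = 0 → rootCoeff N η' = 0 := by
  have : NeZero (N : ℚ) := ⟨Nat.cast_ne_zero.2 (NeZero.ne N)⟩
  have hirr : Irreducible (Polynomial.cyclotomic N ℚ) :=
    Polynomial.cyclotomic.irreducible_rat (NeZero.pos N)
  have inst : IsCyclotomicExtension {N} ℚ (CyclotomicField N ℚ) := by
    convert CyclotomicField.isCyclotomicExtension N ℚ
    · rfl
    · exact Subsingleton.elim _ _
  have hζ := IsCyclotomicExtension.zeta_spec N ℚ (CyclotomicField N ℚ)
  set ζ := IsCyclotomicExtension.zeta N ℚ (CyclotomicField N ℚ)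
  have ex : ∀ ξ : ℂ, IsPrimitiveRoot ξ N → ∃ φ : CyclotomicField N ℚ →+* ℂ, φ ζ = ξ := by
    intro ξ hξ
    set e := hζ.embeddingsEquivPrimitiveRoots ℂ hirr
    refine ⟨(e.symm ⟨ξ, (mem_primitiveRoots (NeZero.pos N)).2 hξ⟩ : CyclotomicField N ℚ →ₐ[ℚ] ℂ), ?_⟩
    have := hζ.embeddingsEquivPrimitiveRoots_apply_coe ℂ hirr
      (e.symm ⟨ξ, (mem_primitiveRoots (NeZero.pos N)).2 hξ⟩)
    rw [Equiv.apply_symm_apply] at this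
    exact this.symm
  obtain ⟨φ, hφ⟩ := ex η hη
  obtain ⟨φ', hφ'⟩ := ex η' hη'
  rw [← hφ, ← hφ', ← map_rootCoeff, ← map_rootCoeff]
  intro h
  rw [(map_eq_zero φ).1 h, map_zero]

/-- The real form of `rootSymb` at `exp (iα)`. -/
theorem rootSymb_exp (α : ℝ) (d : ℕ) : rootSymb (Complex.exp (α * Complex.I)) d
    = (((Real.cos (d * α) - Real.cos α) / (1 - Real.cos α) : ℝ) : ℂ) := by
  have h : ∀ β : ℝ, Complex.exp (β * Complex.I) + (Complex.exp (β * Complex.I))⁻¹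
      = 2 * (Real.cos β : ℝ) := by
    intro β
    rw [← Complex.exp_neg, Complex.ofReal_cos, Complex.cos]
    rw [neg_mul]; ring
  have h1 := h α
  have h2 := h (d * α)
  have h3 : Complex.exp (((d * α : ℝ) : ℂ) * Complex.I) = Complex.exp (α * Complex.I) ^ d := by
    rw [← Complex.exp_nat_mul]; congr 1; push_cast; ring
  rw [h3] at h2
  rw [rootSymb, inv_pow]
  have e1 : Complex.exp (α * Complex.I) ^ d + (Complex.exp (α * Complex.I) ^ d)⁻¹
      - Complex.exp (α * Complex.I) - (Complex.exp (α * Complex.I))⁻¹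
      = 2 * ((Real.cos (d * α) : ℝ) - (Real.cos α : ℝ)) := by linear_combination h2 - h1
  have e2 : 2 - Complex.exp (α * Complex.I) - (Complex.exp (α * Complex.I))⁻¹
      = 2 * (1 - (Real.cos α : ℝ)) := by linear_combination - h1
  rw [e1, e2, mul_div_mul_left _ _ two_ne_zero]
  push_cast; ring

theorem rootCoeff_exp (N : ℕ) (α : ℝ) : rootCoeff N (Complex.exp (α * Complex.I))
    = ((cube (cubicSeq (1 : ℝ) fun d x => x / ((Real.cos (d * α) - Real.cos α) / (1 - Real.cos α)))
      (2 * N - 1) : ℝ) : ℂ) := by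
  have e : ∀ x : ℝ, (x : ℂ) = Complex.ofRealHom x := fun _ => rfl
  rw [e (cube _ _), map_cube, rootCoeff]
  congr 1
  ext d
  rw [map_cubicSeq Complex.ofRealHom (K' := fun d x => x / rootSymb (Complex.exp (α * Complex.I)) d),
    map_one]
  intro d x
  rw [rootSymb_exp, map_div₀]; rfl

/-- For the primitive root of unity closest to `-1` all the relevant symbols are positive. -/
theorem rootCoeff_ne_zero_of_extremal {N : ℕ} (hN : 3 ≤ N) (hodd : Odd N) :
    rootCoeff N (Complex.exp ((2 * Real.pi * ((N - 1) / 2 : ℕ) / N : ℝ) * Complex.I)) ≠ 0 := by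
  rw [rootCoeff_exp, Complex.ofReal_ne_zero]
  obtain ⟨m, rfl⟩ := hodd
  have hm : (2 * m + 1 - 1) / 2 = m := by omega
  rw [hm]
  set N : ℕ := 2 * m + 1 with hNdef
  have hNpos : (0 : ℝ) < N := by positivity
  have hmN : (N : ℝ) = 2 * m + 1 := by rw [hNdef]; push_cast; ring
  have hp := Real.pi_pos
  set α : ℝ := 2 * Real.pi * m / N with hα
  have hα' : α = Real.pi - Real.pi / N := by
    rw [hα]; field_simp; rw [hmN]; ring
  have hcosα : Real.cos α = - Real.cos (Real.pi / N) := by rw [hα', Real.cos_pi_sub]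
  have hlt : Real.pi / N ≤ Real.pi / 3 := by
    have : (3 : ℝ) ≤ N := by exact_mod_cast hN
    exact div_le_div_of_nonneg_left hp.le (by norm_num) this
  have hcpos : 0 < Real.cos (Real.pi / N) :=
    Real.cos_pos_of_mem_Ioo ⟨by have : 0 < Real.pi / N := by positivity
                                linarith, by linarith⟩
  have hpos : ∀ d : ℕ, Odd d → 3 ≤ d → d ≤ 2 * N - 3 →
      0 < (Real.cos (d * α) - Real.cos α) / (1 - Real.cos α) := by
    intro d hd h3 hdN
    refine div_pos ?_ (by rw [hcosα]; linarith)
    -- As `α = π - π/N`, an odd multiple of `α` is `π` minus the same multiple of `π/N`, modulo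
    -- `2π`. The symbol is thus positive exactly when `cos (dπ/N) < cos (π/N)`.
    have e : Real.cos (d * α) = - Real.cos (d * (Real.pi / N)) := by
      obtain ⟨k, rfl⟩ := hd
      rw [hα', show ((2 * k + 1 : ℕ) : ℝ) * (Real.pi - Real.pi / N)
        = (Real.pi - (2 * k + 1 : ℕ) * (Real.pi / N)) + k * (2 * Real.pi) by push_cast; ring,
        Real.cos_add_nat_mul_two_pi, Real.cos_pi_sub]
    rw [e, hcosα]
    have key : Real.cos (d * (Real.pi / N)) < Real.cos (Real.pi / N) := by
      have h3' : (3 : ℝ) ≤ d := by exact_mod_cast h3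
      have hdN' : (d : ℝ) ≤ 2 * N - 3 := by
        have : d + 3 ≤ 2 * N := by omega
        have : (d : ℝ) + 3 ≤ 2 * N := by exact_mod_cast this
        linarith
      have hq : 0 < Real.pi / N := by positivity
      have hNq : N * (Real.pi / N) = Real.pi := by field_simp
      -- Beyond `N` the cosine is reflected at `π`; the bound `d ≤ 2N - 3` keeps the reflected angle
      -- above `π/N`.
      by_cases hh : (d : ℝ) ≤ N
      · exact Real.cos_lt_cos_of_nonneg_of_le_pi hq.le (by nlinarith) (by nlinarith)
      · rw [← Real.cos_two_pi_sub (d * (Real.pi / N))]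
        exact Real.cos_lt_cos_of_nonneg_of_le_pi hq.le (by nlinarith) (by nlinarith)
    linarith
  refine (cube_pos (by omega) (cubicSeq_zero _ _) (fun i hi => ?_)
    (by rw [cubicSeq_one]; exact one_pos) ?_).ne'
  · rcases Nat.even_or_odd i with he | ho
    · rw [cubicSeq_even (by simp) he]
    · have : i ≤ 2 * N - 3 := by
        obtain ⟨k, rfl⟩ := ho; omega
      exact (cubicSeq_pos hpos this).1
  · exact (cubicSeq_pos hpos (by omega)).2 ⟨N - 2, by omega⟩

/-- The leading resonant coefficient does not vanish. -/
theorem cube_cubicSeq_ne_zero {N : ℕ} [NeZero N] (hN : 3 ≤ N) (hodd : Odd N) :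
    cube (cubicSeq (1 : ℝ) fun d x => kap N 0 d * x) (2 * N - 1) ≠ 0 := by
  have hNpos : (0 : ℝ) < N := Nat.cast_pos.2 (NeZero.pos N)
  have h1 : IsPrimitiveRoot (Complex.exp ((2 * Real.pi / N : ℝ) * Complex.I)) N := by
    have := Complex.isPrimitiveRoot_exp N (NeZero.ne N)
    convert this using 2
    push_cast; ring
  have h2 : IsPrimitiveRoot
      (Complex.exp ((2 * Real.pi * ((N - 1) / 2 : ℕ) / N : ℝ) * Complex.I)) N := by
    have hc : ((N - 1) / 2).Coprime N := by
      obtain ⟨m, rfl⟩ := hodd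
      have hm : (2 * m + 1 - 1) / 2 = m := by omega
      rw [hm]
      simp
    have := Complex.isPrimitiveRoot_exp_of_coprime _ N (NeZero.ne N) hc
    convert this using 2
    push_cast; ring
  intro h
  refine rootCoeff_ne_zero_of_extremal hN hodd (rootCoeff_eq_zero_iff h1 h2 ?_)
  rw [rootCoeff_exp, Complex.ofReal_eq_zero, ← h]
  congr 2
  ext d x
  have hs : symb N 0 (d : ZMod N) = (Real.cos (d * (2 * Real.pi / N)) - Real.cos (2 * Real.pi / N))
      / (1 - Real.cos (2 * Real.pi / N)) := by
    have hco : co (d : ZMod N) = Real.cos (d * (2 * Real.pi / N)) := by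
      have := ph_intCast (N := N) 0 d
      rw [Int.cast_natCast] at this
      rw [co, this]; congr 1; push_cast; ring
    have hlt := co_one_lt_one hN
    rw [symb, hco, gammaOne, ← co_one]
    field_simp [(sub_pos.2 hlt).ne']
    ring
  rw [← hs, kap]
  -- At the resonant indices `d ≡ ±1` the symbol is `0`, and `x / 0 = 0` reproduces the value `0`
  -- that `kap` prescribes on these modes.
  split_ifs with hk
  · have : symb N 0 (d : ZMod N) = 0 := by
      rcases hk with hk | hk
      · rw [hk, symb_one hN]
      · rw [hk, symb_neg, symb_one hN]
    rw [this]; simp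
  · ring

end Galois

/-! ### Trigonometric polynomials and aliasing -/

section Trigonometric

/-- The angle `θ + 2π j / N`. -/
noncomputable def ang (θ : ℝ) (j : ZMod N) : ℝ := θ + 2 * Real.pi * j.val / N

theorem wave_eq_cos (θ : ℝ) (j : ZMod N) : wave N θ j = Real.cos (ang θ j) := rfl

theorem wave_add_pi_div_two (θ : ℝ) (j : ZMod N) :
    wave N (θ + Real.pi / 2) j = - Real.sin (ang θ j) := by
  rw [← Real.cos_add_pi_div_two, wave_eq_cos, ang, ang]; congr 1; ring

theorem cos_int_mul_ang (k : ℤ) (θ : ℝ) (j : ZMod N) :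
    Real.cos (k * ang θ j) = ph (k * θ) ((k : ZMod N) * j) := by
  have hj : j = ((j.val : ℤ) : ZMod N) := by simp
  conv_rhs => rw [hj, ← Int.cast_mul, ph_intCast]
  rw [ang]; congr 1; push_cast; ring

theorem sin_int_mul_ang (k : ℤ) (θ : ℝ) (j : ZMod N) :
    Real.sin (k * ang θ j) = ph (k * θ - Real.pi / 2) ((k : ZMod N) * j) := by
  have hj : j = ((j.val : ℤ) : ZMod N) := by simp
  conv_rhs => rw [hj, ← Int.cast_mul, ph_intCast]
  rw [← Real.cos_sub_pi_div_two, ang]; congr 1; push_cast; ring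

/-- The unit complex number with argument `θ + 2π j / N`. -/
noncomputable def unitAng (θ : ℝ) (j : ZMod N) : ℂ := Complex.exp (ang θ j * Complex.I)

/-- `f` is a trigonometric polynomial of degree at most `d` in the angles `θ + 2π j / N`, with
real coefficients given by `p`. -/
def IsTrig (d : ℕ) (f : ℝ → ZMod N → ℝ) (p : Polynomial ℝ) : Prop :=
  p.natDegree ≤ d ∧ ∀ θ j, ((f θ j : ℝ) : ℂ)
    = (unitAng θ j)⁻¹ ^ d * Polynomial.aeval (unitAng θ j ^ 2) p

theorem unitAng_ne_zero (θ : ℝ) (j : ZMod N) : unitAng θ j ≠ 0 := Complex.exp_ne_zero _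

theorem IsTrig.zero (d : ℕ) : IsTrig d (0 : ℝ → ZMod N → ℝ) 0 := ⟨by simp, by simp⟩

theorem IsTrig.add {d : ℕ} {f g : ℝ → ZMod N → ℝ} {p q : Polynomial ℝ} (hf : IsTrig d f p)
    (hg : IsTrig d g q) : IsTrig d (f + g) (p + q) := by
  refine ⟨(Polynomial.natDegree_add_le _ _).trans (max_le hf.1 hg.1), fun θ j => ?_⟩
  simp only [Pi.add_apply, Complex.ofReal_add, hf.2, hg.2, map_add, mul_add]

theorem IsTrig.mul {d e : ℕ} {f g : ℝ → ZMod N → ℝ} {p q : Polynomial ℝ} (hf : IsTrig d f p)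
    (hg : IsTrig e g q) : IsTrig (d + e) (f * g) (p * q) := by
  refine ⟨Polynomial.natDegree_mul_le.trans (add_le_add hf.1 hg.1), fun θ j => ?_⟩
  simp only [Pi.mul_apply, Complex.ofReal_mul, hf.2, hg.2, map_mul, pow_add]
  ring

/-- `2 cos φ = z⁻¹ (1 + z²)` with `z = exp (iφ)`. Working in powers of `z²` records that degree and
frequencies have the same parity, and the factor `2` normalises the extremal coefficient to `1`. -/
theorem isTrig_wave : IsTrig 1 (fun θ => (2 : ℝ) • wave N θ) (1 + Polynomial.X) := by
  refine ⟨by compute_degree, fun θ j => ?_⟩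
  have h0 := unitAng_ne_zero θ j
  simp only [Pi.smul_apply, smul_eq_mul, wave_eq_cos, map_add, map_one, Polynomial.aeval_X, pow_one]
  rw [mul_add, mul_one, sq, inv_mul_cancel_left₀ h0, unitAng, ← Complex.exp_neg,
    Complex.ofReal_mul, Complex.ofReal_cos, Complex.cos]
  rw [neg_mul]; push_cast; ring

theorem unitAng_zpow (k : ℤ) (θ : ℝ) (j : ZMod N) :
    unitAng θ j ^ k = (Real.cos (k * ang θ j) : ℝ) + (Real.sin (k * ang θ j) : ℝ) * Complex.I := by
  rw [unitAng, ← Complex.exp_int_mul, Complex.ofReal_cos, Complex.ofReal_sin,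
    ← Complex.exp_mul_I]
  congr 1; push_cast; ring

theorem re_im_of_mul_eq {a b x S T : ℝ}
    (h : ((a : ℂ) + (b : ℂ) * Complex.I) * (x : ℂ) = (S : ℂ) + (T : ℂ) * Complex.I) :
    a * x = S ∧ b * x = T := by
  have e : ((a : ℂ) + (b : ℂ) * Complex.I) * (x : ℂ)
      = ((a * x : ℝ) : ℂ) + ((b * x : ℝ) : ℂ) * Complex.I := by push_cast; ring
  rw [e] at h
  have h1 := congrArg Complex.re h
  have h2 := congrArg Complex.im h
  simp only [Complex.add_re, Complex.ofReal_re, Complex.re_ofReal_mul, Complex.I_re, mul_zero,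
    add_zero] at h1
  simp only [Complex.add_im, Complex.ofReal_im, Complex.im_ofReal_mul, Complex.I_im, mul_one,
    zero_add] at h2
  exact ⟨h1, h2⟩

theorem IsTrig.eq_sum {d : ℕ} {f : ℝ → ZMod N → ℝ} {p : Polynomial ℝ} (hf : IsTrig d f p)
    (e : ℤ) (θ : ℝ) (j : ZMod N) : unitAng θ j ^ (-e) * ((f θ j : ℝ) : ℂ)
      = ((∑ m ∈ range (d + 1), p.coeff m * Real.cos (((2 * m - d - e : ℤ) : ℝ) * ang θ j) : ℝ) : ℂ)
      + ((∑ m ∈ range (d + 1), p.coeff m * Real.sin (((2 * m - d - e : ℤ) : ℝ) * ang θ j) : ℝ) : ℂ)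
        * Complex.I := by
  have h0 := unitAng_ne_zero θ j
  rw [hf.2, Polynomial.aeval_eq_sum_range' (Nat.lt_succ_of_le hf.1)]
  push_cast
  rw [mul_sum, mul_sum, sum_mul, ← sum_add_distrib]
  refine sum_congr rfl fun m _ => ?_
  have := unitAng_zpow (2 * m - d - e) θ j
  push_cast at this
  rw [mul_assoc, ← mul_add, ← this, inv_pow, ← zpow_natCast, ← zpow_neg, ← pow_mul,
    Complex.real_smul, ← zpow_natCast _ (2 * m), mul_left_comm _ (p.coeff m : ℂ),
    mul_left_comm _ (p.coeff m : ℂ), ← zpow_add₀ h0, ← zpow_add₀ h0]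
  congr 2; push_cast; ring

theorem IsTrig.eq_sum_cos {d : ℕ} {f : ℝ → ZMod N → ℝ} {p : Polynomial ℝ} (hf : IsTrig d f p)
    (θ : ℝ) (j : ZMod N) :
    f θ j = ∑ m ∈ range (d + 1), p.coeff m * Real.cos (((2 * m - d : ℤ) : ℝ) * ang θ j) := by
  have := congrArg Complex.re (hf.eq_sum 0 θ j)
  simpa only [neg_zero, zpow_zero, one_mul, sub_zero, Complex.add_re, Complex.ofReal_re,
    Complex.re_ofReal_mul, Complex.I_re, mul_zero, add_zero] using this

/-- This is the statement that the values of `f` are real. It is needed to rebuild the complex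
identity after a circulant operator has been applied. -/
theorem IsTrig.zero_eq_sum_sin {d : ℕ} {f : ℝ → ZMod N → ℝ} {p : Polynomial ℝ}
    (hf : IsTrig d f p) (θ : ℝ) (j : ZMod N) :
    0 = ∑ m ∈ range (d + 1), p.coeff m * Real.sin (((2 * m - d : ℤ) : ℝ) * ang θ j) := by
  have := congrArg Complex.im (hf.eq_sum 0 θ j)
  simpa only [neg_zero, zpow_zero, one_mul, sub_zero, Complex.add_im, Complex.ofReal_im,
    Complex.im_ofReal_mul, Complex.I_im, mul_one, zero_add] using this

theorem IsTrig.cos_mul {d : ℕ} {f : ℝ → ZMod N → ℝ} {p : Polynomial ℝ} (hf : IsTrig d f p)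
    (θ : ℝ) (j : ZMod N) : wave N θ j * f θ j
      = ∑ m ∈ range (d + 1), p.coeff m * Real.cos (((2 * m - d - 1 : ℤ) : ℝ) * ang θ j) := by
  have := hf.eq_sum 1 θ j
  rw [unitAng_zpow] at this
  rw [← (re_im_of_mul_eq this).1, wave_eq_cos]
  simp

theorem IsTrig.neg_sin_mul {d : ℕ} {f : ℝ → ZMod N → ℝ} {p : Polynomial ℝ} (hf : IsTrig d f p)
    (θ : ℝ) (j : ZMod N) : wave N (θ + Real.pi / 2) j * f θ j
      = ∑ m ∈ range (d + 1), p.coeff m * Real.sin (((2 * m - d - 1 : ℤ) : ℝ) * ang θ j) := by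
  have := hf.eq_sum 1 θ j
  rw [unitAng_zpow] at this
  rw [← (re_im_of_mul_eq this).2, wave_add_pi_div_two]
  simp

theorem isTrig_of_sums {d : ℕ} {f : ℝ → ZMod N → ℝ} {p : Polynomial ℝ} (hp : p.natDegree ≤ d)
    (h1 : ∀ θ j, f θ j = ∑ m ∈ range (d + 1), p.coeff m *
      Real.cos (((2 * m - d : ℤ) : ℝ) * ang θ j))
    (h2 : ∀ θ (j : ZMod N), 0 = ∑ m ∈ range (d + 1), p.coeff m *
      Real.sin (((2 * m - d : ℤ) : ℝ) * ang θ j)) : IsTrig d f p := by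
  refine ⟨hp, fun θ j => ?_⟩
  have h0 := unitAng_ne_zero θ j
  have e : ((f θ j : ℝ) : ℂ) = (f θ j : ℝ) + ((0 : ℝ) : ℂ) * Complex.I := by simp
  rw [e, h1, h2 θ j, Polynomial.aeval_eq_sum_range' (Nat.lt_succ_of_le hp)]
  push_cast
  rw [mul_sum, sum_mul, ← sum_add_distrib]
  refine sum_congr rfl fun m _ => ?_
  have := unitAng_zpow (2 * m - d) θ j
  push_cast at this
  rw [mul_assoc, ← mul_add, ← this, inv_pow, ← zpow_natCast, ← zpow_neg, ← pow_mul,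
    Complex.real_smul, ← zpow_natCast _ (2 * m), mul_left_comm, ← zpow_add₀ h0]
  congr 2; push_cast; ring

/-- A circulant operator acts diagonally on trigonometric polynomials. -/
theorem isTrig_mult {d : ℕ} {f : ℝ → ZMod N → ℝ} {p : Polynomial ℝ} (hf : IsTrig d f p)
    {m : ZMod N → ℝ} (hm : ∀ k, m (-k) = m k) :
    IsTrig d (fun θ => mult m (f θ)) (∑ i ∈ range (d + 1),
      Polynomial.monomial i (m ((2 * i - d : ℤ) : ZMod N) * p.coeff i)) := by
  have hcoeff : ∀ i ∈ range (d + 1), (∑ i ∈ range (d + 1),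
      Polynomial.monomial i (m ((2 * i - d : ℤ) : ZMod N) * p.coeff i)).coeff i
      = m ((2 * i - d : ℤ) : ZMod N) * p.coeff i := by
    intro i hi
    simp only [Polynomial.finsetSum_coeff, Polynomial.coeff_monomial]
    rw [sum_ite_eq', if_pos hi]
  have hw : ∀ (k : ℤ) (α : ℝ), mult m (fun j => ph α ((k : ZMod N) * j))
      = m k • fun j => ph α ((k : ZMod N) * j) := by
    intro k α
    simpa using mult_wave hm α (k : ZMod N) 0
  refine isTrig_of_sums ?_ (fun θ j => ?_) (fun θ j => ?_)
  · refine Polynomial.natDegree_sum_le_of_forall_le _ _ fun i hi => ?_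
    exact (Polynomial.natDegree_monomial_le _).trans (Nat.lt_succ_iff.1 (mem_range.1 hi))
  · have e : f θ = ∑ i ∈ range (d + 1), p.coeff i •
        fun j => ph (((2 * i - d : ℤ) : ℝ) * θ) (((2 * i - d : ℤ) : ZMod N) * j) := by
      ext j
      rw [hf.eq_sum_cos, Finset.sum_apply]
      exact sum_congr rfl fun i _ => by rw [cos_int_mul_ang]; rfl
    rw [e, map_sum, Finset.sum_apply]
    refine sum_congr rfl fun i hi => ?_
    rw [hcoeff i hi, map_smul, hw, cos_int_mul_ang]
    simp only [Pi.smul_apply, smul_eq_mul]; ring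
  · have e : (0 : ZMod N → ℝ) = ∑ i ∈ range (d + 1), p.coeff i •
        fun j => ph (((2 * i - d : ℤ) : ℝ) * θ - Real.pi / 2) (((2 * i - d : ℤ) : ZMod N) * j) := by
      ext j
      rw [Pi.zero_apply, hf.zero_eq_sum_sin θ j, Finset.sum_apply]
      exact sum_congr rfl fun i _ => by rw [sin_int_mul_ang]; rfl
    have e2 := congrFun (congrArg (mult m) e) j
    rw [map_zero, Pi.zero_apply, map_sum, Finset.sum_apply] at e2
    rw [e2]
    refine sum_congr rfl fun i hi => ?_
    rw [hcoeff i hi, map_smul, hw, sin_int_mul_ang]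
    simp only [Pi.smul_apply, smul_eq_mul]; ring

theorem sum_cos_int_mul_ang (k : ℤ) (θ : ℝ) : ∑ j : ZMod N, Real.cos (k * ang θ j)
    = if (k : ZMod N) = 0 then N * Real.cos (k * θ) else 0 := by
  simp only [cos_int_mul_ang]
  have := sum_ph (N := N) (k * θ) k 0
  simpa [ph_zero_right] using this

theorem sum_sin_int_mul_ang (k : ℤ) (θ : ℝ) : ∑ j : ZMod N, Real.sin (k * ang θ j)
    = if (k : ZMod N) = 0 then N * Real.sin (k * θ) else 0 := by
  simp only [sin_int_mul_ang]
  have := sum_ph (N := N) (k * θ - Real.pi / 2) k 0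
  simpa [ph_zero_right, Real.cos_sub_pi_div_two] using this

/-- Among the frequencies `2 m - d - 1` with `m ≤ d` and `d` odd at most `2 N - 1`, only `0` and
`-2 N` are aliased to `0`. -/
theorem alias_cases (hodd : Odd N) {d m : ℕ} (hd : Odd d) (hdN : d ≤ 2 * N - 1) (hm : m ≤ d)
    (h : ((2 * m - d - 1 : ℤ) : ZMod N) = 0) :
    (2 * m - d - 1 : ℤ) = 0 ∨ (m = 0 ∧ d = 2 * N - 1) := by
  rw [ZMod.intCast_zmod_eq_zero_iff_dvd] at h
  obtain ⟨c, hc⟩ := h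
  obtain ⟨a, ha⟩ := hd
  obtain ⟨n, hn⟩ := hodd
  have hN := NeZero.pos N
  have hcN : (N : ℤ) = 2 * n + 1 := by exact_mod_cast hn
  have hda : (d : ℤ) = 2 * a + 1 := by exact_mod_cast ha
  have hdN' : (d : ℤ) ≤ 2 * N - 1 := by omega
  have hm' : (m : ℤ) ≤ d := by exact_mod_cast hm
  have hm0 : (0 : ℤ) ≤ m := by positivity
  have hN0 : (0 : ℤ) < N := by exact_mod_cast hN
  -- The frequency is even and `N` is odd, so a multiple of `N` here is a multiple of `2N`. This is
  -- where oddness of `N` delays the resonance to degree `2N - 1`.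
  have heven : Even c := by
    rcases Int.even_or_odd c with h | h
    · exact h
    · exfalso
      obtain ⟨b, hb⟩ := h
      rw [hda, hb] at hc
      have : (N : ℤ) * (2 * b + 1) = 2 * (N * b + n) + 1 := by rw [mul_add, mul_one]; linarith
      rw [this] at hc
      omega
  obtain ⟨b, hb⟩ := heven
  have h1 : b < 1 := by
    by_contra! hb1
    nlinarith
  have h2 : -2 < b := by
    by_contra! hb1
    nlinarith
  have : b = 0 ∨ b = -1 := by omega
  rcases this with h | h
  · left; rw [hc, hb, h]; simp
  · right
    rw [hb, h] at hc
    constructor <;> omega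

/-- After summation over the ring only the frequencies that are multiples of `N` survive. Frequency
`0` has no sine part, so the alias `-2N`, carried by the extremal coefficient `p.coeff 0`, is all
that remains. -/
theorem IsTrig.wave_dot_tangent (hodd : Odd N) {d : ℕ} {f : ℝ → ZMod N → ℝ}
    {p : Polynomial ℝ} (hf : IsTrig d f p) (hd : Odd d) (hdN : d ≤ 2 * N - 1) (θ : ℝ) :
    wave N (θ + Real.pi / 2) ⬝ᵥ f θ
      = if d = 2 * N - 1 then - (N * p.coeff 0 * Real.sin (2 * N * θ)) else 0 := by
  have hN := NeZero.pos N
  simp only [dotProduct, hf.neg_sin_mul]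
  rw [sum_comm]
  simp only [← mul_sum, sum_sin_int_mul_ang]
  have key : ∀ m ∈ range (d + 1), m ≠ 0 → p.coeff m * (if ((2 * m - d - 1 : ℤ) : ZMod N) = 0 then
      N * Real.sin (((2 * m - d - 1 : ℤ) : ℝ) * θ) else 0) = 0 := by
    intro m hm hm0
    split_ifs with h
    · rcases alias_cases hodd hd hdN (Nat.lt_succ_iff.1 (mem_range.1 hm)) h with h | h
      · rw [h]; simp
      · exact absurd h.1 hm0
    · simp
  rw [sum_eq_single_of_mem 0 (by simp) key]
  split_ifs with h1 h2 h2
  · have : (d : ℤ) = 2 * N - 1 := by omega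
    rw [this, show (((2 * (0 : ℕ) - (2 * N - 1) - 1 : ℤ)) : ℝ) * θ = -(2 * N * θ) by push_cast; ring,
      Real.sin_neg]
    ring
  · rcases alias_cases hodd hd hdN (Nat.zero_le _) h1 with h | h
    · rw [h]; simp
    · exact absurd h.2 h2
  · exfalso
    apply h1
    have : (d : ℤ) = 2 * N - 1 := by omega
    rw [this]; push_cast; simp
  · simp

/-- Below degree `2N - 1` there is no alias: only frequency `0` contributes, and it does not depend
on the angle. -/
theorem IsTrig.wave_dot_const (hodd : Odd N) {d : ℕ} {f : ℝ → ZMod N → ℝ}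
    {p : Polynomial ℝ} (hf : IsTrig d f p) (hd : Odd d) (hdN : d < 2 * N - 1) :
    ∃ c, ∀ θ, wave N θ ⬝ᵥ f θ = c := by
  refine ⟨∑ m ∈ range (d + 1), p.coeff m * if ((2 * m - d - 1 : ℤ) : ZMod N) = 0 then N else 0,
    fun θ => ?_⟩
  simp only [dotProduct, hf.cos_mul]
  rw [sum_comm]
  simp only [← mul_sum, sum_cos_int_mul_ang]
  refine sum_congr rfl fun m hm => ?_
  split_ifs with h
  · rcases alias_cases hodd hd hdN.le (Nat.lt_succ_iff.1 (mem_range.1 hm)) h with h | h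
    · rw [h]; simp
    · omega
  · simp

end Trigonometric

/-! ### Uniform bounds and the expansion in the amplitude -/

theorem abs_dotProduct_le (x y : ZMod N → ℝ) : |x ⬝ᵥ y| ≤ N * (‖x‖ * ‖y‖) := by
  refine (abs_sum_le_sum_abs _ _).trans ?_
  refine (sum_le_sum (g := fun _ => ‖x‖ * ‖y‖) fun j _ => ?_).trans (by simp [ZMod.card])
  rw [abs_mul]
  exact mul_le_mul (norm_le_pi_norm x j) (norm_le_pi_norm y j) (abs_nonneg _) (norm_nonneg _)

theorem hasDerivAt_dotProduct {f g : ℝ → ZMod N → ℝ} {f' g' : ZMod N → ℝ} {θ : ℝ}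
    (hf : HasDerivAt f f' θ) (hg : HasDerivAt g g' θ) :
    HasDerivAt (fun θ => f θ ⬝ᵥ g θ) (f' ⬝ᵥ g θ + f θ ⬝ᵥ g') θ := by
  rw [hasDerivAt_pi] at hf hg
  have := HasDerivAt.fun_sum (u := univ) fun (j : ZMod N) _ => (hf j).mul (hg j)
  rw [sum_add_distrib] at this
  exact this

theorem hasDerivAt_wave (θ : ℝ) : HasDerivAt (wave N) (wave N (θ + Real.pi / 2)) θ := by
  rw [hasDerivAt_pi]
  intro j
  rw [wave_add_pi_div_two]
  have h1 : HasDerivAt (fun θ => ang θ j) 1 θ := (hasDerivAt_id θ).add_const _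
  have h2 := h1.cos
  rw [mul_one] at h2
  exact h2

theorem hasDerivAt_mult (m : ZMod N → ℝ) {f : ℝ → ZMod N → ℝ} {f' : ZMod N → ℝ} {θ : ℝ}
    (hf : HasDerivAt f f' θ) : HasDerivAt (fun θ => mult m (f θ)) (mult m f') θ :=
  ((LinearMap.toContinuousLinearMap (mult m)).hasFDerivAt (x := f θ)).comp_hasDerivAt θ hf

/-- Families of configurations, depending on the parameter `l` and on the angle, which are
bounded together with their derivative in the angle, uniformly as `l → 0`. -/
def Bd (f : ℝ → ℝ → ZMod N → ℝ) : Prop :=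
  ∃ C : ℝ, 0 ≤ C ∧ ∀ᶠ l in 𝓝[>] (0 : ℝ), ∀ θ,
    DifferentiableAt ℝ (f l) θ ∧ ‖f l θ‖ ≤ C ∧ ‖deriv (f l) θ‖ ≤ C

theorem Bd.zero : Bd (0 : ℝ → ℝ → ZMod N → ℝ) :=
  ⟨0, le_rfl, Eventually.of_forall fun l θ => by
    refine ⟨differentiableAt_const _, by simp, ?_⟩
    have : (0 : ℝ → ℝ → ZMod N → ℝ) l = fun _ => 0 := rfl
    rw [this, deriv_const, norm_zero]⟩

theorem Bd.add {f g : ℝ → ℝ → ZMod N → ℝ} (hf : Bd f) (hg : Bd g) : Bd (f + g) := by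
  obtain ⟨C, hC, hf⟩ := hf
  obtain ⟨D, hD, hg⟩ := hg
  refine ⟨C + D, by positivity, ?_⟩
  filter_upwards [hf, hg] with l hf hg θ
  obtain ⟨f1, f2, f3⟩ := hf θ
  obtain ⟨g1, g2, g3⟩ := hg θ
  refine ⟨f1.add g1, norm_add_le_of_le f2 g2, ?_⟩
  rw [Pi.add_apply, deriv_add f1 g1]
  exact norm_add_le_of_le f3 g3

theorem Bd.mul {f g : ℝ → ℝ → ZMod N → ℝ} (hf : Bd f) (hg : Bd g) : Bd (f * g) := by
  obtain ⟨C, hC, hf⟩ := hf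
  obtain ⟨D, hD, hg⟩ := hg
  refine ⟨C * D + C * D, by positivity, ?_⟩
  filter_upwards [hf, hg] with l hf hg θ
  obtain ⟨f1, f2, f3⟩ := hf θ
  obtain ⟨g1, g2, g3⟩ := hg θ
  have hCD : 0 ≤ C * D := by positivity
  have h := f1.hasDerivAt.mul g1.hasDerivAt
  refine ⟨h.differentiableAt, ?_, ?_⟩
  · exact (norm_mul_le_of_le f2 g2).trans (by linarith)
  · rw [Pi.mul_apply, h.deriv]
    exact norm_add_le_of_le (norm_mul_le_of_le f3 g2) (norm_mul_le_of_le f2 g3)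

theorem Bd.sum {ι : Type*} (s : Finset ι) {f : ι → ℝ → ℝ → ZMod N → ℝ}
    (hf : ∀ i ∈ s, Bd (f i)) : Bd (∑ i ∈ s, f i) :=
  Finset.sum_induction f Bd (fun _ _ => Bd.add) Bd.zero hf

theorem Bd.mult_kap (hN : 3 ≤ N) {f : ℝ → ℝ → ZMod N → ℝ} (hf : Bd f) :
    Bd fun l θ => mult (kap N l) (f l θ) := by
  obtain ⟨C, hC, hf⟩ := hf
  obtain ⟨D, hD, hg⟩ := exists_norm_kap_le hN
  refine ⟨D * C, by positivity, ?_⟩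
  filter_upwards [hf, hg] with l hf hg θ
  obtain ⟨f1, f2, f3⟩ := hf θ
  have h := hasDerivAt_mult (kap N l) f1.hasDerivAt
  refine ⟨h.differentiableAt, (hg _).trans (by gcongr), ?_⟩
  rw [h.deriv]
  exact (hg _).trans (by gcongr)

theorem bd_wave : Bd fun (_ : ℝ) θ => (2 : ℝ) • wave N θ := by
  refine ⟨2, by norm_num, Eventually.of_forall fun l θ => ?_⟩
  have h : HasDerivAt (fun θ => (2 : ℝ) • wave N θ) ((2 : ℝ) • wave N (θ + Real.pi / 2)) θ :=
    (hasDerivAt_wave (N := N) θ).fun_const_smul (2 : ℝ)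
  have key : ∀ θ, ‖(2 : ℝ) • wave N θ‖ ≤ 2 := fun θ => by
    rw [norm_smul]; have := norm_wave_le (N := N) θ; norm_num; exact this
  exact ⟨h.differentiableAt, key θ, h.deriv ▸ key _⟩

theorem exists_bound_sum_pow (n : ℕ) {W : ℕ → ℝ → ℝ → ZMod N → ℝ} (hW : ∀ d, Bd (W d)) :
    ∃ C : ℝ, 0 ≤ C ∧ ∀ᶠ l in 𝓝[>] (0 : ℝ), ∀ ρ : ℝ, 0 ≤ ρ → ρ ≤ 1 → ∀ θ,
      DifferentiableAt ℝ (fun θ => ∑ d ∈ range n, ρ ^ d • W d l θ) θ ∧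
      ‖∑ d ∈ range n, ρ ^ d • W d l θ‖ ≤ C ∧
      ‖deriv (fun θ => ∑ d ∈ range n, ρ ^ d • W d l θ) θ‖ ≤ C := by
  choose C hC h using hW
  refine ⟨∑ d ∈ range n, C d, sum_nonneg fun d _ => hC d, ?_⟩
  have h' : ∀ᶠ l in 𝓝[>] (0 : ℝ), ∀ d ∈ range n, ∀ θ,
      DifferentiableAt ℝ (W d l) θ ∧ ‖W d l θ‖ ≤ C d ∧ ‖deriv (W d l) θ‖ ≤ C d :=
    (eventually_all_finset _).2 fun d _ => h d
  filter_upwards [h'] with l hl ρ h0 h1 θ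
  have hd : HasDerivAt (fun θ => ∑ d ∈ range n, ρ ^ d • W d l θ)
      (∑ d ∈ range n, ρ ^ d • deriv (W d l) θ) θ :=
    HasDerivAt.fun_sum fun d hd => (hl d hd θ).1.hasDerivAt.fun_const_smul _
  have hsm : ∀ (d : ℕ) (v : ZMod N → ℝ), ‖v‖ ≤ C d → ‖ρ ^ d • v‖ ≤ C d := fun d v hv => by
    rw [norm_smul, Real.norm_eq_abs, abs_of_nonneg (pow_nonneg h0 d)]
    exact (mul_le_of_le_one_left (norm_nonneg _) (pow_le_one₀ h0 h1)).trans hv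
  refine ⟨hd.differentiableAt, norm_sum_le_of_le _ fun d hd => hsm d _ (hl d hd θ).2.1, ?_⟩
  rw [hd.deriv]
  exact norm_sum_le_of_le _ fun d hd => hsm d _ (hl d hd θ).2.2

/-- The coefficients of the expansion in the amplitude of the solutions of the bifurcation
equation. -/
noncomputable def expCoeff (N : ℕ) [NeZero N] : ℕ → ℝ → ℝ → ZMod N → ℝ :=
  cubicSeq (fun _ θ => (2 : ℝ) • wave N θ) fun _ f l θ => mult (kap N l) (f l θ)

/-- The extremal Fourier coefficients of `expCoeff`. -/
noncomputable def topCoeff (N : ℕ) [NeZero N] (l : ℝ) : ℕ → ℝ :=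
  cubicSeq 1 fun d x => kap N l d * x

/-- The leading resonant coefficient. -/
noncomputable def resCoeff (N : ℕ) [NeZero N] (l : ℝ) : ℝ := cube (topCoeff N l) (2 * N - 1)

theorem bd_expCoeff (hN : 3 ≤ N) (d : ℕ) : Bd (expCoeff N d) :=
  cubicSeq_mem (Q := fun _ f => Bd f) (fun _ => Bd.zero) (fun _ _ _ => Bd.add)
    (fun _ _ _ _ => Bd.mul) bd_wave (fun _ _ h => h.mult_kap hN) d

theorem bd_cube_expCoeff (hN : 3 ≤ N) (d : ℕ) : Bd (cube (expCoeff N) d) :=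
  cube_mem_of_forall (Q := fun _ f => Bd f) (fun _ => Bd.zero) (fun _ _ _ => Bd.add)
    (fun _ _ _ _ => Bd.mul) (cubicSeq_zero _ _) fun _ _ => bd_expCoeff hN _

/-- Extremal coefficients multiply under products, and `kap` acts on frequency `-d` as on `d`. They
therefore satisfy the scalar recursion defining `topCoeff`. -/
theorem isTrig_cube_expCoeff (l : ℝ) (d : ℕ) :
    ∃ p, IsTrig d (cube (expCoeff N) d l) p ∧ p.coeff 0 = cube (topCoeff N l) d := by
  set Q : ℕ → (ℝ → ZMod N → ℝ) × ℝ → Prop := fun d x => ∃ p, IsTrig d x.1 p ∧ p.coeff 0 = x.2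
    with hQ
  -- The recursion is run in a product ring, pairing each function with its extremal coefficient, so
  -- that one induction controls both.
  set K : ℕ → (ℝ → ZMod N → ℝ) × ℝ → (ℝ → ZMod N → ℝ) × ℝ :=
    fun d x => (fun θ => mult (kap N l) (x.1 θ), kap N l d * x.2) with hK
  set a : (ℝ → ZMod N → ℝ) × ℝ := (fun θ => (2 : ℝ) • wave N θ, 1) with ha
  have h0 : ∀ d, Q d 0 := fun d => ⟨0, IsTrig.zero d, by simp⟩
  have hadd : ∀ d x y, Q d x → Q d y → Q d (x + y) := by
    rintro d x y ⟨p, hp, hp'⟩ ⟨q, hq, hq'⟩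
    exact ⟨p + q, hp.add hq, by rw [Polynomial.coeff_add, hp', hq']; rfl⟩
  have hmul : ∀ i j x y, Q i x → Q j y → Q (i + j) (x * y) := by
    rintro i j x y ⟨p, hp, hp'⟩ ⟨q, hq, hq'⟩
    exact ⟨p * q, hp.mul hq, by rw [Polynomial.mul_coeff_zero, hp', hq']; rfl⟩
  have hKQ : ∀ d x, Q d x → Q d (K d x) := by
    rintro d x ⟨p, hp, hp'⟩
    refine ⟨_, isTrig_mult hp (kap_neg l), ?_⟩
    simp only [Polynomial.finsetSum_coeff, Polynomial.coeff_monomial]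
    rw [sum_ite_eq', if_pos (by simp), hp']
    simp [hK, kap_neg]
  have ha1 : Q 1 a := ⟨_, isTrig_wave, by simp [ha]⟩
  have hmem := cube_mem_of_forall h0 hadd hmul (cubicSeq_zero a K) (d := d)
    fun i _ => cubicSeq_mem h0 hadd hmul ha1 hKQ i
  obtain ⟨p, hp, hp'⟩ := hmem
  have e1 : (cube (cubicSeq a K) d).1 = cube (expCoeff N) d l := by
    have h1 := map_cube (RingHom.fst (ℝ → ZMod N → ℝ) ℝ) (cubicSeq a K) d
    have h2 := map_cube (Pi.evalRingHom (fun _ : ℝ => ℝ → ZMod N → ℝ) l) (expCoeff N) d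
    refine h1.trans (Eq.trans ?_ h2.symm)
    congr 1
    ext1 i
    rw [expCoeff, map_cubicSeq (RingHom.fst (ℝ → ZMod N → ℝ) ℝ)
        (K' := fun _ f θ => mult (kap N l) (f θ)) (fun _ _ => rfl),
      map_cubicSeq (Pi.evalRingHom (fun _ : ℝ => ℝ → ZMod N → ℝ) l)
        (K' := fun _ f θ => mult (kap N l) (f θ)) (fun _ _ => rfl)]
    rfl
  have e2 : (cube (cubicSeq a K) d).2 = cube (topCoeff N l) d := by
    refine (map_cube (RingHom.snd (ℝ → ZMod N → ℝ) ℝ) (cubicSeq a K) d).trans ?_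
    congr 1
    ext1 i
    rw [topCoeff, map_cubicSeq (RingHom.snd (ℝ → ZMod N → ℝ) ℝ)
        (K' := fun d x => kap N l d * x) (fun _ _ => rfl)]
    rfl
  exact ⟨p, e1 ▸ hp, hp'.trans e2⟩

theorem tendsto_kap (hN : 3 ≤ N) (k : ZMod N) : ContinuousAt (fun l => kap N l k) 0 := by
  unfold kap
  split_ifs with h
  · exact continuousAt_const
  · push Not at h
    refine ContinuousAt.div continuousAt_const (continuous_symb k).continuousAt ?_
    by_cases h0 : k = 0
    · rw [h0, symb_zero_right]; exact one_ne_zero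
    · exact (symb_zero_neg hN h0 h.1 h.2).ne

theorem continuousAt_resCoeff (hN : 3 ≤ N) : ContinuousAt (resCoeff N) 0 := by
  set u : ℕ → ℝ → ℝ := cubicSeq 1 (fun d f l => kap N l d * f l) with hu
  set Q : ℕ → (ℝ → ℝ) → Prop := fun _ f => ContinuousAt f 0 with hQ
  have h0 : ∀ d, Q d 0 := fun _ => continuousAt_const
  have h1 : Q 1 1 := continuousAt_const
  have hadd : ∀ d x y, Q d x → Q d y → Q d (x + y) := fun _ _ _ hf hg => ContinuousAt.add hf hg
  have hmul : ∀ i j x y, Q i x → Q j y → Q (i + j) (x * y) :=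
    fun _ _ _ _ hf hg => ContinuousAt.mul hf hg
  have hK : ∀ (d : ℕ) x, Q d x → Q d (fun l => kap N l d * x l) :=
    fun d x hx => ContinuousAt.mul (tendsto_kap hN _) hx
  have h : Q (2 * N - 1) (cube u (2 * N - 1)) :=
    cube_mem_of_forall h0 hadd hmul (cubicSeq_zero _ _)
      fun i _ => cubicSeq_mem h0 hadd hmul h1 hK i
  have e : cube u (2 * N - 1) = resCoeff N := by
    ext l
    have h2 : ∀ i, u i l = topCoeff N l i := fun i =>
      map_cubicSeq (Pi.evalRingHom (fun _ : ℝ => ℝ) l)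
        (K' := fun d x => kap N l d * x) (fun _ _ => rfl) i
    have h3 := map_cube (Pi.evalRingHom (fun _ : ℝ => ℝ) l) u (2 * N - 1)
    rw [Pi.evalRingHom_apply] at h3
    rw [h3, resCoeff]
    congr 1
    ext1 i
    exact h2 i
  exact e ▸ h

theorem resCoeff_zero_ne_zero (hN : 3 ≤ N) (hodd : Odd N) : resCoeff N 0 ≠ 0 :=
  cube_cubicSeq_ne_zero hN hodd

theorem cube_of_lt {R : Type*} [CommSemiring R] {u : ℕ → R} (h0 : u 0 = 0) {d : ℕ} (hd : d < 3) :
    cube u d = 0 := by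
  refine sum_eq_zero fun p hp => sum_eq_zero fun q hq => ?_
  rw [HasAntidiagonal.mem_antidiagonal] at hp hq
  have : p.1 = 0 ∨ q.1 = 0 ∨ q.2 = 0 := by omega
  rcases this with h | h | h <;> simp [h, h0]

theorem expCoeff_eq (d : ℕ) (l θ : ℝ) : expCoeff N d l θ
    = (if d = 1 then (2 : ℝ) • wave N θ else 0) + mult (kap N l) (cube (expCoeff N) d l θ) := by
  rcases Nat.lt_or_ge d 2 with hd | hd
  · have h0 : cube (expCoeff N) d = 0 := cube_of_lt (cubicSeq_zero _ _) (by omega)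
    rw [h0]
    interval_cases d
    · rw [expCoeff, cubicSeq_zero]; simp
    · rw [expCoeff, cubicSeq_one]; simp
  · rw [if_neg (by omega), zero_add]
    conv_lhs => rw [expCoeff, cubicSeq_of_two_le _ _ hd]
    rfl

/-- The truncated series is treated as a polynomial in the amplitude over the ring of families of
configurations. Its cube agrees with the formal cube below degree `2N`, and the higher coefficients
form the tail. -/
theorem exists_tail (hN : 3 ≤ N) : ∃ W : ℕ → ℝ → ℝ → ZMod N → ℝ, (∀ d, Bd (W d)) ∧
    ∀ (ρ l θ : ℝ), (∑ d ∈ range (2 * N), ρ ^ d • expCoeff N d l θ) ^ 3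
      = ∑ d ∈ range (2 * N), ρ ^ d • cube (expCoeff N) d l θ
        + ρ ^ (2 * N) • ∑ d ∈ range (4 * N), ρ ^ d • W d l θ := by
  set P : Polynomial (ℝ → ℝ → ZMod N → ℝ) :=
    ∑ d ∈ range (2 * N), Polynomial.monomial d (expCoeff N d) with hP
  have hPc : ∀ i, P.coeff i = if i < 2 * N then expCoeff N i else 0 := by
    intro i
    simp only [hP, Polynomial.finsetSum_coeff, Polynomial.coeff_monomial, sum_ite_eq', mem_range]
  have hPdeg : P.natDegree ≤ 2 * N := by
    refine Polynomial.natDegree_sum_le_of_forall_le _ _ fun i hi => ?_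
    exact (Polynomial.natDegree_monomial_le _).trans (mem_range.1 hi).le
  have hPB : ∀ i, Bd (P.coeff i) := by
    intro i; rw [hPc]; split_ifs
    · exact bd_expCoeff hN i
    · exact Bd.zero
  set P3 := P * (P * P) with hP3
  have hP3deg : P3.natDegree < 2 * N + 4 * N + 1 := by
    have h1 := Polynomial.natDegree_mul_le (p := P) (q := P * P)
    have h2 := Polynomial.natDegree_mul_le (p := P) (q := P)
    rw [← hP3] at h1
    omega
  have hP3B : ∀ i, Bd (P3.coeff i) := by
    intro i
    rw [hP3, Polynomial.coeff_mul]
    refine Bd.sum _ fun p _ => (hPB _).mul ?_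
    rw [Polynomial.coeff_mul]
    exact Bd.sum _ fun q _ => (hPB _).mul (hPB _)
  have hP3c : ∀ d < 2 * N, P3.coeff d = cube (expCoeff N) d := by
    intro d hd
    rw [hP3, Polynomial.coeff_mul, cube]
    refine sum_congr rfl fun p hp => ?_
    rw [Polynomial.coeff_mul, mul_sum]
    refine sum_congr rfl fun q hq => ?_
    rw [HasAntidiagonal.mem_antidiagonal] at hp hq
    rw [hPc, hPc, hPc, if_pos (by omega), if_pos (by omega), if_pos (by omega)]
  -- The crude degree bound leaves room for degree `6N`. Its coefficient vanishes since one of three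
  -- indices summing to `6N` must reach `2N`; this trims the tail to `4N` terms.
  have hP3top : P3.coeff (2 * N + 4 * N) = 0 := by
    rw [hP3, Polynomial.coeff_mul]
    refine sum_eq_zero fun p hp => ?_
    rw [Polynomial.coeff_mul, mul_sum]
    refine sum_eq_zero fun q hq => ?_
    rw [HasAntidiagonal.mem_antidiagonal] at hp hq
    have : 2 * N ≤ p.1 ∨ 2 * N ≤ q.1 ∨ 2 * N ≤ q.2 := by omega
    rcases this with h | h | h
    · rw [hPc p.1, if_neg (by omega)]; simp
    · rw [hPc q.1, if_neg (by omega)]; simp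
    · rw [hPc q.2, if_neg (by omega)]; simp
  refine ⟨fun d => P3.coeff (2 * N + d), fun d => hP3B _, fun ρ l θ => ?_⟩
  set c : ℝ → ℝ → ZMod N → ℝ := fun _ _ _ => ρ with hc
  have hterm : ∀ (d : ℕ) (f : ℝ → ℝ → ZMod N → ℝ), (f * c ^ d) l θ = ρ ^ d • f l θ := by
    intro d f
    ext j
    simp only [Pi.mul_apply, Pi.pow_apply, Pi.smul_apply, smul_eq_mul, hc]; ring
  have e1 : (P.eval c) l θ = ∑ d ∈ range (2 * N), ρ ^ d • expCoeff N d l θ := by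
    rw [hP, Polynomial.eval_finsetSum]
    simp only [Finset.sum_apply, Polynomial.eval_monomial, hterm]
  have e2 : (P3.eval c) l θ = (∑ d ∈ range (2 * N), ρ ^ d • expCoeff N d l θ) ^ 3 := by
    rw [hP3, Polynomial.eval_mul, Polynomial.eval_mul]
    simp only [Pi.mul_apply, e1]; ring
  rw [← e2, Polynomial.eval_eq_sum_range' hP3deg, sum_range_succ, hP3top, zero_mul, add_zero,
    sum_range_add]
  simp only [Pi.add_apply, Finset.sum_apply, hterm]
  congr 1
  · exact sum_congr rfl fun d hd => by rw [hP3c d (mem_range.1 hd)]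
  · rw [smul_sum]
    exact sum_congr rfl fun d _ => by rw [smul_smul, pow_add]

/-! ### Approximate solutions of the bifurcation equations -/

/-- `Φ` solves, up to the small remainder `Rem`, the stationarity equation projected on the modes
other than `±1`, with first mode of amplitude `ρ` and angle `θ`. -/
structure IsApprox (N : ℕ) [NeZero N] (C l ρ : ℝ) (Φ Rem : ℝ → ZMod N → ℝ) : Prop where
  diff : Differentiable ℝ Φ
  diff_rem : Differentiable ℝ Rem
  eq : ∀ θ, Φ θ = (2 * ρ) • wave N θ + mult (kap N l) (Φ θ ^ 3 - Rem θ)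
  norm_le : ∀ θ, ‖Φ θ‖ ≤ C * ρ
  norm_deriv_le : ∀ θ, ‖deriv Φ θ‖ ≤ C * ρ
  norm_rem_le : ∀ θ, ‖Rem θ‖ ≤ C * ρ ^ (2 * N)
  norm_deriv_rem_le : ∀ θ, ‖deriv Rem θ‖ ≤ C * ρ ^ (2 * N)
  tangent : ∀ θ, wave N (θ + Real.pi / 2) ⬝ᵥ (Φ θ ^ 3 - Rem θ)
    = - (N * resCoeff N l * ρ ^ (2 * N - 1) * Real.sin (2 * N * θ))
  radial : ∀ θ, |deriv (fun θ => wave N θ ⬝ᵥ (Φ θ ^ 3 - Rem θ)) θ| ≤ C * ρ ^ (2 * N - 1)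

/-- `Φ` is the formal solution truncated below degree `2N`, and `Rem` is the part of its cube of
degree at least `2N`. Then `Φ ^ 3 - Rem` is exactly the truncated formal cube, so its tangential and
radial components are read off degree by degree. -/
theorem exists_isApprox (hN : 3 ≤ N) (hodd : Odd N) : ∃ C : ℝ, 0 < C ∧ ∀ᶠ l in 𝓝[>] (0 : ℝ),
    ∀ ρ : ℝ, 0 ≤ ρ → ρ ≤ 1 → ∃ Φ Rem, IsApprox N C l ρ Φ Rem := by
  obtain ⟨W, hW, htail⟩ := exists_tail hN
  obtain ⟨C1, hC1, h1⟩ := exists_bound_sum_pow (2 * N - 1) (W := fun d => expCoeff N (d + 1))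
    fun d => bd_expCoeff hN _
  obtain ⟨C2, hC2, h2⟩ := exists_bound_sum_pow (4 * N) hW
  obtain ⟨C3, hC3, h3⟩ := bd_cube_expCoeff hN (2 * N - 1)
  have hNpos : (0 : ℝ) < N := Nat.cast_pos.2 (NeZero.pos N)
  set C := C1 + C2 + 2 * N * C3 + 1 with hC
  have hC3' : 0 ≤ 2 * N * C3 := by positivity
  refine ⟨C, by positivity, ?_⟩
  filter_upwards [h1, h2, h3] with l h1 h2 h3 ρ h0 hρ
  set Φ : ℝ → ZMod N → ℝ := fun θ => ∑ d ∈ range (2 * N), ρ ^ d • expCoeff N d l θ with hΦ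
  set S : ℝ → ZMod N → ℝ := fun θ => ∑ d ∈ range (2 * N), ρ ^ d • cube (expCoeff N) d l θ with hS
  set Rem : ℝ → ZMod N → ℝ := fun θ => ρ ^ (2 * N) • ∑ d ∈ range (4 * N), ρ ^ d • W d l θ with hRem
  have hcube : ∀ θ, Φ θ ^ 3 - Rem θ = S θ := fun θ => by
    rw [hΦ, hRem, hS]; simp only; rw [htail]; abel
  have hΦ' : Φ = fun θ => ρ • ∑ d ∈ range (2 * N - 1), ρ ^ d • expCoeff N (d + 1) l θ := by
    ext1 θ
    rw [hΦ]; simp only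
    rw [show 2 * N = (2 * N - 1) + 1 by omega, sum_range_succ', smul_sum]
    have : expCoeff N 0 = 0 := cubicSeq_zero _ _
    rw [this]
    simp [pow_succ', smul_smul]
  have h1' : ∀ θ, HasDerivAt Φ (ρ • deriv (fun θ => ∑ d ∈ range (2 * N - 1),
      ρ ^ d • expCoeff N (d + 1) l θ) θ) θ := fun θ => by
    rw [hΦ']; exact (h1 ρ h0 hρ θ).1.hasDerivAt.fun_const_smul ρ
  have h2' : ∀ θ, HasDerivAt Rem (ρ ^ (2 * N) • deriv (fun θ => ∑ d ∈ range (4 * N),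
      ρ ^ d • W d l θ) θ) θ := fun θ => (h2 ρ h0 hρ θ).1.hasDerivAt.fun_const_smul _
  have hsm : ∀ (r D : ℝ) (v : ZMod N → ℝ), 0 ≤ r → D ≤ C → ‖v‖ ≤ D → ‖r • v‖ ≤ C * r := by
    intro r D v hr hD hv
    rw [norm_smul, Real.norm_eq_abs, abs_of_nonneg hr, mul_comm]
    gcongr; linarith
  refine ⟨Φ, Rem, ⟨fun θ => (h1' θ).differentiableAt, fun θ => (h2' θ).differentiableAt,
    fun θ => ?_, fun θ => ?_, fun θ => ?_, fun θ => ?_, fun θ => ?_, fun θ => ?_, fun θ => ?_⟩⟩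
  · rw [hcube, hS]
    simp only [hΦ, map_sum, map_smul]
    rw [← sum_erase_add (range (2 * N)) _ (mem_range.2 (show 1 < 2 * N by omega)),
      ← sum_erase_add (range (2 * N)) (fun d => ρ ^ d • mult (kap N l) (cube (expCoeff N) d l θ))
        (mem_range.2 (show 1 < 2 * N by omega)), expCoeff_eq 1, if_pos rfl, smul_add, pow_one,
        smul_smul, mul_comm ρ 2, add_left_comm]
    congr 2
    refine sum_congr rfl fun d hd => ?_
    rw [expCoeff_eq, if_neg (mem_erase.1 hd).1, zero_add]
  · rw [hΦ']; exact hsm ρ C1 _ h0 (by linarith) (h1 ρ h0 hρ θ).2.1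
  · rw [(h1' θ).deriv]; exact hsm ρ C1 _ h0 (by linarith) (h1 ρ h0 hρ θ).2.2
  · exact hsm _ C2 _ (by positivity) (by linarith) (h2 ρ h0 hρ θ).2.1
  · rw [(h2' θ).deriv]; exact hsm _ C2 _ (by positivity) (by linarith) (h2 ρ h0 hρ θ).2.2
  · rw [hcube, hS]
    simp only [dotProduct_sum, dotProduct_smul, smul_eq_mul]
    rw [sum_eq_single_of_mem (2 * N - 1) (mem_range.2 (by omega))]
    · obtain ⟨p, hp, hp0⟩ := isTrig_cube_expCoeff (N := N) l (2 * N - 1)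
      rw [hp.wave_dot_tangent hodd ⟨N - 1, by omega⟩ le_rfl, if_pos rfl, hp0, resCoeff]
      ring
    · intro d hd hd'
      obtain ⟨p, hp, hp0⟩ := isTrig_cube_expCoeff (N := N) l d
      rw [mem_range] at hd
      rcases Nat.even_or_odd d with he | ho
      · have : cube (expCoeff N) d = 0 :=
          cube_even he (cubicSeq_zero _ _) fun i _ hi => cubicSeq_even (fun d => by
            ext; simp) hi
        rw [this]; simp
      · rw [hp.wave_dot_tangent hodd ho (by omega), if_neg hd', mul_zero]
  · have key : ∃ c, ∀ θ, wave N θ ⬝ᵥ (Φ θ ^ 3 - Rem θ)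
        = c + ρ ^ (2 * N - 1) * (wave N θ ⬝ᵥ cube (expCoeff N) (2 * N - 1) l θ) := by
      have hc : ∀ d, ∃ c, d ∈ range (2 * N - 1) →
          ∀ θ, wave N θ ⬝ᵥ (cube (expCoeff N) d l θ) = c := by
        intro d
        obtain ⟨p, hp, hp0⟩ := isTrig_cube_expCoeff (N := N) l d
        by_cases hd : d ∈ range (2 * N - 1)
        · rcases Nat.even_or_odd d with he | ho
          · have : cube (expCoeff N) d = 0 :=
              cube_even he (cubicSeq_zero _ _) fun i _ hi => cubicSeq_even (fun d => by
                ext; simp) hi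
            exact ⟨0, fun _ θ => by rw [this]; simp⟩
          · obtain ⟨c, hc⟩ := hp.wave_dot_const hodd ho (mem_range.1 hd)
            exact ⟨c, fun _ => hc⟩
        · exact ⟨0, fun h => absurd h hd⟩
      choose c hc using hc
      refine ⟨∑ d ∈ range (2 * N - 1), ρ ^ d * c d, fun θ => ?_⟩
      rw [hcube, hS]
      simp only [dotProduct_sum, dotProduct_smul, smul_eq_mul]
      conv_lhs => rw [show 2 * N = (2 * N - 1) + 1 by omega, sum_range_succ]
      congr 1
      exact sum_congr rfl fun d hd => by rw [hc d hd θ]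
    obtain ⟨c, hc⟩ := key
    simp only [hc]
    have hd := hasDerivAt_dotProduct (hasDerivAt_wave (N := N) θ) (h3 θ).1.hasDerivAt
    rw [((hd.const_mul (ρ ^ (2 * N - 1))).const_add c).deriv, abs_mul,
      abs_of_nonneg (by positivity), mul_comm]
    refine mul_le_mul_of_nonneg_right ?_ (by positivity)
    have b1 := abs_dotProduct_le (wave N (θ + Real.pi / 2)) (cube (expCoeff N) (2 * N - 1) l θ)
    have b2 := abs_dotProduct_le (wave N θ) (deriv (cube (expCoeff N) (2 * N - 1) l) θ)
    have b3 : ‖wave N (θ + Real.pi / 2)‖ * ‖cube (expCoeff N) (2 * N - 1) l θ‖ ≤ 1 * C3 :=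
      mul_le_mul (norm_wave_le _) (h3 θ).2.1 (norm_nonneg _) zero_le_one
    have b4 : ‖wave N θ‖ * ‖deriv (cube (expCoeff N) (2 * N - 1) l) θ‖ ≤ 1 * C3 :=
      mul_le_mul (norm_wave_le _) (h3 θ).2.2 (norm_nonneg _) zero_le_one
    refine (abs_add_le _ _).trans ?_
    nlinarith

/-! ### A priori bounds and polar form of exact solutions -/

theorem mult_symb_eq_linOp (l : ℝ) (x : ZMod N → ℝ) :
    mult (symb N l) x = linOp ((1 - l) * gammaOne N) x := by
  rw [linOp_eq_mult]; rfl

theorem dist_le_of_abs_succ_sub_le {x : ZMod N → ℝ} {D : ℝ} (h : ∀ j, |x j - x (j + 1)| ≤ D)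
    (i j : ZMod N) : |x i| ≤ |x j| + N * D := by
  have hD : 0 ≤ D := (abs_nonneg _).trans (h 0)
  have key : ∀ n : ℕ, |x (j + n)| ≤ |x j| + n * D := by
    intro n
    induction n with
    | zero => simp
    | succ n ih =>
      have h1 := h (j + n)
      have h2 := abs_sub_abs_le_abs_sub (x (j + n + 1)) (x (j + n))
      rw [abs_sub_comm] at h2
      push_cast
      rw [← add_assoc]
      linarith
  have h1 := key (i - j).val
  rw [ZMod.natCast_val, ZMod.cast_id', id, add_sub_cancel] at h1
  have h2 : ((i - j).val : ℝ) ≤ N := by exact_mod_cast (ZMod.val_lt (i - j)).le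
  nlinarith

/-- A solution of the stationarity equation is either constant or small. -/
theorem const_or_norm_le (hN : 3 ≤ N) {l : ℝ} (hl0 : 0 ≤ l) (hl : l ≤ 1) {x : ZMod N → ℝ}
    (hx : mult (symb N l) x = x ^ 3) :
    (∀ j, x j = x 0) ∨ ‖x‖ ≤ (2 + 2 * N ^ 2) * Real.sqrt l := by
  set d : ZMod N → ℝ := fun j => x j - x (j + 1) with hd
  set q : ZMod N → ℝ := fun j => x j ^ 2 + x j * x (j + 1) + x (j + 1) ^ 2 with hq
  have hsum : ∑ j, d j = 0 := by
    simp only [hd, sum_sub_distrib]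
    rw [sub_eq_zero]
    exact (Equiv.sum_comp (Equiv.addRight (1 : ZMod N)) x).symm
  -- Subtracting the equations at neighbouring sites factors the difference of cubes. With the
  -- Poincaré inequality this gives `∑ d² (q - l) ≤ 0`: either some `q j ≤ l`, or every difference
  -- vanishes.
  have hLd : mult (symb N l) d = d * q := by
    ext j
    rw [mult_symb_eq_linOp] at hx ⊢
    have h1 := congrFun hx j
    have h2 := congrFun hx (j + 1)
    simp only [linOp_apply, Pi.pow_apply, Pi.mul_apply, hd, hq] at h1 h2 ⊢
    rw [show j + 1 - 1 = j - 1 + 1 by ring] at h2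
    linear_combination h1 - h2
  have hineq : ∑ j, d j ^ 2 * q j ≤ l * ∑ j, d j ^ 2 := by
    have := dot_symb_le hN hl hsum
    rw [hLd] at this
    simp only [dotProduct, Pi.mul_apply] at this
    calc _ = ∑ j, d j * (d j * q j) := sum_congr rfl fun j _ => by ring
      _ ≤ _ := this
      _ = _ := by congr 1; exact sum_congr rfl fun j _ => by ring
  by_cases hall : ∃ j, q j ≤ l
  · right
    obtain ⟨j, hj⟩ := hall
    have hs0 := Real.sqrt_nonneg l
    have hs := Real.sq_sqrt hl0
    have hxj : |x j| ≤ 2 * Real.sqrt l := by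
      refine abs_le_of_sq_le_sq ?_ (by positivity)
      simp only [hq] at hj
      nlinarith [sq_nonneg (x j + 2 * x (j + 1))]
    have hN1 : (1 : ℝ) ≤ N := by exact_mod_cast NeZero.one_le
    have hdj : ∀ j, |d j| ≤ 2 * N * Real.sqrt l := by
      -- At the largest difference, `d²/4 ≤ q` and the inequality above give `d i ^ 4 / 4 ≤ l N d i
      -- ^ 2`, so all differences are `O(√l)`. Walking round the ring from the small value `x j`
      -- bounds every coordinate.
      obtain ⟨i, -, hi⟩ := exists_max_image univ (fun j => d j ^ 2) ⟨0, mem_univ _⟩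
      have h1 : d i ^ 4 / 4 ≤ ∑ j, d j ^ 2 * q j := by
        have h0 : ∀ j, d j ^ 4 / 4 ≤ d j ^ 2 * q j := fun j => by
          have : d j ^ 2 / 4 ≤ q j := by
            simp only [hd, hq]; nlinarith [sq_nonneg (x j + x (j + 1))]
          nlinarith [sq_nonneg (d j)]
        refine (h0 i).trans (single_le_sum (f := fun j => d j ^ 2 * q j) (fun j _ => ?_)
          (mem_univ i))
        have := h0 j
        have h4 : 0 ≤ d j ^ 4 := by positivity
        linarith
      have h2 : ∑ j, d j ^ 2 ≤ N * d i ^ 2 := by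
        refine (sum_le_sum fun j hj => hi j hj).trans (by simp [ZMod.card])
      have h3 : d i ^ 2 ≤ 4 * N * l := by
        have h4 : d i ^ 2 * d i ^ 2 ≤ 4 * N * l * d i ^ 2 := by nlinarith
        rcases (sq_nonneg (d i)).eq_or_lt with h5 | h5
        · rw [← h5]; positivity
        · exact le_of_mul_le_mul_right h4 h5
      intro j
      refine abs_le_of_sq_le_sq ((hi j (mem_univ _)).trans (h3.trans ?_)) (by positivity)
      rw [mul_pow, hs, mul_pow]
      nlinarith
    refine (pi_norm_le_iff_of_nonneg (by positivity)).2 fun i => ?_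
    refine (dist_le_of_abs_succ_sub_le hdj i j).trans ?_
    nlinarith
  · left
    push Not at hall
    have h0 : ∑ j, d j ^ 2 * (q j - l) = 0 := by
      refine le_antisymm ?_ (sum_nonneg fun j _ => ?_)
      · simp only [mul_sub, sum_sub_distrib, ← sum_mul]; linarith
      · exact mul_nonneg (sq_nonneg _) (by linarith [hall j])
    rw [sum_eq_zero_iff_of_nonneg fun j _ => mul_nonneg (sq_nonneg _) (by linarith [hall j])] at h0
    have hd0 : ∀ j, x j = x (j + 1) := fun j => by
      have := h0 j (mem_univ _)
      rcases mul_eq_zero.1 this with h | h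
      · exact sub_eq_zero.1 (pow_eq_zero_iff two_ne_zero |>.1 h)
      · linarith [hall j]
    intro j
    have key : ∀ n : ℕ, x n = x 0 := by
      intro n
      induction n with
      | zero => simp
      | succ n ih => push_cast; rw [← hd0, ih]
    simpa using key j.val

theorem eventually_const_or_small (hN : 3 ≤ N) {ε : ℝ} (hε : 0 < ε) :
    ∀ᶠ l in 𝓝[>] (0 : ℝ), ∀ x : ZMod N → ℝ, mult (symb N l) x = x ^ 3 →
      (∀ j, x j = x 0) ∨ ‖x‖ ≤ ε := by
  have h1 : Tendsto (fun l => (2 + 2 * (N : ℝ) ^ 2) * Real.sqrt l) (𝓝[>] 0) (𝓝 0) := by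
    have : Continuous fun l => (2 + 2 * (N : ℝ) ^ 2) * Real.sqrt l := by fun_prop
    have h := this.tendsto 0
    simp only [Real.sqrt_zero, mul_zero] at h
    exact h.mono_left nhdsWithin_le_nhds
  filter_upwards [h1.eventually (eventually_le_nhds hε), self_mem_nhdsWithin,
    nhdsWithin_le_nhds (eventually_le_nhds zero_lt_one)] with l h2 h3 h4 x hx
  exact (const_or_norm_le hN (le_of_lt h3) h4 hx).imp_right fun h => h.trans h2

theorem const_sol {l c : ℝ} (h : mult (symb N l) (fun _ => c) = (fun _ => c) ^ 3) :
    c = 0 ∨ c = 1 ∨ c = -1 := by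
  rw [mult_symb_eq_linOp] at h
  have := congrFun h 0
  simp only [linOp_apply, Pi.pow_apply] at this
  have h2 : c * ((c - 1) * (c + 1)) = 0 := by linear_combination -this
  rcases mul_eq_zero.1 h2 with h | h
  · exact Or.inl h
  · rcases mul_eq_zero.1 h with h | h
    · exact Or.inr (Or.inl (by linarith))
    · exact Or.inr (Or.inr (by linarith))

/-- The mean of `cos⁴` is `3/8` because the frequencies `2` and `4` are not aliased to `0`; for `4`
this excludes `N = 4`, by parity. -/
theorem wave_dot_wave_cube (hN : 3 ≤ N) (hodd : Odd N) (θ : ℝ) :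
    wave N θ ⬝ᵥ wave N θ ^ 3 = 3 * N / 8 := by
  have h2 := sum_cos_int_mul_ang (N := N) 2 θ
  have h4 := sum_cos_int_mul_ang (N := N) 4 θ
  have n2 := two_ne_zero_zmod hN
  have n4 : (4 : ZMod N) ≠ 0 := by
    intro h
    have : ((4 : ℕ) : ZMod N) = 0 := by exact_mod_cast h
    rw [ZMod.natCast_eq_zero_iff] at this
    have h3 := Nat.le_of_dvd (by norm_num) this
    interval_cases N
    · omega
    · revert hodd; decide
  rw [if_neg (by exact_mod_cast n2)] at h2
  rw [if_neg (by exact_mod_cast n4)] at h4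
  push_cast at h2 h4
  have e : ∀ j : ZMod N, wave N θ j * (wave N θ ^ 3) j
      = 3 / 8 + Real.cos (2 * ang θ j) / 2 + Real.cos (4 * ang θ j) / 8 := by
    intro j
    rw [Pi.pow_apply, wave_eq_cos, show 4 * ang θ j = 2 * (2 * ang θ j) by ring,
      Real.cos_two_mul (2 * _), Real.cos_two_mul (ang θ j)]
    ring
  simp only [dotProduct, e, sum_add_distrib, ← sum_div, h2, h4]
  simp [ZMod.card]; ring

theorem norm_cube_sub_cube_le {x y : ZMod N → ℝ} {M : ℝ} (hx : ‖x‖ ≤ M) (hy : ‖y‖ ≤ M) :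
    ‖x ^ 3 - y ^ 3‖ ≤ 3 * M ^ 2 * ‖x - y‖ := by
  have hM : 0 ≤ M := (norm_nonneg _).trans hx
  have e : x ^ 3 - y ^ 3 = (x * x + x * y + y * y) * (x - y) := by ring
  rw [e]
  refine norm_mul_le_of_le ?_ le_rfl
  have := norm_add_le_of_le (norm_add_le_of_le (norm_mul_le_of_le hx hx)
    (norm_mul_le_of_le hx hy)) (norm_mul_le_of_le hy hy)
  linarith

/-- A solution with first mode of amplitude `ρ > 0` and angle `θ`. -/
structure IsPolar (N : ℕ) [NeZero N] (C l ρ θ : ℝ) (x : ZMod N → ℝ) : Prop where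
  pos : 0 < ρ
  sq_le : ρ ^ 2 ≤ l
  eq : x = (2 * ρ) • wave N θ + mult (kap N l) (x ^ 3)
  norm_le : ‖x‖ ≤ 4 * ρ
  norm_sub_le : ‖x - (2 * ρ) • wave N θ‖ ≤ C * ρ ^ 3
  radial : l * ρ * N = wave N θ ⬝ᵥ x ^ 3
  abs_le : |l - 3 * ρ ^ 2| ≤ C * ρ ^ 4
  tangent : wave N (θ + Real.pi / 2) ⬝ᵥ x ^ 3 = 0

/-- Polar form of solutions, from the equations in components. -/
theorem exists_isPolar_of_eq (hN : 3 ≤ N) (hodd : Odd N) : ∃ C : ℝ, 0 < C ∧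
    ∀ᶠ l in 𝓝[>] (0 : ℝ), ∀ (ρ θ : ℝ) (x : ZMod N → ℝ), 0 < ρ → C * ρ ^ 2 ≤ 2 → ‖x‖ ≤ 4 * ρ →
      x = (2 * ρ) • wave N θ + mult (kap N l) (x ^ 3) → l * ρ * N = wave N θ ⬝ᵥ x ^ 3 →
      wave N (θ + Real.pi / 2) ⬝ᵥ x ^ 3 = 0 → IsPolar N C l ρ θ x := by
  obtain ⟨D, hD, hD'⟩ := exists_norm_kap_le hN
  have hNpos : (0 : ℝ) < N := Nat.cast_pos.2 (NeZero.pos N)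
  refine ⟨64 * D + 48 * 64 * D, by positivity, ?_⟩
  filter_upwards [hD'] with l hD' ρ θ x hρ hCρ hx heq hrad htan
  have hw : ‖x - (2 * ρ) • wave N θ‖ ≤ 64 * D * ρ ^ 3 := by
    have : x - (2 * ρ) • wave N θ = mult (kap N l) (x ^ 3) := by
      conv_lhs => rw [heq]
      abel
    rw [this]
    refine (hD' _).trans ?_
    have h3 : ‖x ^ 3‖ ≤ (4 * ρ) ^ 3 := (norm_pow_le' x (by norm_num)).trans (by gcongr)
    nlinarith
  have hρ3 : 0 ≤ ρ ^ 3 := by positivity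
  have hb : ‖(2 * ρ) • wave N θ‖ ≤ 4 * ρ := by
    rw [norm_smul, Real.norm_eq_abs, abs_of_pos (by positivity)]
    have := norm_wave_le (N := N) θ
    nlinarith
  have h3 := norm_cube_sub_cube_le hx hb
  have h4 := abs_dotProduct_le (wave N θ) (x ^ 3 - ((2 * ρ) • wave N θ) ^ 3)
  rw [dotProduct_sub, ← hrad, smul_pow, dotProduct_smul, wave_dot_wave_cube hN hodd,
    smul_eq_mul] at h4
  rw [smul_pow] at h3
  -- Replacing `x` by its leading part `2ρ · wave θ` in the radial equation gives `3ρ³N`, with an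
  -- error of order `ρ⁵`.
  have h5 : |l - 3 * ρ ^ 2| * (ρ * N) ≤ N * (48 * 64 * D * ρ ^ 5) := by
    calc |l - 3 * ρ ^ 2| * (ρ * N) = |l * ρ * N - (2 * ρ) ^ 3 * (3 * N / 8)| := by
          rw [← abs_of_pos (show 0 < ρ * N by positivity), ← abs_mul]
          congr 1; ring
      _ ≤ _ := h4
      _ ≤ N * (1 * (3 * (4 * ρ) ^ 2 * (64 * D * ρ ^ 3))) := by
          gcongr
          · exact norm_wave_le θ
          · exact h3.trans (by gcongr)
      _ = _ := by ring
  have h6 : |l - 3 * ρ ^ 2| * (ρ * N) ≤ 48 * 64 * D * ρ ^ 4 * (ρ * N) := by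
    refine h5.trans (le_of_eq (by ring))
  have h7 := le_of_mul_le_mul_right h6 (by positivity)
  have h8 : 0 ≤ D * ρ ^ 4 := by positivity
  have h9 : |l - 3 * ρ ^ 2| ≤ (64 * D + 48 * 64 * D) * ρ ^ 4 := by linarith
  refine ⟨hρ, ?_, heq, hx, hw.trans (by nlinarith [mul_nonneg hD.le hρ3]), hrad, h9, htan⟩
  -- `l ≥ 3ρ² - Cρ⁴ ≥ ρ²`, thanks to `C ρ² ≤ 2`.
  have h10 := (abs_le.1 h9).1
  have h11 := mul_le_mul_of_nonneg_right hCρ (sq_nonneg ρ)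
  nlinarith

/-- Projecting the equation off the modes `±1` and inverting there yields the slaved part; pairing
with the wave and its quarter turn yields the radial and tangential equations. -/
theorem exists_isPolar_of_sol (hN : 3 ≤ N) (hodd : Odd N) : ∃ C : ℝ, 0 < C ∧
    ∀ᶠ l in 𝓝[>] (0 : ℝ), ∀ x : ZMod N → ℝ, mult (symb N l) x = x ^ 3 → (¬ ∀ j, x j = x 0) →
      ∃ ρ θ, IsPolar N C l ρ θ x := by
  obtain ⟨C, hC, h1⟩ := exists_isPolar_of_eq hN hodd
  obtain ⟨D, hD, h2⟩ := exists_norm_kap_le hN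
  have hNpos : (0 : ℝ) < N := Nat.cast_pos.2 (NeZero.pos N)
  refine ⟨C, hC, ?_⟩
  have hε : 0 < min (1 / (2 * (D + 1))) (2 / C) := by positivity
  filter_upwards [h1, h2, eventually_nonRes hN,
    eventually_const_or_small hN (Real.sqrt_pos.2 hε)] with l h1 h2 h3 h4 x hx hnc
  have hsm := (h4 x hx).resolve_left hnc
  obtain ⟨ρ, θ, hρ, hxe⟩ := exists_polar hN x
  have hpw : mult (pw N) x = mult (kap N l) (x ^ 3) := by
    rw [← hx, mult_kap_symb h3]
  rw [hpw] at hxe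
  have hnx : 0 < ‖x‖ := by
    rw [norm_pos_iff]
    rintro rfl
    exact hnc fun j => rfl
  have hb : ‖(2 * ρ) • wave N θ‖ ≤ 2 * ρ := by
    rw [norm_smul, Real.norm_eq_abs, abs_of_nonneg (by positivity)]
    have := norm_wave_le (N := N) θ
    nlinarith
  have hsq : ‖x‖ ^ 2 ≤ min (1 / (2 * (D + 1))) (2 / C) := by
    rw [← Real.sq_sqrt hε.le]; gcongr
  -- Smallness of `x` makes the slaved part at most half of `x`, so it is absorbed and `ρ` controls
  -- the whole norm.
  have hw : ‖mult (kap N l) (x ^ 3)‖ ≤ ‖x‖ / 2 := by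
    refine (h2 _).trans ?_
    have h5 : ‖x ^ 3‖ ≤ ‖x‖ ^ 3 := norm_pow_le' x (by norm_num)
    have h6 : ‖x‖ ^ 2 ≤ 1 / (2 * (D + 1)) := hsq.trans (min_le_left _ _)
    have h7 : (2 * (D + 1)) * ‖x‖ ^ 2 ≤ 1 := by
      rwa [le_div_iff₀ (by positivity), mul_comm] at h6
    calc D * ‖x ^ 3‖ ≤ D * ‖x‖ ^ 3 := by gcongr
      _ ≤ ((D + 1) * ‖x‖ ^ 2) * ‖x‖ := by nlinarith [pow_pos hnx 3]
      _ ≤ ‖x‖ / 2 := by nlinarith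
  have hx4 : ‖x‖ ≤ 4 * ρ := by
    have : ‖x‖ ≤ 2 * ρ + ‖x‖ / 2 := by
      conv_lhs => rw [hxe]
      exact norm_add_le_of_le hb hw
    linarith
  have hdot : wave N θ ⬝ᵥ x = ρ * N := by
    conv_lhs => rw [hxe]
    rw [dotProduct_add, wave_dot_mult_kap, dotProduct_smul, wave_dot_wave hN, sub_self,
      Real.cos_zero, smul_eq_mul]
    ring
  have hρx : ρ ≤ ‖x‖ := by
    have h5 := (le_abs_self _).trans (abs_dotProduct_le (wave N θ) x)
    have h6 := mul_le_mul_of_nonneg_right (norm_wave_le (N := N) θ) (norm_nonneg x)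
    have h7 : ρ * N ≤ ‖x‖ * N := by rw [← hdot]; nlinarith
    exact le_of_mul_le_mul_right h7 hNpos
  have hCρ : C * ρ ^ 2 ≤ 2 := by
    have h5 : ρ ^ 2 ≤ 2 / C := (pow_le_pow_left₀ hρ hρx 2).trans (hsq.trans (min_le_right _ _))
    rwa [le_div_iff₀ hC, mul_comm] at h5
  refine ⟨ρ, θ, h1 ρ θ x (by linarith) hCρ hx4 hxe ?_ ?_⟩
  · rw [← hx, wave_dot_mult_symb hN, hdot]; ring
  · rw [← hx, wave_dot_mult_symb hN, hxe, dotProduct_add, wave_dot_mult_kap, dotProduct_smul,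
      wave_dot_wave hN, add_sub_cancel_left, Real.cos_pi_div_two, smul_eq_mul]
    ring

theorem eventually_pos_le {ε : ℝ} (hε : 0 < ε) : ∀ᶠ l in 𝓝[>] (0 : ℝ), 0 < l ∧ l ≤ ε := by
  filter_upwards [self_mem_nhdsWithin, nhdsWithin_le_nhds (eventually_le_nhds hε)] with l h1 h2
  exact ⟨h1, h2⟩

/-! ### Exact against approximate solutions -/

theorem IsApprox.sub_eq {C D l ρ θ : ℝ} {Φ Rem : ℝ → ZMod N → ℝ} {x : ZMod N → ℝ}
    (hΦ : IsApprox N C l ρ Φ Rem) (hx : IsPolar N D l ρ θ x) :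
    x - Φ θ = mult (kap N l) (x ^ 3 - (Φ θ ^ 3 - Rem θ)) := by
  rw [map_sub]
  conv_lhs => rw [hx.eq, hΦ.eq θ]
  abel

/-- The exact solutions are close to the approximate ones. -/
theorem exists_norm_sub_approx_le (hN : 3 ≤ N) {A P : ℝ} (hA : 0 < A) : ∃ C : ℝ, 0 < C ∧
    ∀ᶠ l in 𝓝[>] (0 : ℝ), ∀ (ρ θ : ℝ) (Φ Rem : ℝ → ZMod N → ℝ) (x : ZMod N → ℝ),
      IsApprox N A l ρ Φ Rem → IsPolar N P l ρ θ x →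
        ‖x ^ 3 - (Φ θ ^ 3 - Rem θ)‖ ≤ C * ρ ^ (2 * N) ∧ ‖x - Φ θ‖ ≤ C * ρ ^ (2 * N) := by
  obtain ⟨D, hD, hD'⟩ := exists_norm_kap_le hN
  set M := max 4 A with hM
  have hM4 : 4 ≤ M := le_max_left _ _
  have hε : 0 < 1 / (6 * M ^ 2 * D) := by positivity
  refine ⟨2 * A + D * (2 * A), by positivity, ?_⟩
  filter_upwards [hD', eventually_pos_le hε] with l hD' hl ρ θ Φ Rem x hΦ hx
  have hρ := hx.pos
  have hz := hΦ.sub_eq hx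
  have hz' : ‖x - Φ θ‖ ≤ D * ‖x ^ 3 - (Φ θ ^ 3 - Rem θ)‖ := by rw [hz]; exact hD' _
  have h1 : ‖x‖ ≤ M * ρ := hx.norm_le.trans (by gcongr)
  have h2 : ‖Φ θ‖ ≤ M * ρ := (hΦ.norm_le θ).trans (by gcongr; exact le_max_right _ _)
  have h3 := norm_cube_sub_cube_le h1 h2
  have h4 : ‖x ^ 3 - (Φ θ ^ 3 - Rem θ)‖ ≤ ‖x ^ 3 - Φ θ ^ 3‖ + ‖Rem θ‖ := by
    rw [← sub_add]; exact norm_add_le _ _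
  have h5 : 3 * M ^ 2 * D * ρ ^ 2 ≤ 1 / 2 := by
    have := hx.sq_le.trans hl.2
    rw [le_div_iff₀ (by positivity)] at this
    linarith
  set y := ‖x ^ 3 - (Φ θ ^ 3 - Rem θ)‖ with hy
  have hy0 : 0 ≤ y := norm_nonneg _
  -- The cubic difference costs a factor `O(ρ²)`, so for small `ρ` it is absorbed on the left and
  -- only the remainder is left.
  have h6 : y ≤ 2 * A * ρ ^ (2 * N) := by
    have h7 : 3 * (M * ρ) ^ 2 * ‖x - Φ θ‖ ≤ 1 / 2 * y := by
      calc 3 * (M * ρ) ^ 2 * ‖x - Φ θ‖ ≤ 3 * (M * ρ) ^ 2 * (D * y) := by gcongr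
        _ = (3 * M ^ 2 * D * ρ ^ 2) * y := by ring
        _ ≤ _ := by gcongr
    have := hΦ.norm_rem_le θ
    linarith
  have hp : 0 ≤ ρ ^ (2 * N) := by positivity
  constructor
  · refine h6.trans ?_
    gcongr
    have : 0 ≤ D * (2 * A) := by positivity
    linarith
  · refine hz'.trans ((mul_le_mul_of_nonneg_left h6 hD.le).trans ?_)
    nlinarith [mul_nonneg hA.le hp]

theorem norm_sub_le_of_norm_deriv_le {f : ℝ → ZMod N → ℝ} {C : ℝ} (hf : Differentiable ℝ f)
    (h : ∀ θ, ‖deriv f θ‖ ≤ C) (θ θ' : ℝ) : ‖f θ - f θ'‖ ≤ C * |θ - θ'| :=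
  Convex.norm_image_sub_le_of_norm_deriv_le (fun x _ => hf x) (fun x _ => h x) convex_univ
    (Set.mem_univ _) (Set.mem_univ _)

theorem norm_wave_sub_le (θ θ' : ℝ) : ‖wave N θ - wave N θ'‖ ≤ |θ - θ'| := by
  have := norm_sub_le_of_norm_deriv_le (f := wave N) (C := 1)
    (fun θ => (hasDerivAt_wave θ).differentiableAt)
    (fun θ => by rw [(hasDerivAt_wave θ).deriv]; exact norm_wave_le _) θ θ'
  rwa [one_mul] at this

/-- Two solutions with the same amplitude: comparison of the angular equations. -/
theorem exists_sin_sub_sin_le (hN : 3 ≤ N) {A P : ℝ} (hA : 0 < A) : ∃ C : ℝ, 0 < C ∧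
    ∀ᶠ l in 𝓝[>] (0 : ℝ), ∀ (ρ θ θ' : ℝ) (Φ Rem : ℝ → ZMod N → ℝ) (x x' : ZMod N → ℝ),
      IsApprox N A l ρ Φ Rem → IsPolar N P l ρ θ x → IsPolar N P l ρ θ' x' →
        |resCoeff N l| * |Real.sin (2 * N * θ) - Real.sin (2 * N * θ')| ≤ C * ρ * |θ - θ'| := by
  obtain ⟨B, hB, hB'⟩ := exists_norm_sub_approx_le hN (P := P) hA
  obtain ⟨D, hD, hD'⟩ := exists_norm_kap_le hN
  set M := max 4 A with hM
  have hM4 : 4 ≤ M := le_max_left _ _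
  have hNpos : (0 : ℝ) < N := Nat.cast_pos.2 (NeZero.pos N)
  have hε : 0 < min 1 (1 / (18 * M ^ 2 * D)) := by positivity
  set E := 2 * (A + 6 * B * M * A) with hE
  refine ⟨B + E, by positivity, ?_⟩
  filter_upwards [hB', hD', eventually_pos_le hε] with l hB' hD' hl ρ θ θ' Φ Rem x x' hΦ hx hx'
  have hρ := hx.pos
  have hρl := hx.sq_le.trans hl.2
  have hρ1 : ρ ^ 2 ≤ 1 := hρl.trans (min_le_left _ _)
  have hρ2 : 9 * M ^ 2 * D * ρ ^ 2 ≤ 1 / 2 := by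
    have := hρl.trans (min_le_right _ _)
    rw [le_div_iff₀ (by positivity)] at this
    linarith
  obtain ⟨hy, hz⟩ := hB' ρ θ Φ Rem x hΦ hx
  obtain ⟨hy', hz'⟩ := hB' ρ θ' Φ Rem x' hΦ hx'
  have ez := hΦ.sub_eq hx
  have ez' := hΦ.sub_eq hx'
  have b1 : ‖x‖ ≤ M * ρ := hx.norm_le.trans (by gcongr)
  have b2 : ‖Φ θ‖ ≤ M * ρ := (hΦ.norm_le θ).trans (by gcongr; exact le_max_right _ _)
  have b1' : ‖x'‖ ≤ M * ρ := hx'.norm_le.trans (by gcongr)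
  have b2' : ‖Φ θ'‖ ≤ M * ρ := (hΦ.norm_le θ').trans (by gcongr; exact le_max_right _ _)
  have lΦ := norm_sub_le_of_norm_deriv_le hΦ.diff hΦ.norm_deriv_le θ θ'
  have lR := norm_sub_le_of_norm_deriv_le hΦ.diff_rem hΦ.norm_deriv_rem_le θ θ'
  set y := x ^ 3 - (Φ θ ^ 3 - Rem θ) with hydef
  set y' := x' ^ 3 - (Φ θ' ^ 3 - Rem θ') with hydef'
  set z := x - Φ θ with hzdef
  set z' := x' - Φ θ' with hzdef'
  set Δ := |θ - θ'| with hΔ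
  have hΔ0 : 0 ≤ Δ := abs_nonneg _
  have lz : ‖z - z'‖ ≤ D * ‖y - y'‖ := by rw [ez, ez', ← map_sub]; exact hD' _
  -- A difference of differences: every term contains either a variation in the angle or `z - z'`.
  -- The latter is bounded by `y - y'` with a factor `O(ρ²)` and absorbed, leaving a Lipschitz bound
  -- of order `ρ^(2N)`.
  have key : y - y' = (Rem θ - Rem θ') + ((z - z') * (x * x + x * Φ θ + Φ θ * Φ θ)
      + z' * (((z - z') + (Φ θ - Φ θ')) * (x + x' + Φ θ) + (Φ θ - Φ θ') * (x' + Φ θ + Φ θ'))) := by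
    rw [hydef, hydef', hzdef, hzdef']; ring
  have hzb : ‖z'‖ ≤ 2 * (M * ρ) := by
    have := norm_sub_le_of_le b1' b2'; linarith
  have q1 : ‖(z - z') * (x * x + x * Φ θ + Φ θ * Φ θ)‖ ≤ (D * ‖y - y'‖) * (3 * (M * ρ) ^ 2) := by
    refine norm_mul_le_of_le lz ?_
    have := norm_add_le_of_le (norm_add_le_of_le (norm_mul_le_of_le b1 b1)
      (norm_mul_le_of_le b1 b2)) (norm_mul_le_of_le b2 b2)
    linarith
  have s1 : ‖x + x' + Φ θ‖ ≤ 3 * (M * ρ) := by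
    have := norm_add_le_of_le (norm_add_le_of_le b1 b1') b2; linarith
  have s2 : ‖x' + Φ θ + Φ θ'‖ ≤ 3 * (M * ρ) := by
    have := norm_add_le_of_le (norm_add_le_of_le b1' b2) b2'; linarith
  have q2 : ‖z' * ((z - z') * (x + x' + Φ θ))‖
      ≤ (2 * (M * ρ)) * ((D * ‖y - y'‖) * (3 * (M * ρ))) :=
    norm_mul_le_of_le hzb (norm_mul_le_of_le lz s1)
  have q3 : ‖z' * ((Φ θ - Φ θ') * (x + x' + Φ θ))‖
      ≤ (B * ρ ^ (2 * N)) * ((A * ρ * Δ) * (3 * (M * ρ))) :=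
    norm_mul_le_of_le hz' (norm_mul_le_of_le lΦ s1)
  have q4 : ‖z' * ((Φ θ - Φ θ') * (x' + Φ θ + Φ θ'))‖
      ≤ (B * ρ ^ (2 * N)) * ((A * ρ * Δ) * (3 * (M * ρ))) :=
    norm_mul_le_of_le hz' (norm_mul_le_of_le lΦ s2)
  have hY : ‖y - y'‖ ≤ E * ρ ^ (2 * N) * Δ := by
    have e : y - y' = (Rem θ - Rem θ') + ((z - z') * (x * x + x * Φ θ + Φ θ * Φ θ)
      + (z' * ((z - z') * (x + x' + Φ θ)) + z' * ((Φ θ - Φ θ') * (x + x' + Φ θ))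
        + z' * ((Φ θ - Φ θ') * (x' + Φ θ + Φ θ')))) := by rw [key]; ring
    have h1 := norm_add_le_of_le lR (norm_add_le_of_le q1
      (norm_add_le_of_le (norm_add_le_of_le q2 q3) q4))
    rw [← e] at h1
    have h2 : (9 * M ^ 2 * D * ρ ^ 2) * ‖y - y'‖ ≤ 1 / 2 * ‖y - y'‖ := by gcongr
    have h3 : (B * A * M * ρ ^ (2 * N) * Δ) * ρ ^ 2 ≤ (B * A * M * ρ ^ (2 * N) * Δ) * 1 := by
      gcongr
    rw [hE]
    linarith
  -- For an exact solution the tangential component vanishes, so that of the error equals the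
  -- resonant term.
  have hd1 : wave N (θ + Real.pi / 2) ⬝ᵥ y
      = N * resCoeff N l * ρ ^ (2 * N - 1) * Real.sin (2 * N * θ) := by
    rw [hydef, dotProduct_sub, hx.tangent, hΦ.tangent]; ring
  have hd2 : wave N (θ' + Real.pi / 2) ⬝ᵥ y'
      = N * resCoeff N l * ρ ^ (2 * N - 1) * Real.sin (2 * N * θ') := by
    rw [hydef', dotProduct_sub, hx'.tangent, hΦ.tangent]; ring
  have hG : |wave N (θ + Real.pi / 2) ⬝ᵥ y - wave N (θ' + Real.pi / 2) ⬝ᵥ y'|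
      ≤ N * ((B + E) * ρ ^ (2 * N) * Δ) := by
    have e : wave N (θ + Real.pi / 2) ⬝ᵥ y - wave N (θ' + Real.pi / 2) ⬝ᵥ y'
        = (wave N (θ + Real.pi / 2) - wave N (θ' + Real.pi / 2)) ⬝ᵥ y
          + wave N (θ' + Real.pi / 2) ⬝ᵥ (y - y') := by
      rw [sub_dotProduct, dotProduct_sub _ y y']; ring
    have w1 : ‖wave N (θ + Real.pi / 2) - wave N (θ' + Real.pi / 2)‖ ≤ Δ := by
      have := norm_wave_sub_le (N := N) (θ + Real.pi / 2) (θ' + Real.pi / 2)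
      rwa [add_sub_add_right_eq_sub] at this
    rw [e]
    refine (abs_add_le _ _).trans ((add_le_add (abs_dotProduct_le _ _)
      (abs_dotProduct_le _ _)).trans ?_)
    have a1 := mul_le_mul w1 hy (norm_nonneg _) hΔ0
    have a2 := mul_le_mul (norm_wave_le (N := N) (θ' + Real.pi / 2)) hY (norm_nonneg _) zero_le_one
    rw [← mul_add]
    gcongr
    linarith
  rw [hd1, hd2, ← mul_sub, abs_mul, abs_mul, abs_mul, abs_of_pos hNpos,
    abs_of_pos (show 0 < ρ ^ (2 * N - 1) by positivity)] at hG
  have hpow : ρ ^ (2 * N) = ρ ^ (2 * N - 1) * ρ := by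
    rw [← pow_succ]; congr 1; omega
  rw [hpow] at hG
  have hfin : (|resCoeff N l| * |Real.sin (2 * N * θ) - Real.sin (2 * N * θ')|)
      * (N * ρ ^ (2 * N - 1)) ≤ ((B + E) * ρ * Δ) * (N * ρ ^ (2 * N - 1)) := by
    linarith
  exact le_of_mul_le_mul_right hfin (by positivity)

/-! ### Mirror symmetries and quantisation of the angle -/

/-- The reflection of configurations that maps `wave θ` to `wave (π k / N - θ)`. -/
noncomputable def mirror (k : ℤ) : (ZMod N → ℝ) →ₗ[ℝ] (ZMod N → ℝ) where
  toFun x j := (-1) ^ k * x (((-(k * ((N + 1) / 2 : ℕ)) : ℤ) : ZMod N) - j)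
  map_add' x y := by ext j; simp only [Pi.add_apply]; ring
  -- In `mirror`, `(N + 1) / 2` is the inverse of `2` modulo the odd number `N`; the sign `(-1) ^ k`
  -- compensates the resulting phase shift by `kπ`.
  map_smul' c x := by ext j; simp only [Pi.smul_apply, smul_eq_mul, RingHom.id_apply]; ring

theorem mirror_apply (k : ℤ) (x : ZMod N → ℝ) (j : ZMod N) : mirror k x j
    = (-1) ^ k * x (((-(k * ((N + 1) / 2 : ℕ)) : ℤ) : ZMod N) - j) := rfl

theorem neg_one_zpow_mul_self (k : ℤ) : ((-1 : ℝ) ^ k) * (-1) ^ k = 1 := by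
  rw [← zpow_add₀ (by norm_num)]; exact Even.neg_one_zpow ⟨k, rfl⟩

theorem mirror_pow_three (k : ℤ) (x : ZMod N → ℝ) : mirror k x ^ 3 = mirror k (x ^ 3) := by
  ext j
  simp only [Pi.pow_apply, mirror_apply, mul_pow]
  congr 1
  rw [pow_succ, pow_two, neg_one_zpow_mul_self, one_mul]

theorem mirror_dot (k : ℤ) (x y : ZMod N → ℝ) : mirror k x ⬝ᵥ mirror k y = x ⬝ᵥ y := by
  simp only [dotProduct, mirror_apply]
  rw [← Equiv.sum_comp (Equiv.subLeft ((-(k * ((N + 1) / 2 : ℕ)) : ℤ) : ZMod N))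
    (fun j => x j * y j)]
  refine sum_congr rfl fun j _ => ?_
  rw [mul_mul_mul_comm, neg_one_zpow_mul_self, one_mul]; rfl

theorem mirror_mult (k : ℤ) (m : ZMod N → ℝ) (x : ZMod N → ℝ) :
    mirror k (mult m x) = mult m (mirror k x) := by
  ext j
  simp only [mult_apply, mirror_apply, mul_sum]
  refine sum_congr rfl fun i _ => ?_
  rw [← Equiv.sum_comp (Equiv.subLeft ((-(k * ((N + 1) / 2 : ℕ)) : ℤ) : ZMod N))]
  refine sum_congr rfl fun s _ => ?_
  simp only [Equiv.subLeft_apply]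
  rw [← co_neg, show ∀ a : ZMod N, -(i * (a - j - (a - s))) = i * (j - s) from fun a => by ring]
  ring

theorem norm_mirror (k : ℤ) (x : ZMod N → ℝ) : ‖mirror k x‖ = ‖x‖ := by
  have h1 : ∀ j, ‖mirror k x j‖ = ‖x (((-(k * ((N + 1) / 2 : ℕ)) : ℤ) : ZMod N) - j)‖ := by
    intro j; rw [mirror_apply, norm_mul]; simp
  apply le_antisymm
  · refine (pi_norm_le_iff_of_nonneg (norm_nonneg _)).2 fun j => ?_
    rw [h1]; exact norm_le_pi_norm x _
  · refine (pi_norm_le_iff_of_nonneg (norm_nonneg _)).2 fun j => ?_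
    have := h1 (((-(k * ((N + 1) / 2 : ℕ)) : ℤ) : ZMod N) - j)
    rw [sub_sub_cancel] at this
    rw [← this]
    exact norm_le_pi_norm (mirror k x) _

theorem mirror_wave (hodd : Odd N) (k : ℤ) (θ : ℝ) :
    mirror k (wave N θ) = wave N (Real.pi * k / N - θ) := by
  have hN : (N : ℝ) ≠ 0 := Nat.cast_ne_zero.2 (NeZero.ne N)
  ext j
  obtain ⟨n, rfl⟩ := exists_intCast j
  obtain ⟨m, hm⟩ := hodd
  have h1 : (N + 1) / 2 = m + 1 := by omega
  have h2 : (N : ℝ) = 2 * m + 1 := by exact_mod_cast hm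
  rw [mirror_apply, wave, wave, ← Int.cast_sub, ph_intCast, ph_intCast, h1]
  rw [show θ + 2 * Real.pi * ((-(k * ((m + 1 : ℕ) : ℤ)) - n : ℤ) : ℝ) / N
      = -((Real.pi * k / N - θ + 2 * Real.pi * n / N) + k * Real.pi) by
    push_cast; field_simp; rw [h2]; ring]
  rw [Real.cos_neg, Real.cos_add_int_mul_pi, ← mul_assoc, neg_one_zpow_mul_self, one_mul]

theorem mirror_wave_tangent (hodd : Odd N) (k : ℤ) (θ : ℝ) :
    mirror k (wave N (θ + Real.pi / 2)) = -wave N (Real.pi * k / N - θ + Real.pi / 2) := by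
  rw [mirror_wave hodd, show Real.pi * k / N - (θ + Real.pi / 2)
    = (Real.pi * k / N - θ + Real.pi / 2) - Real.pi by ring]
  ext j
  simp only [wave_eq_cos, Pi.neg_apply, ang]
  rw [← Real.cos_sub_pi]
  congr 1; ring

theorem IsPolar.mirror (hodd : Odd N) {C l ρ θ : ℝ} {x : ZMod N → ℝ} (hx : IsPolar N C l ρ θ x)
    (k : ℤ) : IsPolar N C l ρ (Real.pi * k / N - θ) (mirror k x) where
  pos := hx.pos
  sq_le := hx.sq_le
  eq := by
    conv_lhs => rw [hx.eq]
    rw [map_add, map_smul, mirror_wave hodd, mirror_mult, mirror_pow_three]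
  norm_le := by rw [norm_mirror]; exact hx.norm_le
  norm_sub_le := by
    rw [← mirror_wave hodd, ← map_smul, ← map_sub, norm_mirror]; exact hx.norm_sub_le
  radial := by rw [← mirror_wave hodd, mirror_pow_three, mirror_dot]; exact hx.radial
  abs_le := hx.abs_le
  tangent := by
    rw [← neg_eq_zero, ← neg_dotProduct, ← mirror_wave_tangent hodd, mirror_pow_three, mirror_dot]
    exact hx.tangent

/-- The angle of a solution is a multiple of `π / (2 N)`. -/
theorem eventually_angle (hN : 3 ≤ N) (hodd : Odd N) (P : ℝ) : ∀ᶠ l in 𝓝[>] (0 : ℝ),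
    ∀ (ρ θ : ℝ) (x : ZMod N → ℝ), IsPolar N P l ρ θ x → ∃ k : ℤ, θ = Real.pi * k / (2 * N) := by
  obtain ⟨A, hA, hA'⟩ := exists_isApprox hN hodd
  obtain ⟨C, hC, hC'⟩ := exists_sin_sub_sin_le hN (P := P) hA
  have hNpos : (0 : ℝ) < N := Nat.cast_pos.2 (NeZero.pos N)
  have hp := Real.pi_pos
  set r := |resCoeff N 0| / 2 with hr
  have hr0 : 0 < |resCoeff N 0| := abs_pos.2 (resCoeff_zero_ne_zero hN hodd)
  have hres : ∀ᶠ l in 𝓝[>] (0 : ℝ), r < |resCoeff N l| :=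
    nhdsWithin_le_nhds ((continuousAt_resCoeff hN).abs.eventually_const_lt (by rw [hr]; linarith))
  have hε : 0 < min 1 ((r * N / (Real.pi * C)) ^ 2) := by positivity
  filter_upwards [hA', hC', hres, eventually_pos_le hε] with l hA' hC' hres hl ρ θ x hx
  have hρ := hx.pos
  have hρl := hx.sq_le.trans hl.2
  have hρ1 : ρ ≤ 1 := by
    have := hρl.trans (min_le_left _ _)
    nlinarith
  obtain ⟨Φ, Rem, hΦ⟩ := hA' ρ hρ.le hρ1
  set k := round (2 * N * θ / Real.pi) with hk
  refine ⟨k, ?_⟩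
  -- The mirror image is another exact solution with the same amplitude, so the same `Φ` serves
  -- both. The integer `k` is chosen so that the reflected angle is as close to `θ` as possible.
  have h1 := hC' ρ θ _ Φ Rem x _ hΦ hx (hx.mirror hodd k)
  set δ := 2 * N * θ - k * Real.pi with hδ
  have hδ' : |δ| ≤ Real.pi / 2 := by
    have := abs_sub_round (2 * N * θ / Real.pi)
    rw [← hk] at this
    have e : δ = (2 * N * θ / Real.pi - k) * Real.pi := by rw [hδ]; field_simp
    rw [e, abs_mul, abs_of_pos hp]
    nlinarith
  have e1 : Real.sin (2 * N * θ) - Real.sin (2 * N * (Real.pi * k / N - θ))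
      = 2 * ((-1) ^ k * Real.sin δ) := by
    rw [show 2 * N * θ = δ + k * Real.pi by rw [hδ]; ring,
      show 2 * N * (Real.pi * k / N - θ) = -δ + k * Real.pi by rw [hδ]; field_simp; ring,
      Real.sin_add_int_mul_pi, Real.sin_add_int_mul_pi, Real.sin_neg]
    ring
  have e2 : |θ - (Real.pi * k / N - θ)| = |δ| / N := by
    rw [← abs_of_pos hNpos, ← abs_div, abs_of_pos hNpos, hδ]
    congr 1; field_simp; ring
  -- By Jordan's inequality the resonant terms differ by at least a multiple of `|δ|`, while the
  -- comparison allows only `O(ρ) |δ|`. For small `ρ` this forces `δ = 0`.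
  have hsin : 2 / Real.pi * |δ| ≤ |Real.sin δ| := Real.mul_abs_le_abs_sin hδ'
  rw [e1, e2, abs_mul, abs_mul] at h1
  have e3 : |((-1 : ℝ) ^ k)| = 1 := by simp
  rw [e3, one_mul, abs_two] at h1
  by_contra hne
  have hδ0 : 0 < |δ| := by
    refine abs_pos.2 fun h => hne ?_
    rw [hδ, sub_eq_zero] at h
    field_simp
    linarith
  have h2 : r * (2 * (2 / Real.pi * |δ|)) ≤ C * ρ * (|δ| / N) :=
    (mul_le_mul hres.le (by linarith) (by positivity) (abs_nonneg _)).trans h1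
  have h3 : ρ ≤ r * N / (Real.pi * C) :=
    le_of_sq_le_sq (hρl.trans (min_le_right _ _)) (by positivity)
  rw [le_div_iff₀ (by positivity)] at h3
  have h4 : r * (2 * (2 / Real.pi * |δ|)) * (Real.pi * N) = 4 * (r * N) * |δ| := by
    field_simp; ring
  have h5 : C * ρ * (|δ| / N) * (Real.pi * N) = (ρ * (Real.pi * C)) * |δ| := by
    field_simp
  have h6 := mul_le_mul_of_nonneg_right h2 (show 0 ≤ Real.pi * N by positivity)
  rw [h4, h5] at h6
  have h7 := le_of_mul_le_mul_right h6 hδ0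
  have : 0 < r * N := by positivity
  linarith

/-! ### Existence and uniqueness at a given angle -/

/-- The radial component of the cubic term. -/
noncomputable def radialCube (N : ℕ) [NeZero N] (θ : ℝ) (v : ZMod N → ℝ) : ℝ :=
  wave N θ ⬝ᵥ ((2 : ℝ) • wave N θ + v) ^ 3

/-- The map whose fixed points `v` give the profiles `2 wave θ + v` of the solutions of the
bifurcation equations other than the tangential one. -/
noncomputable def profileMap (N : ℕ) [NeZero N] (l θ : ℝ) (v : ZMod N → ℝ) : ZMod N → ℝ :=
  mult (kap N l) ((l * N / radialCube N θ v) • ((2 : ℝ) • wave N θ + v) ^ 3)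

theorem norm_two_wave_add_le {θ : ℝ} {v : ZMod N → ℝ} (hv : ‖v‖ ≤ 1 / 27) :
    ‖(2 : ℝ) • wave N θ + v‖ ≤ 3 := by
  have h : ‖(2 : ℝ) • wave N θ‖ ≤ 2 := by
    rw [norm_smul, Real.norm_eq_abs, abs_two]
    have := norm_wave_le (N := N) θ
    linarith
  exact (norm_add_le_of_le h hv).trans (by norm_num)

theorem norm_profile_cube_sub_le {θ : ℝ} {v v' : ZMod N → ℝ} (hv : ‖v‖ ≤ 1 / 27)
    (hv' : ‖v'‖ ≤ 1 / 27) :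
    ‖((2 : ℝ) • wave N θ + v) ^ 3 - ((2 : ℝ) • wave N θ + v') ^ 3‖ ≤ 27 * ‖v - v'‖ := by
  have := norm_cube_sub_cube_le (norm_two_wave_add_le (θ := θ) hv)
    (norm_two_wave_add_le (θ := θ) hv')
  rw [add_sub_add_left_eq_sub] at this
  linarith

theorem abs_radialCube_sub_le {θ : ℝ} {v v' : ZMod N → ℝ} (hv : ‖v‖ ≤ 1 / 27)
    (hv' : ‖v'‖ ≤ 1 / 27) :
    |radialCube N θ v - radialCube N θ v'| ≤ N * (27 * ‖v - v'‖) := by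
  rw [radialCube, radialCube, ← dotProduct_sub]
  refine (abs_dotProduct_le _ _).trans ?_
  have h1 := mul_le_mul (norm_wave_le (N := N) θ) (norm_profile_cube_sub_le (θ := θ) hv hv')
    (norm_nonneg _) zero_le_one
  rw [one_mul] at h1
  gcongr

/-- At `v = 0` the value is `3N`. The radius `1/27` is the inverse of the Lipschitz constant of the
cube on the ball of radius `3`, so that at most `N` is lost. -/
theorem le_radialCube (hN : 3 ≤ N) (hodd : Odd N) {θ : ℝ} {v : ZMod N → ℝ} (hv : ‖v‖ ≤ 1 / 27) :
    2 * N ≤ radialCube N θ v := by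
  have h1 := abs_radialCube_sub_le (N := N) (θ := θ) hv (v' := 0) (by simp)
  have h2 : radialCube N θ 0 = 3 * N := by
    rw [radialCube, add_zero, smul_pow, dotProduct_smul, wave_dot_wave_cube hN hodd, smul_eq_mul]
    ring
  have hNpos : (0 : ℝ) < N := Nat.cast_pos.2 (NeZero.pos N)
  rw [sub_zero, h2] at h1
  have h3 := (abs_le.1 h1).1
  nlinarith

/-- The amplitude has been eliminated through `ρ² = l N / radialCube`, so the map carries a factor
`l`. Both it and its Lipschitz constant are small, uniformly in the angle. -/
theorem eventually_contracting (hN : 3 ≤ N) (hodd : Odd N) : ∀ᶠ l in 𝓝[>] (0 : ℝ), ∀ θ,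
    (∀ v, ‖v‖ ≤ 1 / 27 → ‖profileMap N l θ v‖ ≤ 1 / 27) ∧
    ∀ v v', ‖v‖ ≤ 1 / 27 → ‖v'‖ ≤ 1 / 27 →
      ‖profileMap N l θ v - profileMap N l θ v'‖ ≤ 1 / 2 * ‖v - v'‖ := by
  obtain ⟨D, hD, hD'⟩ := exists_norm_kap_le hN
  have hNpos : (0 : ℝ) < N := Nat.cast_pos.2 (NeZero.pos N)
  -- With `D l ≤ 1/400` the Lipschitz constant is `783/1600 < 1/2`, and the image has norm at most
  -- `27/800 < 1/27`.
  have hε : 0 < 1 / (400 * D) := by positivity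
  filter_upwards [hD', eventually_pos_le hε] with l hD' hl θ
  obtain ⟨hl0, hl⟩ := hl
  have hlD : D * l ≤ 1 / 400 := by
    rw [le_div_iff₀ (by positivity)] at hl
    linarith
  have hcube : ∀ v : ZMod N → ℝ, ‖v‖ ≤ 1 / 27 → ‖((2 : ℝ) • wave N θ + v) ^ 3‖ ≤ 27 :=
    fun v hv => (norm_pow_le' _ (by norm_num)).trans
      ((pow_le_pow_left₀ (norm_nonneg _) (norm_two_wave_add_le hv) 3).trans (by norm_num))
  have hquot : ∀ v : ZMod N → ℝ, ‖v‖ ≤ 1 / 27 → ‖l * N / radialCube N θ v‖ ≤ l / 2 := by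
    intro v hv
    have := le_radialCube hN hodd (θ := θ) hv
    have h0 : 0 < radialCube N θ v := by linarith
    rw [Real.norm_eq_abs, abs_of_nonneg (by positivity), div_le_iff₀ h0]
    nlinarith
  refine ⟨fun v hv => ?_, fun v v' hv hv' => ?_⟩
  · refine (hD' _).trans ?_
    have h1 : ‖(l * N / radialCube N θ v) • ((2 : ℝ) • wave N θ + v) ^ 3‖ ≤ l / 2 * 27 := by
      rw [norm_smul]
      exact mul_le_mul (hquot v hv) (hcube v hv) (norm_nonneg _) (by positivity)
    nlinarith
  · rw [profileMap, profileMap, ← map_sub]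
    refine (hD' _).trans ?_
    set s := radialCube N θ v with hs
    set s' := radialCube N θ v' with hs'
    set p := ((2 : ℝ) • wave N θ + v) ^ 3 with hp
    set p' := ((2 : ℝ) • wave N θ + v') ^ 3 with hp'
    have b1 : 2 * N ≤ s := le_radialCube hN hodd hv
    have b2 : 2 * N ≤ s' := le_radialCube hN hodd hv'
    have hs0 : 0 < s := by linarith
    have hs0' : 0 < s' := by linarith
    have e : (l * N / s) • p - (l * N / s') • p'
        = (l * N / s) • (p - p') + (l * N * (s' - s) / (s * s')) • p' := by
      ext j
      simp only [Pi.sub_apply, Pi.add_apply, Pi.smul_apply, smul_eq_mul]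
      field_simp; ring
    have h1 : ‖(l * N / s) • (p - p')‖ ≤ l / 2 * (27 * ‖v - v'‖) := by
      rw [norm_smul]
      exact mul_le_mul (hquot v hv) (norm_profile_cube_sub_le hv hv') (norm_nonneg _)
        (by positivity)
    have h2 : ‖(l * N * (s' - s) / (s * s')) • p'‖ ≤ (l / 4 * (27 * ‖v - v'‖)) * 27 := by
      rw [norm_smul]
      refine mul_le_mul ?_ (hcube v' hv') (norm_nonneg _) (by positivity)
      have h3 := abs_radialCube_sub_le (θ := θ) hv' hv
      rw [← hs, ← hs', norm_sub_rev] at h3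
      rw [Real.norm_eq_abs, abs_div, abs_mul, abs_of_pos (show 0 < l * N by positivity),
        abs_of_pos (show 0 < s * s' by positivity), div_le_iff₀ (by positivity)]
      have h4 : 2 * N * (2 * N) ≤ s * s' := by gcongr
      calc l * N * |s' - s| ≤ l * N * (N * (27 * ‖v - v'‖)) := by gcongr
        _ = l / 4 * (27 * ‖v - v'‖) * (2 * N * (2 * N)) := by ring
        _ ≤ _ := by gcongr
    rw [e]
    have h5 := norm_add_le_of_le h1 h2
    calc D * ‖(l * N / s) • (p - p') + (l * N * (s' - s) / (s * s')) • p'‖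
        ≤ D * (l / 2 * (27 * ‖v - v'‖) + (l / 4 * (27 * ‖v - v'‖)) * 27) := by gcongr
      _ = (D * l) * (783 / 4 * ‖v - v'‖) := by ring
      _ ≤ (1 / 400) * (783 / 4 * ‖v - v'‖) := by gcongr
      _ ≤ _ := by have := norm_nonneg (v - v'); linarith

theorem eventually_profile_unique (hN : 3 ≤ N) (hodd : Odd N) : ∀ᶠ l in 𝓝[>] (0 : ℝ), ∀ θ,
    ∀ v v', ‖v‖ ≤ 1 / 27 → ‖v'‖ ≤ 1 / 27 → profileMap N l θ v = v → profileMap N l θ v' = v' →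
      v = v' := by
  filter_upwards [eventually_contracting hN hodd] with l hl θ v v' hv hv' h h'
  have := (hl θ).2 v v' hv hv'
  rw [h, h'] at this
  have h0 := norm_nonneg (v - v')
  exact sub_eq_zero.1 (norm_eq_zero.1 (by linarith))

theorem eventually_exists_profile (hN : 3 ≤ N) (hodd : Odd N) : ∀ᶠ l in 𝓝[>] (0 : ℝ), ∀ θ,
    ∃ v, ‖v‖ ≤ 1 / 27 ∧ profileMap N l θ v = v := by
  filter_upwards [eventually_contracting hN hodd] with l hl θ
  obtain ⟨h1, h2⟩ := hl θ
  set s : Set (ZMod N → ℝ) := Metric.closedBall 0 (1 / 27) with hs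
  have hmem : ∀ v, v ∈ s ↔ ‖v‖ ≤ 1 / 27 := fun v => mem_closedBall_zero_iff
  have hmap : Set.MapsTo (profileMap N l θ) s s := fun v hv => (hmem _).2 (h1 v ((hmem v).1 hv))
  have hc : ContractingWith (1 / 2) (hmap.restrict (profileMap N l θ) s s) := by
    refine ⟨by rw [← NNReal.coe_lt_coe]; norm_num, LipschitzWith.of_dist_le_mul fun v v' => ?_⟩
    have := h2 v v' ((hmem _).1 v.2) ((hmem _).1 v'.2)
    rw [← dist_eq_norm, ← dist_eq_norm] at this
    exact this.trans_eq (by norm_num; rfl)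
  obtain ⟨v, hv, hfix, -⟩ := hc.exists_fixedPoint' Metric.isClosed_closedBall.isComplete hmap
    (x := 0) ((hmem 0).2 (by simp)) (edist_ne_top _ _)
  exact ⟨v, (hmem v).1 hv, hfix⟩

theorem IsPolar.wave_dot (hN : 3 ≤ N) {C l ρ θ : ℝ} {x : ZMod N → ℝ} (hx : IsPolar N C l ρ θ x)
    (α : ℝ) : wave N α ⬝ᵥ x = ρ * N * Real.cos (α - θ) := by
  rw [hx.eq, dotProduct_add, wave_dot_mult_kap, dotProduct_smul, wave_dot_wave hN, smul_eq_mul]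
  ring

/-- The three polar equations together say that `L x` and `x ^ 3` have the same component on the
modes `±1` and on the others. -/
theorem IsPolar.sol (hN : 3 ≤ N) {C l ρ θ : ℝ} {x : ZMod N → ℝ} (hl : NonRes N l)
    (hx : IsPolar N C l ρ θ x) : mult (symb N l) x = x ^ 3 := by
  have hNpos : (0 : ℝ) < N := Nat.cast_pos.2 (NeZero.pos N)
  have h := sub_mult_pw hN θ (x ^ 3)
  rw [← hx.radial, hx.tangent, mul_zero, zero_smul, add_zero, sub_eq_iff_eq_add] at h
  rw [h]
  conv_lhs => rw [hx.eq]
  rw [map_add, map_smul, mult_symb_wave hN, mult_symb_kap hl, smul_smul]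
  congr 2
  field_simp

/-- The profile of a solution is a fixed point of `profileMap`. -/
theorem IsPolar.profile {C l ρ θ : ℝ} {x : ZMod N → ℝ} (hx : IsPolar N C l ρ θ x)
    (hC : C * ρ ^ 2 ≤ 1 / 27) (hl : 0 < l) : ∃ v, ‖v‖ ≤ 1 / 27 ∧ profileMap N l θ v = v ∧
      x = ρ • ((2 : ℝ) • wave N θ + v) ∧ ρ ^ 2 = l * N / radialCube N θ v := by
  have hNpos : (0 : ℝ) < N := Nat.cast_pos.2 (NeZero.pos N)
  have hρ := hx.pos
  set v := ρ⁻¹ • (x - (2 * ρ) • wave N θ) with hv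
  have hxe : x = ρ • ((2 : ℝ) • wave N θ + v) := by
    rw [hv, smul_add, smul_smul, smul_smul, mul_inv_cancel₀ hρ.ne', one_smul, mul_comm ρ 2]
    abel
  have hrad : l * N = ρ ^ 2 * radialCube N θ v := by
    have h := hx.radial
    rw [hxe, smul_pow, dotProduct_smul, smul_eq_mul] at h
    have : (l * N) * ρ = (ρ ^ 2 * radialCube N θ v) * ρ := by rw [radialCube]; linarith
    exact mul_right_cancel₀ hρ.ne' this
  have hr0 : radialCube N θ v ≠ 0 := by
    intro h
    rw [h, mul_zero] at hrad
    exact (mul_pos hl hNpos).ne' hrad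
  have hρ2 : ρ ^ 2 = l * N / radialCube N θ v := by rw [hrad]; field_simp
  refine ⟨v, ?_, ?_, hxe, hρ2⟩
  · rw [hv, norm_smul, norm_inv, Real.norm_eq_abs, abs_of_pos hρ, inv_mul_le_iff₀ hρ]
    refine hx.norm_sub_le.trans ?_
    nlinarith
  · have h1 : x - (2 * ρ) • wave N θ = mult (kap N l) (x ^ 3) := by
      conv_lhs => rw [hx.eq]
      abel
    rw [profileMap, ← hρ2, hv, h1]
    conv_rhs => rw [hxe, smul_pow, map_smul, smul_smul]
    rw [map_smul, ← h1, ← hv]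
    congr 1
    field_simp

/-- At most one solution for each angle. -/
theorem eventually_isPolar_unique (hN : 3 ≤ N) (hodd : Odd N) (P P' : ℝ) :
    ∀ᶠ l in 𝓝[>] (0 : ℝ), ∀ (ρ ρ' θ θ' : ℝ) (x x' : ZMod N → ℝ), wave N θ = wave N θ' →
      IsPolar N P l ρ θ x → IsPolar N P' l ρ' θ' x' → x = x' := by
  have hε : 0 < 1 / (27 * (|P| + |P'| + 1)) := by positivity
  filter_upwards [eventually_profile_unique hN hodd, eventually_pos_le hε]
    with l hu hl ρ ρ' θ θ' x x' hw hx hx'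
  have hb : ∀ Q r, Q ≤ |P| + |P'| + 1 → r ^ 2 ≤ l → Q * r ^ 2 ≤ 1 / 27 := by
    intro Q r hQ hr
    have h1 := hr.trans hl.2
    rw [le_div_iff₀ (by positivity)] at h1
    nlinarith [sq_nonneg r]
  obtain ⟨v, hv, hfix, hxe, hρ⟩ := hx.profile
    (hb P ρ (by linarith [le_abs_self P, abs_nonneg P']) hx.sq_le) hl.1
  obtain ⟨v', hv', hfix', hxe', hρ'⟩ := hx'.profile
    (hb P' ρ' (by linarith [le_abs_self P', abs_nonneg P]) hx'.sq_le) hl.1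
  have e1 : profileMap N l θ v' = v' := by
    rw [profileMap, radialCube, hw]
    exact hfix'
  have hvv := hu θ v v' hv hv' hfix e1
  have hρρ : ρ = ρ' := by
    rw [← sq_eq_sq₀ hx.pos.le hx'.pos.le, hρ, hρ', hvv, radialCube, radialCube, hw]
  rw [hxe, hxe', hρρ, hvv, hw]

theorem wave_add_int_mul_two_pi (θ : ℝ) (m : ℤ) : wave N (θ + m * (2 * Real.pi)) = wave N θ := by
  ext j
  rw [wave_eq_cos, wave_eq_cos, ang, add_right_comm]
  exact Real.cos_add_int_mul_two_pi _ _

/-- Existence of a solution for each symmetric angle. -/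
theorem exists_isPolar (hN : 3 ≤ N) (hodd : Odd N) : ∃ P : ℝ, 0 < P ∧
    ∀ᶠ l in 𝓝[>] (0 : ℝ), ∀ k : ℤ, ∃ ρ x, IsPolar N P l ρ (Real.pi * k / (2 * N)) x := by
  obtain ⟨P, hP, hP'⟩ := exists_isPolar_of_eq hN hodd
  have hNpos : (0 : ℝ) < N := Nat.cast_pos.2 (NeZero.pos N)
  refine ⟨P, hP, ?_⟩
  filter_upwards [hP', eventually_profile_unique hN hodd, eventually_exists_profile hN hodd,
    eventually_pos_le (show 0 < 2 / P by positivity)] with l hP' hu he hl k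
  set θ := Real.pi * k / (2 * N) with hθ
  have hθ' : Real.pi * k / N - θ = θ := by rw [hθ]; field_simp; ring
  obtain ⟨v, hv, hfix⟩ := he θ
  have hmw : mirror k (wave N θ) = wave N θ := by rw [mirror_wave hodd, hθ']
  have hmt : mirror k (wave N (θ + Real.pi / 2)) = -wave N (θ + Real.pi / 2) := by
    rw [mirror_wave_tangent hodd, hθ']
  have hmc : ((2 : ℝ) • wave N θ + mirror k v) ^ 3 = mirror k (((2 : ℝ) • wave N θ + v) ^ 3) := by
    rw [← mirror_pow_three, map_add, map_smul, hmw]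
  have hmr : radialCube N θ (mirror k v) = radialCube N θ v := by
    rw [radialCube, hmc]
    conv_lhs => enter [1]; rw [← hmw]
    rw [mirror_dot]; rfl
  -- The mirror fixes the angle `πk/(2N)`, hence commutes with `profileMap` there; uniqueness of the
  -- fixed point makes it invariant.
  have hmv : mirror k v = v := by
    refine hu θ _ _ (by rwa [norm_mirror]) hv ?_ hfix
    rw [profileMap, hmr, hmc, ← map_smul, ← mirror_mult]
    exact congrArg (mirror k) hfix
  have hs := le_radialCube hN hodd (θ := θ) hv
  have hs0 : 0 < radialCube N θ v := by linarith
  set q := l * N / radialCube N θ v with hq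
  have hq0 : 0 < q := div_pos (mul_pos hl.1 hNpos) hs0
  have hql : q ≤ l := by
    rw [hq, div_le_iff₀ hs0]
    have := hl.1
    nlinarith
  set ρ := Real.sqrt q with hρ
  have hρ0 : 0 < ρ := Real.sqrt_pos.2 hq0
  have hρ2 : ρ ^ 2 = q := Real.sq_sqrt hq0.le
  set x := ρ • ((2 : ℝ) • wave N θ + v) with hx
  have hx3 : x ^ 3 = (ρ * q) • ((2 : ℝ) • wave N θ + v) ^ 3 := by
    rw [hx, smul_pow, ← hρ2]; congr 1; ring
  refine ⟨ρ, x, hP' ρ θ x hρ0 ?_ ?_ ?_ ?_ ?_⟩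
  · rw [hρ2]
    have := hql.trans hl.2
    rw [le_div_iff₀ hP] at this
    linarith
  · rw [hx, norm_smul, Real.norm_eq_abs, abs_of_pos hρ0]
    have := norm_two_wave_add_le (θ := θ) hv
    nlinarith
  · rw [hx3, mul_smul ρ q, (mult (kap N l)).map_smul ρ]
    have : mult (kap N l) (q • ((2 : ℝ) • wave N θ + v) ^ 3) = v := hfix
    rw [this, hx, smul_add, smul_smul, mul_comm ρ 2]
  · rw [hx3, dotProduct_smul, smul_eq_mul]
    change _ = ρ * q * radialCube N θ v
    rw [hq]; field_simp
  · rw [hx3, dotProduct_smul, smul_eq_mul]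
    -- The mirror reverses the tangent wave and preserves the cube, so their product equals its own
    -- opposite: the missing tangential equation holds.
    have h1 := mirror_dot k (wave N (θ + Real.pi / 2)) (((2 : ℝ) • wave N θ + v) ^ 3)
    rw [hmt, ← hmc, hmv, neg_dotProduct] at h1
    have h2 : wave N (θ + Real.pi / 2) ⬝ᵥ ((2 : ℝ) • wave N θ + v) ^ 3 = 0 := by linarith
    rw [h2, mul_zero]

theorem sum_wave (hN : 3 ≤ N) (θ : ℝ) : ∑ j, wave N θ j = 0 := by
  have := sum_ph (N := N) θ 1 0
  rw [if_neg (one_ne_zero_zmod hN)] at this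
  simpa [wave] using this

theorem IsPolar.not_const (hN : 3 ≤ N) {C l ρ θ : ℝ} {x : ZMod N → ℝ} (hx : IsPolar N C l ρ θ x) :
    ¬ ∀ j, x j = x 0 := by
  intro h
  have hNpos : (0 : ℝ) < N := Nat.cast_pos.2 (NeZero.pos N)
  have h1 := hx.wave_dot hN θ
  rw [sub_self, Real.cos_zero, mul_one] at h1
  have h2 : wave N θ ⬝ᵥ x = 0 := by
    simp only [dotProduct]
    rw [sum_congr rfl fun j _ => by rw [h j], ← sum_mul, sum_wave hN, zero_mul]
  have := mul_pos hx.pos hNpos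
  linarith

/-! ### Enumeration of the nonconstant solutions -/

/-- The nonconstant solutions form `4 N` points, indexed by the multiples of `π / (2 N)`. -/
theorem exists_branches (hN : 3 ≤ N) (hodd : Odd N) : ∃ P : ℝ, 0 < P ∧
    ∀ᶠ l in 𝓝[>] (0 : ℝ), ∃ (r : ℤ → ℝ) (b : ℤ → ZMod N → ℝ),
      (∀ k, IsPolar N P l (r k) (Real.pi * k / (2 * N)) (b k)) ∧
      (∀ k, mult (symb N l) (b k) = b k ^ 3) ∧
      (∀ k, ¬ ∀ j, b k j = b k 0) ∧
      (∀ x, mult (symb N l) x = x ^ 3 → (¬ ∀ j, x j = x 0) → ∃ k, x = b k) ∧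
      ∀ k k', b k = b k' ↔ (4 * N : ℤ) ∣ k - k' := by
  obtain ⟨P, hP, hP'⟩ := exists_isPolar hN hodd
  obtain ⟨Q, hQ, hQ'⟩ := exists_isPolar_of_sol hN hodd
  have hNpos : (0 : ℝ) < N := Nat.cast_pos.2 (NeZero.pos N)
  refine ⟨P, hP, ?_⟩
  filter_upwards [hP', hQ', eventually_nonRes hN, eventually_angle hN hodd Q,
    eventually_isPolar_unique hN hodd P P, eventually_isPolar_unique hN hodd Q P]
    with l hP' hQ' hl hang hu hu'
  choose r b hb using hP'
  refine ⟨r, b, hb, fun k => (hb k).sol hN hl, fun k => (hb k).not_const hN, fun x hx hnc => ?_,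
    fun k k' => ⟨fun h => ?_, fun h => ?_⟩⟩
  · obtain ⟨ρ, θ, hp⟩ := hQ' x hx hnc
    obtain ⟨k, hk⟩ := hang ρ θ x hp
    exact ⟨k, hu' _ _ _ _ _ _ (by rw [hk]) hp (hb k)⟩
  -- Pairing one point, in its two descriptions, with both waves gives `r k' = r k · c` and `r k = r
  -- k' · c`. Positivity of the amplitudes forces `c = 1`, so the angles agree modulo `2π`.
  · have h1 := (hb k).wave_dot hN (Real.pi * k' / (2 * N))
    have h2 := (hb k').wave_dot hN (Real.pi * k / (2 * N))
    have h3 := (hb k).wave_dot hN (Real.pi * k / (2 * N))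
    have h4 := (hb k').wave_dot hN (Real.pi * k' / (2 * N))
    rw [← h] at h2 h4
    rw [sub_self, Real.cos_zero, mul_one] at h3 h4
    rw [h3] at h2
    rw [h4] at h1
    rw [← Real.cos_neg, neg_sub] at h1
    have hk := (hb k).pos
    have hk' := (hb k').pos
    set c := Real.cos (Real.pi * k / (2 * N) - Real.pi * k' / (2 * N)) with hc
    have e1 : r k' = r k * c := mul_right_cancel₀ hNpos.ne' (by linarith)
    have e2 : r k = r k' * c := mul_right_cancel₀ hNpos.ne' (by linarith)
    have hc0 : 0 < c := by
      by_contra! h0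
      nlinarith
    have hc1 : c ≤ 1 := Real.cos_le_one _
    have hc2 : c = 1 := by
      have : r k * (c * c) = r k * 1 := by rw [← mul_assoc, ← e1, ← e2, mul_one]
      have := mul_left_cancel₀ hk.ne' this
      nlinarith
    obtain ⟨m, hm⟩ := (Real.cos_eq_one_iff _).1 (hc ▸ hc2)
    refine ⟨m, ?_⟩
    have hpi := Real.pi_pos
    have : (k : ℝ) - k' = 4 * N * m := by
      field_simp at hm
      linarith
    exact_mod_cast this
  · obtain ⟨m, hm⟩ := h
    refine hu _ _ _ _ _ _ ?_ (hb k) (hb k')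
    have : (k : ℝ) = k' + 4 * N * m := by
      have : k = k' + 4 * N * m := by linarith
      exact_mod_cast this
    rw [← wave_add_int_mul_two_pi (Real.pi * k' / (2 * N)) m, this]
    congr 1
    field_simp
    ring

/-! ### Gradient and Hessian of the potential -/

section Derivatives

/-- The coordinate functionals. -/
noncomputable def coord (i : ZMod N) : Config N →L[ℝ] ℝ := EuclideanSpace.proj i

theorem coord_apply (i : ZMod N) (x : Config N) : coord i x = x i := rfl

theorem hasFDerivAt_coord (i : ZMod N) (x : Config N) :
    HasFDerivAt (fun x : Config N => x i) (coord i) x :=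
  (coord i).hasFDerivAt

theorem hasDerivAt_localPotential (ξ : ℝ) : HasDerivAt localPotential (ξ ^ 3 - ξ) ξ := by
  have h := ((hasDerivAt_pow 4 ξ).const_mul (1 / 4 : ℝ)).sub
    ((hasDerivAt_pow 2 ξ).const_mul (1 / 2 : ℝ))
  refine h.congr_deriv ?_
  norm_num
  ring

theorem sum_sub_mul_sub (x y : ZMod N → ℝ) : ∑ i, (x (i + 1) - x i) * (y (i + 1) - y i)
    = ∑ i, (2 * x i - x (i + 1) - x (i - 1)) * y i := by
  have h := Equiv.sum_comp (Equiv.addRight (1 : ZMod N)) (fun i => (x i - x (i - 1)) * y i)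
  simp only [Equiv.coe_addRight, add_sub_cancel_right] at h
  simp only [mul_sub, sum_sub_distrib]
  rw [h, ← sum_sub_distrib]
  exact sum_congr rfl fun i _ => by ring

theorem hasFDerivAt_potential (γ : ℝ) (x : Config N) : HasFDerivAt (potential N γ)
    (∑ i, (x i ^ 3 - linOp γ x.ofLp i) • coord i) x := by
  have h1 : HasFDerivAt (fun x : Config N => ∑ i, localPotential (x i))
      (∑ i, (x i ^ 3 - x i) • coord i) x :=
    HasFDerivAt.fun_sum fun i _ => by
      have h := (hasDerivAt_localPotential (x i)).comp_hasFDerivAt x (hasFDerivAt_coord i x)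
      exact h
  have h2 : HasFDerivAt (fun x : Config N => ∑ i : ZMod N, (x (i + 1) - x i) ^ 2)
      (∑ i, (2 * (x (i + 1) - x i)) • (coord (i + 1)
        - coord i)) x := by
    refine HasFDerivAt.fun_sum fun i _ => ?_
    have h3 := (hasDerivAt_pow 2 (x (i + 1) - x i)).comp_hasFDerivAt x
      ((hasFDerivAt_coord (i + 1) x).sub (hasFDerivAt_coord i x))
    refine h3.congr_fderiv ?_
    norm_num
  refine (h1.add (h2.const_mul (γ / 4))).congr_fderiv ?_
  ext y
  simp only [_root_.add_apply, _root_.smul_apply,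
    _root_.sum_apply, _root_.sub_apply, coord_apply,
    smul_eq_mul]
  have h3 := sum_sub_mul_sub x.ofLp y.ofLp
  have h4 : ∑ i, 2 * (x (i + 1) - x i) * (y (i + 1) - y i)
      = 2 * ∑ i, (2 * x i - x (i + 1) - x (i - 1)) * y i := by
    rw [← h3, mul_sum]
    exact sum_congr rfl fun i _ => by ring
  rw [h4, ← mul_assoc, mul_sum, ← sum_add_distrib]
  refine sum_congr rfl fun i _ => ?_
  rw [linOp_apply]; ring

theorem fderiv_potential (γ : ℝ) : fderiv ℝ (potential N γ) = fun x : Config N =>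
    ∑ i, (x i ^ 3 - linOp γ x.ofLp i) • coord i :=
  funext fun x => (hasFDerivAt_potential γ x).fderiv

theorem mem_stationary_iff (γ : ℝ) (x : Config N) :
    x ∈ stationary N γ ↔ linOp γ x.ofLp = x.ofLp ^ 3 := by
  rw [stationary, Set.mem_ofPred_eq, gradient, LinearIsometryEquiv.map_eq_zero_iff, fderiv_potential]
  constructor
  · intro h
    ext j
    have h1 := congrArg (fun f => f (EuclideanSpace.single j (1 : ℝ))) h
    simp only [_root_.sum_apply, _root_.smul_apply,
      coord_apply, PiLp.single_apply, smul_eq_mul, mul_ite, mul_one,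
      mul_zero, sum_ite_eq', mem_univ, if_true,
      _root_.zero_apply] at h1
    rw [Pi.pow_apply]; linarith
  · intro h
    refine sum_eq_zero fun i _ => ?_
    rw [h, Pi.pow_apply, sub_self, zero_smul]

/-- The action of the Hessian at `x`. -/
noncomputable def hessOp (γ : ℝ) (x y : ZMod N → ℝ) : ZMod N → ℝ := 3 * x ^ 2 * y - linOp γ y

theorem hessian_apply (γ : ℝ) (x : Config N) (i j : ZMod N) :
    hessian N γ x i j = hessOp γ x.ofLp (Pi.single i 1) j := by
  have hlin : ∀ k, HasFDerivAt (fun x : Config N => linOp γ x.ofLp k)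
      ((LinearMap.toContinuousLinearMap ((LinearMap.proj k).comp (linOp γ))).comp
        (PiLp.continuousLinearEquiv 2 ℝ fun _ : ZMod N => ℝ).toContinuousLinearMap) x := fun k =>
    ContinuousLinearMap.hasFDerivAt ((LinearMap.toContinuousLinearMap
      ((LinearMap.proj k).comp (linOp γ))).comp
        (PiLp.continuousLinearEquiv 2 ℝ fun _ : ZMod N => ℝ).toContinuousLinearMap)
  have h1 : ∀ k, HasFDerivAt (fun x : Config N => (x k ^ 3 - linOp γ x.ofLp k) • coord k) _ x :=
    fun k => by
      have := (((hasDerivAt_pow 3 (x k)).comp_hasFDerivAt x (hasFDerivAt_coord k x)).sub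
        (hlin k)).smul_const (coord k)
      exact this
  have h := HasFDerivAt.fun_sum (u := univ) fun (k : ZMod N) _ => h1 k
  rw [hessian, Matrix.of_apply, fderiv_potential]
  rw [h.fderiv]
  simp only [_root_.sum_apply, ContinuousLinearMap.smulRight_apply,
    _root_.smul_apply, coord_apply, PiLp.single_apply,
    smul_eq_mul, mul_ite, mul_one, mul_zero, sum_ite_eq', mem_univ, if_true]
  have e : PiLp.continuousLinearEquiv 2 ℝ (fun _ : ZMod N => ℝ) (EuclideanSpace.single i 1)
      = Pi.single i 1 := rfl
  simp [hessOp, Pi.single_apply, e, coord_apply]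

end Derivatives

/-! ### Inertia of a symmetric matrix from test subspaces -/

section Inertia

variable {n : Type*} [Fintype n] [DecidableEq n]

theorem dotProduct_mulVec_eq_sum_eigenvalues {M : Matrix n n ℝ} (hM : M.IsHermitian) (y : n → ℝ) :
    y ⬝ᵥ M.mulVec y
      = ∑ i, hM.eigenvalues i * ((hM.eigenvectorBasis i).ofLp ⬝ᵥ y) ^ 2 := by
  have h := hM.eigenvectorBasis.sum_inner_mul_inner (WithLp.toLp 2 y) (WithLp.toLp 2 (M.mulVec y))
  simp only [EuclideanSpace.inner_eq_star_dotProduct, star_trivial] at h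
  rw [dotProduct_comm y, ← h]
  refine sum_congr rfl fun i _ => ?_
  rw [dotProduct_comm (M.mulVec y), Matrix.dotProduct_mulVec, ← Matrix.mulVec_transpose,
    ← Matrix.conjTranspose_eq_transpose_of_trivial, hM.eq, hM.mulVec_eigenvectorBasis,
    smul_dotProduct, smul_eq_mul]
  ring

/-- The inertia of a symmetric matrix, from a space on which its form is negative and a space of
complementary dimension on which its form is positive. -/
theorem inertia_of_forms {M : Matrix n n ℝ} (hM : M.IsHermitian) {a : ℕ} (u φ : Fin a → n → ℝ)
    (hneg : ∀ c : Fin a → ℝ, c ≠ 0 → (∑ i, c i • u i) ⬝ᵥ M.mulVec (∑ i, c i • u i) < 0)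
    (hpos : ∀ y, y ≠ 0 → (∀ i, φ i ⬝ᵥ y = 0) → 0 < y ⬝ᵥ M.mulVec y) :
    M.charpoly.roots.countP (· < 0) = a ∧ M.charpoly.roots.countP (· = 0) = 0 ∧
      M.charpoly.roots.countP (0 < ·) = Fintype.card n - a := by
  set ev := hM.eigenvalues with hev
  set v : n → n → ℝ := fun i => (hM.eigenvectorBasis i).ofLp with hv
  have hform := dotProduct_mulVec_eq_sum_eigenvalues hM
  have hc : ∀ p : ℝ → Prop, [DecidablePred p] →
      M.charpoly.roots.countP p = (univ.filter fun i => p (ev i)).card := by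
    intro p _
    rw [hM.roots_charpoly_eq_eigenvalues, Multiset.countP_map]
    rfl
  -- A vector of the negative space whose coefficients along all negative eigenvectors vanish would
  -- have a nonnegative form. So these coefficients determine it, and there are at least `a`
  -- negative eigenvalues.
  have h1 : a ≤ (univ.filter fun i => ev i < 0).card := by
    let T : (Fin a → ℝ) →ₗ[ℝ] ({i // ev i < 0} → ℝ) :=
      { toFun := fun c i => v i ⬝ᵥ ∑ k, c k • u k
        map_add' := fun c d => by
          ext i; simp only [Pi.add_apply, add_smul, sum_add_distrib, dotProduct_add]
        map_smul' := fun r c => by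
          ext i
          simp only [Pi.smul_apply, smul_eq_mul, mul_smul, ← smul_sum, dotProduct_smul,
            RingHom.id_apply] }
    have hT : Function.Injective T := by
      rw [← LinearMap.ker_eq_bot, LinearMap.ker_eq_bot']
      intro c hc0
      by_contra hne
      have h2 := hneg c hne
      rw [hform] at h2
      refine h2.not_ge (sum_nonneg fun i _ => ?_)
      rcases lt_or_ge (ev i) 0 with hi | hi
      · have : v i ⬝ᵥ ∑ k, c k • u k = 0 := congrFun hc0 ⟨i, hi⟩
        simp only [hv] at this
        rw [this]; simp
      · exact mul_nonneg hi (sq_nonneg _)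
    have := LinearMap.finrank_le_finrank_of_injective hT
    simpa [Fintype.card_subtype] using this
  -- Dually, a vector is determined by its coefficients along the positive eigenvectors and its `a`
  -- values under `φ`. The two counts leave no room for a zero eigenvalue.
  have h2 : Fintype.card n ≤ (univ.filter fun i => 0 < ev i).card + a := by
    let T : (n → ℝ) →ₗ[ℝ] ({i // 0 < ev i} → ℝ) × (Fin a → ℝ) :=
      { toFun := fun y => (fun i => v i ⬝ᵥ y, fun i => φ i ⬝ᵥ y)
        map_add' := fun c d => by
          ext i <;> simp only [dotProduct_add, Prod.fst_add, Prod.snd_add, Pi.add_apply]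
        map_smul' := fun r c => by
          ext i <;> simp [dotProduct_smul] }
    have hT : Function.Injective T := by
      rw [← LinearMap.ker_eq_bot, LinearMap.ker_eq_bot']
      intro y hy
      by_contra hne
      have h2 := hpos y hne fun i => congrFun (congrArg Prod.snd hy) i
      rw [hform] at h2
      refine h2.not_ge (sum_nonpos fun i _ => ?_)
      rcases lt_or_ge 0 (ev i) with hi | hi
      · have : v i ⬝ᵥ y = 0 := congrFun (congrArg Prod.fst hy) ⟨i, hi⟩
        simp only [hv] at this
        rw [this]; simp
      · exact mul_nonpos_of_nonpos_of_nonneg hi (sq_nonneg _)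
    have := LinearMap.finrank_le_finrank_of_injective hT
    simpa [Fintype.card_subtype] using this
  have h3 : (univ.filter fun i => ev i < 0).card + (univ.filter fun i => ev i = 0).card
      + (univ.filter fun i => 0 < ev i).card = Fintype.card n := by
    rw [card_filter, card_filter, card_filter, ← sum_add_distrib, ← sum_add_distrib,
      Fintype.card_eq_sum_ones]
    refine sum_congr rfl fun i _ => ?_
    rcases lt_trichotomy (ev i) 0 with h | h | h
    · simp [h, h.ne, h.not_gt]
    · simp [h]
    · simp [h, h.ne', h.not_gt]
  rw [hc, hc, hc]
  omega

end Inertia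

/-! ### The Hessian at the stationary points -/

theorem dotProduct_hessOp (γ : ℝ) (x y z : ZMod N → ℝ) :
    y ⬝ᵥ hessOp γ x z = 3 * ∑ i, x i ^ 2 * (y i * z i) - y ⬝ᵥ linOp γ z := by
  rw [hessOp, dotProduct_sub, mul_sum]
  congr 1
  simp only [dotProduct, Pi.mul_apply, Pi.pow_apply]
  exact sum_congr rfl fun i _ => by simp; ring

theorem dotProduct_hessOp_comm (γ : ℝ) (x y z : ZMod N → ℝ) :
    y ⬝ᵥ hessOp γ x z = z ⬝ᵥ hessOp γ x y := by
  rw [dotProduct_hessOp, dotProduct_hessOp, linOp_eq_mult, linOp_eq_mult, ← mult_symm,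
    dotProduct_comm (mult _ y)]
  simp only [mul_comm]

theorem isHermitian_hessian (γ : ℝ) (x : Config N) : (hessian N γ x).IsHermitian := by
  ext i j
  rw [Matrix.conjTranspose_apply, star_trivial, hessian_apply, hessian_apply]
  have := dotProduct_hessOp_comm γ x.ofLp (Pi.single i 1) (Pi.single j 1)
  simpa using this

theorem hessOp_add (γ : ℝ) (x y z : ZMod N → ℝ) :
    hessOp γ x (y + z) = hessOp γ x y + hessOp γ x z := by
  rw [hessOp, hessOp, hessOp, map_add]; ring

theorem hessOp_smul (γ : ℝ) (x : ZMod N → ℝ) (c : ℝ) (y : ZMod N → ℝ) :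
    hessOp γ x (c • y) = c • hessOp γ x y := by
  rw [hessOp, hessOp, map_smul, smul_sub, mul_smul_comm]

theorem hessian_mulVec (γ : ℝ) (x : Config N) (y : ZMod N → ℝ) :
    (hessian N γ x).mulVec y = hessOp γ x.ofLp y := by
  let T : (ZMod N → ℝ) →ₗ[ℝ] (ZMod N → ℝ) :=
    { toFun := hessOp γ x.ofLp, map_add' := hessOp_add γ _, map_smul' := hessOp_smul γ _ }
  have h : hessian N γ x = LinearMap.toMatrix' T := by
    ext i j
    rw [LinearMap.toMatrix'_apply]
    have := (isHermitian_hessian γ x).apply i j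
    rw [star_trivial] at this
    rw [← this, hessian_apply]
    congr 1
  rw [h, LinearMap.toMatrix'_mulVec]
  rfl

theorem isOfType_of_forms {γ : ℝ} {x : Config N} {a : ℕ} (u φ : Fin a → ZMod N → ℝ)
    (hneg : ∀ c : Fin a → ℝ, c ≠ 0 →
      (∑ i, c i • u i) ⬝ᵥ hessOp γ x.ofLp (∑ i, c i • u i) < 0)
    (hpos : ∀ y, y ≠ 0 → (∀ i, φ i ⬝ᵥ y = 0) → 0 < y ⬝ᵥ hessOp γ x.ofLp y) :
    IsOfType N γ x a 0 (N - a) := by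
  have := inertia_of_forms (isHermitian_hessian γ x) u φ
    (fun c hc => by rw [hessian_mulVec]; exact hneg c hc)
    (fun y hy hφ => by rw [hessian_mulVec]; exact hpos y hy hφ)
  rw [ZMod.card] at this
  exact this

/-- The type of a stationary point determines its number of negative eigenvalues. -/
theorem IsOfType.unique {γ : ℝ} {x : Config N} {a b c a' b' c' : ℕ}
    (h : IsOfType N γ x a b c) (h' : IsOfType N γ x a' b' c') : a = a' := h.1.symm.trans h'.1

theorem dotProduct_hessOp_symb (l : ℝ) (x y z : ZMod N → ℝ) :
    y ⬝ᵥ hessOp ((1 - l) * gammaOne N) x z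
      = 3 * ∑ i, x i ^ 2 * (y i * z i) - y ⬝ᵥ mult (symb N l) z := by
  rw [dotProduct_hessOp, mult_symb_eq_linOp]

theorem hessOp_symb (l : ℝ) (x y : ZMod N → ℝ) :
    hessOp ((1 - l) * gammaOne N) x y = 3 * x ^ 2 * y - mult (symb N l) y := by
  rw [hessOp, mult_symb_eq_linOp]

theorem dotProduct_self_pos {y : ZMod N → ℝ} (hy : y ≠ 0) : 0 < y ⬝ᵥ y := by
  simpa using Matrix.dotProduct_star_self_pos_iff.2 hy

/-- Pointwise input for the transversal positivity of the Hessian, with `x ≈ 2ρc` and test vector `a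
c + u`. Splitting the square loses a factor `2`, which is affordable: summed and tripled, the main
term is `(9/4) ρ² a² N` against about `(3/2) ρ² a² N` from the linear part. -/
theorem sq_mul_sq_lower_bound {P ρ a c u x : ℝ} (hP : 0 ≤ P) (hρ : 0 ≤ ρ) (hc : |c| ≤ 1)
    (hx : |x - 2 * ρ * c| ≤ P * ρ ^ 3) :
    2 * ρ ^ 2 * a ^ 2 * (c * c ^ 3) - 4 * ρ ^ 2 * (u * u)
      - 4 * (P * ρ ^ 4) * (2 * a ^ 2 * (c * c) + 2 * (u * u))
      ≤ x ^ 2 * ((a * c + u) * (a * c + u)) := by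
  have hc2 : c ^ 2 ≤ 1 := (sq_le_one_iff_abs_le_one _).2 hc
  have hcw : |c * (x - 2 * ρ * c)| ≤ P * ρ ^ 3 := by
    rw [abs_mul]
    exact (mul_le_of_le_one_left (abs_nonneg _) hc).trans hx
  have hx2 : 4 * ρ ^ 2 * c ^ 2 - 4 * (P * ρ ^ 4) ≤ x ^ 2 := by
    have h1 := mul_le_mul_of_nonneg_left (abs_le.1 hcw).1 (show 0 ≤ 4 * ρ by positivity)
    nlinarith [sq_nonneg (x - 2 * ρ * c)]
  have hy2 : a ^ 2 * c ^ 2 / 2 - u ^ 2 ≤ (a * c + u) ^ 2 := by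
    nlinarith [sq_nonneg (a * c + 2 * u)]
  have hy3 : (a * c + u) ^ 2 ≤ 2 * a ^ 2 * c ^ 2 + 2 * u ^ 2 := by
    nlinarith [sq_nonneg (a * c - u)]
  have h1 := mul_le_mul_of_nonneg_left hy2 (show 0 ≤ 4 * ρ ^ 2 * c ^ 2 by positivity)
  have h2 := mul_le_mul_of_nonneg_left hy3 (show 0 ≤ 4 * (P * ρ ^ 4) by positivity)
  have h3 := mul_le_mul_of_nonneg_right hx2 (sq_nonneg (a * c + u))
  have h4 := mul_le_mul_of_nonneg_left hc2 (show 0 ≤ 4 * ρ ^ 2 * u ^ 2 by positivity)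
  linarith

/-- Positivity of the Hessian at a small solution, transversally to the constants and to the
tangent wave. -/
theorem eventually_hess_pos (hN : 3 ≤ N) (hodd : Odd N) {P : ℝ} (hP : 0 < P) :
    ∀ᶠ l in 𝓝[>] (0 : ℝ), ∀ (ρ θ : ℝ) (x : ZMod N → ℝ), IsPolar N P l ρ θ x →
      ∀ y : ZMod N → ℝ, ∑ j, y j = 0 → wave N (θ + Real.pi / 2) ⬝ᵥ y = 0 →
        ρ ^ 2 / 4 * (y ⬝ᵥ y) ≤ y ⬝ᵥ hessOp ((1 - l) * gammaOne N) x y := by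
  obtain ⟨κ, hκ, hgap⟩ := exists_gap hN
  have hNpos : (0 : ℝ) < N := Nat.cast_pos.2 (NeZero.pos N)
  have hε : 0 < min (κ / 14) (1 / (25 * P)) := by positivity
  filter_upwards [hgap, eventually_pos_le hε] with l hgap hl ρ θ x hx y hy0 hyt
  have hρ := hx.pos
  have hρ1 : 14 * ρ ^ 2 ≤ κ := by
    have := (hx.sq_le.trans hl.2).trans (min_le_left _ _)
    linarith
  have hρ2 : 25 * (P * ρ ^ 2) ≤ 1 := by
    have := (hx.sq_le.trans hl.2).trans (min_le_right _ _)
    rw [le_div_iff₀ (by positivity)] at this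
    linarith
  set c := wave N θ with hc
  set a := 2 / N * (c ⬝ᵥ y) with ha
  set u := y - a • c with hu
  have hyu : y = a • c + u := by rw [hu]; abel
  have hcc : c ⬝ᵥ c = N / 2 := by rw [hc, wave_dot_wave hN, sub_self, Real.cos_zero, mul_one]
  have htc : wave N (θ + Real.pi / 2) ⬝ᵥ c = 0 := by
    rw [hc, wave_dot_wave hN, add_sub_cancel_left, Real.cos_pi_div_two, mul_zero]
  have hcu : c ⬝ᵥ u = 0 := by
    rw [hu, dotProduct_sub, dotProduct_smul, hcc, smul_eq_mul, ha]; field_simp; ring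
  have htu : wave N (θ + Real.pi / 2) ⬝ᵥ u = 0 := by
    rw [hu, dotProduct_sub, dotProduct_smul, htc, hyt, smul_zero, sub_zero]
  have hwu : ∀ α, wave N α ⬝ᵥ u = 0 := by
    intro α
    rw [show α = θ + (α - θ) by ring, wave_add, add_dotProduct, smul_dotProduct, smul_dotProduct,
      htu, ← hc, hcu]
    simp
  have hu0 : ∑ j, u j = 0 := by
    have := sum_wave hN θ
    simp only [hu, Pi.sub_apply, Pi.smul_apply, smul_eq_mul, sum_sub_distrib, ← mul_sum, hy0, hc,
      this]
    ring
  set U := u ⬝ᵥ u with hU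
  have hU0 : 0 ≤ U := sum_nonneg fun i _ => mul_self_nonneg _
  -- The wave and `u` decouple under the circulant operator: the wave contributes through its
  -- eigenvalue `l`, and `u` gains the spectral gap.
  have hL : y ⬝ᵥ mult (symb N l) y ≤ a ^ 2 * l * (N / 2) - κ * U := by
    have h1 := dot_symb_le_neg hgap hu0 hwu
    have h2 : y ⬝ᵥ mult (symb N l) y = a ^ 2 * l * (N / 2) + u ⬝ᵥ mult (symb N l) u := by
      rw [hyu, map_add, map_smul, hc, mult_symb_wave hN, ← hc, add_dotProduct, dotProduct_add,
        dotProduct_add, smul_dotProduct, smul_dotProduct, dotProduct_smul, dotProduct_smul,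
        dotProduct_smul, dotProduct_smul, hcc, dotProduct_comm u c, hcu, hc,
        wave_dot_mult_symb hN, ← hc, hcu]
      simp only [smul_eq_mul]; ring
    rw [h2]; linarith
  have hyy : y ⬝ᵥ y = a ^ 2 * (N / 2) + U := by
    rw [hyu, add_dotProduct, dotProduct_add, dotProduct_add, smul_dotProduct, smul_dotProduct,
        dotProduct_smul, dotProduct_smul, hcc, dotProduct_comm u c, hcu]
    simp only [smul_eq_mul]; ring
  have hpt : ∀ j, 2 * ρ ^ 2 * a ^ 2 * (c j * c j ^ 3) - 4 * ρ ^ 2 * (u j * u j)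
      - 4 * (P * ρ ^ 4) * (2 * a ^ 2 * (c j * c j) + 2 * (u j * u j)) ≤ x j ^ 2 * (y j * y j) := by
    intro j
    have hw : |x j - 2 * ρ * c j| ≤ P * ρ ^ 3 := by
      have := (norm_le_pi_norm (x - (2 * ρ) • wave N θ) j).trans hx.norm_sub_le
      simpa using this
    have hyj : y j = a * c j + u j := congrFun hyu j
    rw [hyj]
    exact sq_mul_sq_lower_bound hP.le hρ.le (abs_ph_le θ j) hw
  have hsum := sum_le_sum fun j (_ : j ∈ univ) => hpt j
  have hc4 : ∑ j, c j * c j ^ 3 = 3 * N / 8 := wave_dot_wave_cube hN hodd θ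
  have hc2 : ∑ j, c j * c j = N / 2 := hcc
  have hu2 : ∑ j, u j * u j = U := rfl
  simp only [sum_sub_distrib, sum_add_distrib, ← mul_sum, hc4, hc2, hu2] at hsum
  rw [dotProduct_hessOp_symb, hyy]
  have hl3 : l ≤ 3 * ρ ^ 2 + P * ρ ^ 4 := by
    have := (abs_le.1 hx.abs_le).2
    linarith
  have h1 : a ^ 2 * l * (N / 2) ≤ a ^ 2 * (3 * ρ ^ 2 + P * ρ ^ 4) * (N / 2) := by gcongr
  have h2 : 25 * (P * ρ ^ 4) ≤ ρ ^ 2 := by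
    have := mul_le_mul_of_nonneg_right hρ2 (sq_nonneg ρ)
    linarith
  have h3 : (a ^ 2 * N) * (25 * (P * ρ ^ 4)) ≤ (a ^ 2 * N) * ρ ^ 2 := by gcongr
  have h4 : U * (25 * (P * ρ ^ 4)) ≤ U * ρ ^ 2 := by gcongr
  have h5 : U * (14 * ρ ^ 2) ≤ U * κ := by gcongr
  have h6 : 0 ≤ a ^ 2 * N * ρ ^ 2 := by positivity
  have h7 : 0 ≤ U * ρ ^ 2 := by positivity
  have h8 : 0 ≤ U * (P * ρ ^ 4) := by positivity
  linarith

set_option maxHeartbeats 1000000 in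
/-- The almost neutral direction along the approximate solutions. -/
theorem exists_tangent_vector (hN : 3 ≤ N) (hodd : Odd N) (P : ℝ) : ∃ C : ℝ, 0 < C ∧
    ∀ᶠ l in 𝓝[>] (0 : ℝ), ∀ (ρ : ℝ) (k : ℤ) (x : ZMod N → ℝ),
      IsPolar N P l ρ (Real.pi * k / (2 * N)) x → ∃ ξ : ZMod N → ℝ,
        wave N (Real.pi * k / (2 * N) + Real.pi / 2) ⬝ᵥ ξ = ρ * N ∧
        ‖hessOp ((1 - l) * gammaOne N) x ξ‖ ≤ C * ρ ^ (2 * N - 1) ∧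
        |ξ ⬝ᵥ hessOp ((1 - l) * gammaOne N) x ξ
          + 4 * N ^ 2 * resCoeff N l * (-1) ^ k * ρ ^ (2 * N)| ≤ C * ρ ^ (2 * N + 1) := by
  obtain ⟨A, hA, hA'⟩ := exists_isApprox hN hodd
  obtain ⟨B, hB, hB'⟩ := exists_norm_sub_approx_le hN (P := P) hA
  have hNpos : (0 : ℝ) < N := Nat.cast_pos.2 (NeZero.pos N)
  set R := |resCoeff N 0| + 1 with hR
  have hR0 : 0 < R := by positivity
  have hres : ∀ᶠ l in 𝓝[>] (0 : ℝ), |resCoeff N l| < R :=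
    nhdsWithin_le_nhds ((continuousAt_resCoeff hN).abs.eventually_lt_const (by rw [hR]; linarith))
  set E := 3 * (B * (4 + A)) * A with hE
  have hE0 : 0 < E := by positivity
  set C := E + A + 2 / N * A + (2 * B + 4 * N * R) + (N * (A * E) + N * (A * A) + 2 * (N * B))
    with hC
  refine ⟨C, by positivity, ?_⟩
  filter_upwards [hA', hB', hres, eventually_nonRes hN, eventually_pos_le zero_lt_one]
    with l hA' hB' hres hnr hl ρ k x hx
  set θ := Real.pi * k / (2 * N) with hθ
  have h2N : 2 * N * θ = k * Real.pi := by rw [hθ]; field_simp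
  have hρ := hx.pos
  have hρ1 : ρ ≤ 1 := by
    have := hx.sq_le.trans hl.2
    nlinarith
  obtain ⟨Φ, Rem, hΦ⟩ := hA' ρ hρ.le hρ1
  obtain ⟨hy, hz⟩ := hB' ρ θ Φ Rem x hΦ hx
  -- Rotation would be an exact symmetry without aliasing, so the angular derivative of the
  -- approximate branch is nearly in the kernel of the Hessian.
  set ξ := deriv Φ θ with hξ
  set R' := deriv Rem θ with hR'
  set y := x ^ 3 - (Φ θ ^ 3 - Rem θ) with hydef
  set c := wave N θ with hc
  set t := wave N (θ + Real.pi / 2) with ht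
  set s := 3 * Φ θ ^ 2 * ξ - R' with hs
  have dΦ : HasDerivAt Φ ξ θ := (hΦ.diff θ).hasDerivAt
  have dR : HasDerivAt Rem R' θ := (hΦ.diff_rem θ).hasDerivAt
  have dS : HasDerivAt (fun θ => Φ θ ^ 3 - Rem θ) s θ := by
    have h := (dΦ.fun_pow 3).fun_sub dR
    exact h
  have eξ : ξ = (2 * ρ) • t + mult (kap N l) s := by
    have h1 := ((hasDerivAt_wave (N := N) θ).fun_const_smul (2 * ρ)).fun_add
      (hasDerivAt_mult (kap N l) dS)
    have h2 : Φ = fun θ => (2 * ρ) • wave N θ + mult (kap N l) (Φ θ ^ 3 - Rem θ) := funext hΦ.eq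
    rw [← h2] at h1
    exact dΦ.unique h1
  have eL : mult (symb N l) ξ = (2 * ρ * l) • t + mult (pw N) s := by
    rw [eξ, map_add, map_smul, ht, mult_symb_wave hN, mult_symb_kap hnr, smul_smul]
  have eS := sub_mult_pw hN θ s
  rw [← hc, ← ht] at eS
  have eH : hessOp ((1 - l) * gammaOne N) x ξ = (3 * (x ^ 2 - Φ θ ^ 2) * ξ + R')
      + (2 / N * (c ⬝ᵥ s)) • c + (2 / N * (t ⬝ᵥ s) - 2 * ρ * l) • t := by
    rw [hessOp_symb, eL, sub_smul, ← add_sub_assoc, add_assoc _ _ ((2 / N * (t ⬝ᵥ s)) • t), ← eS,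
      hs]
    ring
  have hcc : c ⬝ᵥ c = N / 2 := by rw [hc, wave_dot_wave hN, sub_self, Real.cos_zero, mul_one]
  have htt : t ⬝ᵥ t = N / 2 := by rw [ht, wave_dot_wave hN, sub_self, Real.cos_zero, mul_one]
  have hct : c ⬝ᵥ t = 0 := by
    rw [hc, ht, wave_dot_wave hN, sub_add_cancel_left, Real.cos_neg, Real.cos_pi_div_two, mul_zero]
  have hcξ : c ⬝ᵥ ξ = 0 := by
    rw [eξ, dotProduct_add, dotProduct_smul, hct, hc, wave_dot_mult_kap, smul_zero, add_zero]
  have htξ : t ⬝ᵥ ξ = ρ * N := by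
    rw [eξ, dotProduct_add, dotProduct_smul, htt, ht, wave_dot_mult_kap, smul_eq_mul]; ring
  have hwpi : wave N (θ + Real.pi / 2 + Real.pi / 2) = -c := by
    rw [add_assoc, add_halves, wave_add, Real.cos_pi, Real.sin_pi]; simp [hc]
  have hcosk : Real.cos (2 * N * θ) = (-1) ^ k := by
    rw [h2N, ← zero_add (k * Real.pi), Real.cos_add_int_mul_pi, Real.cos_zero, mul_one]
  have hsink : Real.sin (2 * N * θ) = 0 := by rw [h2N, Real.sin_int_mul_pi]
  -- Obtained by differentiating the tangential identity in the angle: the wave turns into `-c`, and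
  -- the sine into a cosine equal to `(-1) ^ k` at this angle.
  have hts : t ⬝ᵥ s = c ⬝ᵥ (Φ θ ^ 3 - Rem θ)
      - 2 * N ^ 2 * resCoeff N l * (-1) ^ k * ρ ^ (2 * N - 1) := by
    have dt : HasDerivAt (fun θ => wave N (θ + Real.pi / 2)) (-c) θ := by
      rw [← hwpi]; exact (hasDerivAt_wave (θ + Real.pi / 2)).comp_add_const θ (Real.pi / 2)
    have d1 := hasDerivAt_dotProduct dt dS
    have d2 : HasDerivAt (fun θ => - (N * resCoeff N l * ρ ^ (2 * N - 1) * Real.sin (2 * N * θ)))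
        (-(N * resCoeff N l * ρ ^ (2 * N - 1) * (Real.cos (2 * N * θ) * (2 * N * 1)))) θ :=
      ((((hasDerivAt_id θ).const_mul (2 * N : ℝ)).sin).const_mul _).fun_neg
    have e : (fun θ => wave N (θ + Real.pi / 2) ⬝ᵥ (Φ θ ^ 3 - Rem θ))
        = fun θ => - (N * resCoeff N l * ρ ^ (2 * N - 1) * Real.sin (2 * N * θ)) :=
      funext hΦ.tangent
    rw [e] at d1
    have := d1.unique d2
    rw [hcosk, neg_dotProduct, ← ht] at this
    linarith
  have hcs : |c ⬝ᵥ s| ≤ A * ρ ^ (2 * N - 1) := by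
    have d1 := hasDerivAt_dotProduct (hasDerivAt_wave (N := N) θ) dS
    have h1 := hΦ.radial θ
    rw [d1.deriv, hΦ.tangent, hsink, mul_zero, neg_zero, zero_add] at h1
    exact h1
  have hcS : c ⬝ᵥ (Φ θ ^ 3 - Rem θ) = l * ρ * N - c ⬝ᵥ y := by
    have h := hx.radial
    rw [← hc] at h
    rw [hydef, dotProduct_sub c (x ^ 3), h]; ring
  have hcy : |c ⬝ᵥ y| ≤ N * (B * ρ ^ (2 * N)) := by
    refine (abs_dotProduct_le _ _).trans ?_
    have := mul_le_mul (norm_wave_le (N := N) θ) hy (norm_nonneg _) zero_le_one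
    rw [one_mul] at this
    gcongr
  have hpow : ρ ^ (2 * N) = ρ ^ (2 * N - 1) * ρ := by rw [← pow_succ]; congr 1; omega
  have hτ : 2 / N * (t ⬝ᵥ s) - 2 * ρ * l
      = -(2 / N * (c ⬝ᵥ y)) - 4 * N * resCoeff N l * (-1) ^ k * ρ ^ (2 * N - 1) := by
    rw [hts, hcS]; field_simp; ring
  have b1 : ‖ξ‖ ≤ A * ρ := hΦ.norm_deriv_le θ
  have b2 : ‖R'‖ ≤ A * ρ ^ (2 * N) := hΦ.norm_deriv_rem_le θ
  have b3 : ‖3 * (x ^ 2 - Φ θ ^ 2) * ξ‖ ≤ E * ρ ^ (2 * N) := by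
    have h3 : ‖(3 : ZMod N → ℝ)‖ ≤ 3 :=
      (pi_norm_le_iff_of_nonneg (by norm_num)).2 fun j => by
        rw [Pi.ofNat_apply, Real.norm_eq_abs, abs_of_pos (by norm_num)]
    have e : x ^ 2 - Φ θ ^ 2 = (x - Φ θ) * (x + Φ θ) := by ring
    rw [e]
    refine (norm_mul_le_of_le (norm_mul_le_of_le h3 (norm_mul_le_of_le hz
      (norm_add_le_of_le hx.norm_le (hΦ.norm_le θ)))) b1).trans ?_
    have h4 : E * ρ ^ (2 * N) * ρ ^ 2 ≤ E * ρ ^ (2 * N) * 1 := by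
      gcongr; exact pow_le_one₀ hρ.le hρ1
    rw [hE] at h4 ⊢
    linarith
  have hk1 : |((-1 : ℝ) ^ k)| = 1 := by simp
  have hp0 : 0 < ρ ^ (2 * N - 1) := by positivity
  have hple : ρ ^ (2 * N) ≤ ρ ^ (2 * N - 1) := by rw [hpow]; nlinarith
  have hCN : 0 ≤ 2 / N * A := by positivity
  refine ⟨ξ, htξ, ?_, ?_⟩
  · have b4 : ‖(2 / N * (c ⬝ᵥ s)) • c‖ ≤ 2 / N * A * ρ ^ (2 * N - 1) := by
      rw [norm_smul, Real.norm_eq_abs, abs_mul, abs_of_pos (by positivity : (0 : ℝ) < 2 / N)]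
      refine (mul_le_of_le_one_right (by positivity) (norm_wave_le θ)).trans ?_
      rw [mul_assoc]; gcongr
    have b5 : ‖(2 / N * (t ⬝ᵥ s) - 2 * ρ * l) • t‖ ≤ (2 * B + 4 * N * R) * ρ ^ (2 * N - 1) := by
      rw [norm_smul, Real.norm_eq_abs]
      refine (mul_le_of_le_one_right (abs_nonneg _) (norm_wave_le _)).trans ?_
      rw [hτ]
      refine (abs_sub _ _).trans ?_
      rw [abs_neg, abs_mul, abs_of_pos (by positivity : (0 : ℝ) < 2 / N), abs_mul, abs_mul, abs_mul,
        hk1, abs_of_pos hp0, abs_of_pos (show (0 : ℝ) < 4 * N by positivity), mul_one]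
      have h1 : 2 / N * |c ⬝ᵥ y| ≤ 2 * B * ρ ^ (2 * N) := by
        calc 2 / N * |c ⬝ᵥ y| ≤ 2 / N * (N * (B * ρ ^ (2 * N))) := by gcongr
          _ = _ := by field_simp
      have h2 : 4 * N * |resCoeff N l| * ρ ^ (2 * N - 1) ≤ 4 * N * R * ρ ^ (2 * N - 1) := by gcongr
      have h3 : 2 * B * ρ ^ (2 * N) ≤ 2 * B * ρ ^ (2 * N - 1) := by gcongr
      linarith
    rw [eH]
    have h1 := norm_add_le_of_le (norm_add_le_of_le (norm_add_le_of_le b3 b2) b4) b5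
    have h2 : (E + A) * ρ ^ (2 * N) ≤ (E + A) * ρ ^ (2 * N - 1) := by gcongr
    have h3 : 0 ≤ (N * (A * E) + N * (A * A) + 2 * (N * B)) * ρ ^ (2 * N - 1) := by positivity
    rw [hC]
    linarith
  -- The component of `H ξ` along `c` is only `O(ρ^(2N-1))`, too large for the claimed error, but
  -- `ξ` is exactly orthogonal to `c`. The leading term comes from the component along `t` and `t ⬝ᵥ
  -- ξ = ρ N`.
  · have e : ξ ⬝ᵥ hessOp ((1 - l) * gammaOne N) x ξ
        + 4 * N ^ 2 * resCoeff N l * (-1) ^ k * ρ ^ (2 * N)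
        = ξ ⬝ᵥ (3 * (x ^ 2 - Φ θ ^ 2) * ξ) + ξ ⬝ᵥ R' - 2 * ρ * (c ⬝ᵥ y) := by
      rw [eH, dotProduct_add, dotProduct_add, dotProduct_add, dotProduct_smul, dotProduct_smul,
        dotProduct_comm ξ c, hcξ, dotProduct_comm ξ t, htξ, hτ, hpow, smul_zero, smul_eq_mul]
      field_simp; ring
    rw [e]
    have h1 : |ξ ⬝ᵥ (3 * (x ^ 2 - Φ θ ^ 2) * ξ)| ≤ N * ((A * ρ) * (E * ρ ^ (2 * N))) :=
      (abs_dotProduct_le _ _).trans (mul_le_mul_of_nonneg_left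
        (mul_le_mul b1 b3 (norm_nonneg _) (by positivity)) hNpos.le)
    have h2 : |ξ ⬝ᵥ R'| ≤ N * ((A * ρ) * (A * ρ ^ (2 * N))) :=
      (abs_dotProduct_le _ _).trans (mul_le_mul_of_nonneg_left
        (mul_le_mul b1 b2 (norm_nonneg _) (by positivity)) hNpos.le)
    have h3 : |2 * ρ * (c ⬝ᵥ y)| ≤ 2 * ρ * (N * (B * ρ ^ (2 * N))) := by
      rw [abs_mul, abs_of_pos (show 0 < 2 * ρ by positivity)]; gcongr
    refine (abs_sub _ _).trans ((add_le_add (abs_add_le _ _) h3).trans ?_)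
    have h4 : 0 ≤ (E + A + 2 / N * A + (2 * B + 4 * N * R)) * ρ ^ (2 * N + 1) := by positivity
    have h5 : ρ ^ (2 * N + 1) = ρ ^ (2 * N) * ρ := pow_succ _ _
    rw [hC]
    have h6 : N * ((A * ρ) * (E * ρ ^ (2 * N))) + N * ((A * ρ) * (A * ρ ^ (2 * N)))
        + 2 * ρ * (N * (B * ρ ^ (2 * N)))
        = (N * (A * E) + N * (A * A) + 2 * (N * B)) * ρ ^ (2 * N + 1) := by rw [h5]; ring
    linarith

/-- Completing the square: `m ^ 2 ≤ Y * K` with `K < q * p` is a negative discriminant, with the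
degenerate case `Y = 0` treated apart. -/
theorem quadratic_pos {b m p q K Y : ℝ} (hq : 0 < q) (hY : 0 ≤ Y) (hm : m ^ 2 ≤ Y * K)
    (hK : K < q * p) (h : b ≠ 0 ∨ 0 < Y) : 0 < b ^ 2 * q + 2 * b * m + p * Y := by
  rcases hY.eq_or_lt with h0 | h0
  · have hb : b ≠ 0 := h.resolve_right (by rw [← h0]; exact lt_irrefl _)
    rw [← h0, zero_mul] at hm
    have hm0 : m = 0 := pow_eq_zero_iff two_ne_zero |>.1 (le_antisymm hm (sq_nonneg _))
    rw [← h0, hm0]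
    have : 0 < b ^ 2 := by positivity
    nlinarith
  · have h1 : 0 < q * (b ^ 2 * q + 2 * b * m + p * Y) := by
      nlinarith [sq_nonneg (b * q + m), mul_pos h0 (sub_pos.2 hK)]
    exact (mul_pos_iff_of_pos_left hq).1 h1

theorem mult_symb_const (l : ℝ) : mult (symb N l) 1 = 1 := by
  rw [mult_symb_eq_linOp]
  ext j
  simp only [linOp_apply, Pi.one_apply]; ring

theorem one_dot_hessOp_one (l : ℝ) (x : ZMod N → ℝ) :
    (1 : ZMod N → ℝ) ⬝ᵥ hessOp ((1 - l) * gammaOne N) x 1 = 3 * ∑ i, x i ^ 2 - N := by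
  rw [dotProduct_hessOp_symb, mult_symb_const]
  simp [ZMod.card]

theorem dotProduct_sq_le (x y : ZMod N → ℝ) : (x ⬝ᵥ y) ^ 2 ≤ (x ⬝ᵥ x) * (y ⬝ᵥ y) := by
  have := sum_mul_sq_le_sq_mul_sq univ x y
  simpa only [dotProduct, ← sq] using this

theorem dotProduct_self_nonneg (x : ZMod N → ℝ) : 0 ≤ x ⬝ᵥ x :=
  sum_nonneg fun _ _ => mul_self_nonneg _

set_option maxHeartbeats 1000000 in
/-- The types of the solutions of the branches. -/
theorem eventually_isOfType (hN : 3 ≤ N) (hodd : Odd N) {P : ℝ} (hP : 0 < P) :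
    ∀ᶠ l in 𝓝[>] (0 : ℝ), resCoeff N l ≠ 0 ∧ ∀ (ρ : ℝ) (k : ℤ) (x : ZMod N → ℝ),
      IsPolar N P l ρ (Real.pi * k / (2 * N)) x →
        (resCoeff N l * (-1) ^ k < 0 →
          IsOfType N ((1 - l) * gammaOne N) (WithLp.toLp 2 x) 1 0 (N - 1)) ∧
        (0 < resCoeff N l * (-1) ^ k →
          IsOfType N ((1 - l) * gammaOne N) (WithLp.toLp 2 x) 2 0 (N - 2)) := by
  obtain ⟨C, hC, hC'⟩ := exists_tangent_vector hN hodd P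
  have hN1 : (1 : ℝ) ≤ N := by exact_mod_cast NeZero.one_le
  have hNpos : (0 : ℝ) < N := by linarith
  set r := |resCoeff N 0| / 2 with hr
  have hr0 : 0 < |resCoeff N 0| := abs_pos.2 (resCoeff_zero_ne_zero hN hodd)
  have hr1 : 0 < r := by positivity
  have hres : ∀ᶠ l in 𝓝[>] (0 : ℝ), r < |resCoeff N l| :=
    nhdsWithin_le_nhds ((continuousAt_resCoeff hN).abs.eventually_const_lt (by rw [hr]; linarith))
  have hε : 0 < min (min (1 / 96) ((r / C) ^ 2)) (r / (8 * N * C ^ 2)) := by positivity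
  filter_upwards [hC', eventually_hess_pos hN hodd hP, hres, eventually_pos_le hε]
    with l hC' hpos hres hl
  refine ⟨abs_pos.1 (hr1.trans hres), fun ρ k x hx => ?_⟩
  set θ := Real.pi * k / (2 * N) with hθ
  set γ := (1 - l) * gammaOne N with hγ
  obtain ⟨ξ, htξ, hHξ, hq⟩ := hC' ρ k x hx
  have hpos := hpos ρ θ x hx
  rw [← hθ] at htξ
  set t := wave N (θ + Real.pi / 2) with ht
  have hρ := hx.pos
  have hρl := hx.sq_le.trans hl.2
  have hρ1 : 96 * ρ ^ 2 ≤ 1 := by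
    have := hρl.trans ((min_le_left _ _).trans (min_le_left _ _)); linarith
  have hρ1' : ρ ≤ 1 := by nlinarith
  have hρ2 : C * ρ ≤ r := by
    have := le_of_sq_le_sq (hρl.trans ((min_le_left _ _).trans (min_le_right _ _)))
      (by positivity)
    rwa [le_div_iff₀ hC, mul_comm] at this
  have hρ3 : 8 * N * C ^ 2 * ρ ^ 2 ≤ r := by
    have := hρl.trans (min_le_right _ _)
    rwa [le_div_iff₀ (by positivity), mul_comm] at this
  set H := hessOp γ x ξ with hH
  set q := ξ ⬝ᵥ H with hqd
  have hp0 : 0 < ρ ^ (2 * N) := by positivity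
  have hqabs : ∀ s : ℝ, s ≤ -r → |q + 4 * N ^ 2 * s * ρ ^ (2 * N)| ≤ C * ρ ^ (2 * N + 1) →
      r * ρ ^ (2 * N) ≤ q := by
    intro s hs h
    have h1 := (abs_le.1 h).1
    have h2 : C * ρ ^ (2 * N + 1) ≤ r * ρ ^ (2 * N) := by
      rw [pow_succ, mul_comm (ρ ^ (2 * N)), ← mul_assoc]; gcongr
    have h3 : 2 * r ≤ 4 * N ^ 2 * -s := by
      have : (1 : ℝ) ≤ N ^ 2 := one_le_pow₀ hN1
      nlinarith
    have h4 := mul_le_mul_of_nonneg_right h3 hp0.le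
    linarith
  -- `4N - 2 ≥ 2N + 4` is the condition `N ≥ 3`. It makes the cross terms, of order `ρ^(4N-2)` once
  -- squared, negligible against `ρ^(2N) · ρ²`.
  have hpow : (ρ ^ (2 * N - 1)) ^ 2 ≤ ρ ^ (2 * N) * ρ ^ 4 := by
    rw [← pow_mul, ← pow_add]
    exact pow_le_pow_of_le_one hρ.le hρ1' (by omega)
  have hone : ∀ y : ZMod N → ℝ, (1 : ZMod N → ℝ) ⬝ᵥ y = ∑ j, y j := fun y => one_dotProduct y
  -- The form on constants is `3 ∑ x² - N`, and `∑ x² ≤ 16 N ρ²` with `96 ρ² ≤ 1`.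
  have hHone : (1 : ZMod N → ℝ) ⬝ᵥ hessOp γ x 1 ≤ -(N / 2) := by
    rw [hγ, one_dot_hessOp_one]
    have : ∑ i, x i ^ 2 ≤ N * (16 * ρ ^ 2) := by
      refine (sum_le_sum (g := fun _ => 16 * ρ ^ 2) fun j _ => ?_).trans (by simp [ZMod.card])
      have := (norm_le_pi_norm x j).trans hx.norm_le
      rw [Real.norm_eq_abs] at this
      have h2 := sq_le_sq' (by linarith [neg_abs_le (x j)]) ((le_abs_self _).trans this)
      linarith
    nlinarith
  have hHH : H ⬝ᵥ H ≤ N * (C * ρ ^ (2 * N - 1)) ^ 2 := by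
    refine (le_abs_self _).trans ((abs_dotProduct_le _ _).trans ?_)
    rw [sq]
    exact mul_le_mul_of_nonneg_left (mul_le_mul hHξ hHξ (norm_nonneg _) (by positivity)) hNpos.le
  constructor
  · intro hs
    have hq1 : r * ρ ^ (2 * N) ≤ q := by
      refine hqabs (resCoeff N l * (-1) ^ k) ?_ (by rwa [← mul_assoc])
      have : |resCoeff N l * (-1) ^ k| = |resCoeff N l| := by simp [abs_mul]
      rw [abs_of_neg hs] at this
      linarith
    have hq0 : 0 < q := lt_of_lt_of_le (by positivity) hq1
    -- The functional is chosen so that, on its kernel, subtracting the multiple of `ξ` that removes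
    -- the component along `t` leaves a vector of mean zero, to which the transversal bound applies.
    refine isOfType_of_forms ![1] ![1 - ((1 : ZMod N → ℝ) ⬝ᵥ ξ / (ρ * N)) • t]
      (fun c hc => ?_) (fun y hy hφ => ?_)
    · have hc0 : c 0 ≠ 0 := by
        intro h; apply hc; ext i; fin_cases i; exact h
      simp only [univ_unique, Fin.default_eq_zero, sum_singleton, Matrix.cons_val_fin_one,
        hessOp_smul, smul_dotProduct, dotProduct_smul, smul_eq_mul]
      have : 0 < c 0 * c 0 := mul_self_pos.2 hc0
      nlinarith
    · have hφ0 := hφ 0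
      simp only [Matrix.cons_val_fin_one, sub_dotProduct, smul_dotProduct, smul_eq_mul] at hφ0
      set b := (t ⬝ᵥ y) / (ρ * N) with hb
      set y0 := y - b • ξ with hy0
      have hye : y = b • ξ + y0 := by rw [hy0]; abel
      have hty0 : t ⬝ᵥ y0 = 0 := by
        rw [hy0, dotProduct_sub, dotProduct_smul, htξ, smul_eq_mul, hb]; field_simp; ring
      have h1y0 : ∑ j, y0 j = 0 := by
        rw [← hone, hy0, dotProduct_sub, dotProduct_smul, smul_eq_mul, hb, ← hφ0]; ring
      have hpy := hpos y0 h1y0 hty0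
      have hform : y ⬝ᵥ hessOp γ x y
          = b ^ 2 * q + 2 * b * (y0 ⬝ᵥ H) + y0 ⬝ᵥ hessOp γ x y0 := by
        rw [hye, hessOp_add, hessOp_smul, add_dotProduct, dotProduct_add, dotProduct_add,
          smul_dotProduct, smul_dotProduct, dotProduct_smul, dotProduct_smul,
          dotProduct_hessOp_comm γ x ξ y0]
        simp only [smul_eq_mul]; ring
      rw [hform]
      refine lt_of_lt_of_le (quadratic_pos (p := ρ ^ 2 / 4) (K := N * (C * ρ ^ (2 * N - 1)) ^ 2)
        (Y := y0 ⬝ᵥ y0) (b := b) (m := y0 ⬝ᵥ H) hq0 (dotProduct_self_nonneg _) ?_ ?_ ?_)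
        (by linarith)
      · exact (dotProduct_sq_le _ _).trans
          (mul_le_mul_of_nonneg_left hHH (dotProduct_self_nonneg _))
      · have h1 : N * (C * ρ ^ (2 * N - 1)) ^ 2 ≤ N * C ^ 2 * (ρ ^ (2 * N) * ρ ^ 4) := by
          rw [mul_pow, ← mul_assoc]; gcongr
        have h2 : N * C ^ 2 * (ρ ^ (2 * N) * ρ ^ 4) = (8 * N * C ^ 2 * ρ ^ 2)
          * (ρ ^ (2 * N) * ρ ^ 2 / 8) := by ring
        have h3 : (8 * N * C ^ 2 * ρ ^ 2) * (ρ ^ (2 * N) * ρ ^ 2 / 8)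
            ≤ r * (ρ ^ (2 * N) * ρ ^ 2 / 8) := by gcongr
        have h4 : r * ρ ^ (2 * N) * (ρ ^ 2 / 4) ≤ q * (ρ ^ 2 / 4) := by gcongr
        have h5 : 0 < r * (ρ ^ (2 * N) * ρ ^ 2) := by positivity
        linarith
      · by_cases hb0 : b = 0
        · right
          refine dotProduct_self_pos ?_
          rw [hy0, hb0, zero_smul, sub_zero]; exact hy
        · exact Or.inl hb0
  · intro hs
    have hq1 : r * ρ ^ (2 * N) ≤ -q := by
      have h1 := hqabs (-(resCoeff N l * (-1) ^ k))
      have h2 : |resCoeff N l * (-1) ^ k| = |resCoeff N l| := by simp [abs_mul]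
      rw [abs_of_pos hs] at h2
      have h3 := (abs_le.1 hq).2
      have h4 : C * ρ ^ (2 * N + 1) ≤ r * ρ ^ (2 * N) := by
        rw [pow_succ, mul_comm (ρ ^ (2 * N)), ← mul_assoc]; gcongr
      have h5 : 2 * r ≤ 4 * N ^ 2 * (resCoeff N l * (-1) ^ k) := by
        have : (1 : ℝ) ≤ N ^ 2 := one_le_pow₀ hN1
        nlinarith
      have h6 := mul_le_mul_of_nonneg_right h5 hp0.le
      linarith
    have hq0 : 0 < -q := lt_of_lt_of_le (by positivity) hq1
    -- Now the form is negative along `ξ` as well as along constants, and the common kernel of the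
    -- two functionals is exactly where the transversal bound holds.
    refine isOfType_of_forms ![1, ξ] ![1, t] (fun c hc => ?_) (fun y hy hφ => ?_)
    · have hc0 : c 1 ≠ 0 ∨ 0 < c 0 ^ 2 := by
        by_contra! h
        apply hc; ext i; fin_cases i
        · exact pow_eq_zero_iff two_ne_zero |>.1 (le_antisymm h.2 (sq_nonneg _))
        · exact h.1
      have hform : (∑ i, c i • (![1, ξ] : Fin 2 → ZMod N → ℝ) i) ⬝ᵥ
          hessOp γ x (∑ i, c i • (![1, ξ] : Fin 2 → ZMod N → ℝ) i)
          = c 0 ^ 2 * ((1 : ZMod N → ℝ) ⬝ᵥ hessOp γ x 1)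
            + 2 * c 1 * (c 0 * ((1 : ZMod N → ℝ) ⬝ᵥ H)) + c 1 ^ 2 * q := by
        rw [Fin.sum_univ_two, Matrix.cons_val_zero, Matrix.cons_val_one, Matrix.cons_val_fin_one,
          hessOp_add, hessOp_smul, hessOp_smul, add_dotProduct, dotProduct_add, dotProduct_add,
          smul_dotProduct, smul_dotProduct, smul_dotProduct, smul_dotProduct, dotProduct_smul,
          dotProduct_smul, dotProduct_smul, dotProduct_smul, dotProduct_hessOp_comm γ x ξ 1]
        simp only [smul_eq_mul]; ring
      rw [show (WithLp.toLp 2 x : Config N).ofLp = x from rfl, hform]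
      have key := quadratic_pos (p := N / 2) (K := N * (N * (C * ρ ^ (2 * N - 1)) ^ 2))
        (Y := c 0 ^ 2) (b := c 1) (m := -(c 0 * ((1 : ZMod N → ℝ) ⬝ᵥ H))) hq0 (sq_nonneg _)
        ?_ ?_ hc0
      · have := mul_le_mul_of_nonneg_left hHone (sq_nonneg (c 0))
        linarith
      · rw [neg_sq, mul_pow]
        refine mul_le_mul_of_nonneg_left ((dotProduct_sq_le _ _).trans ?_) (sq_nonneg _)
        have : (1 : ZMod N → ℝ) ⬝ᵥ 1 = N := by simp [ZMod.card]
        rw [this]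
        gcongr
      · have h1 : N * (N * (C * ρ ^ (2 * N - 1)) ^ 2) ≤ N * (N * C ^ 2 * (ρ ^ (2 * N) * ρ ^ 4)) := by
          rw [mul_pow, ← mul_assoc (N : ℝ) (C ^ 2)]; gcongr
        have h2 : N * (N * C ^ 2 * (ρ ^ (2 * N) * ρ ^ 4)) = (8 * N * C ^ 2 * ρ ^ 2)
          * (N * ρ ^ (2 * N) * ρ ^ 2 / 8) := by ring
        have h3 : (8 * N * C ^ 2 * ρ ^ 2) * (N * ρ ^ (2 * N) * ρ ^ 2 / 8)
            ≤ r * (N * ρ ^ (2 * N) * 1 / 8) := by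
          gcongr
          exact pow_le_one₀ hρ.le hρ1'
        have h4 : r * ρ ^ (2 * N) * (N / 2) ≤ -q * (N / 2) := by gcongr
        have h5 : 0 < r * (N * ρ ^ (2 * N)) := by positivity
        linarith
    · have h0 := hφ 0
      have h1 := hφ 1
      simp only [Matrix.cons_val_zero, Matrix.cons_val_one, Matrix.cons_val_fin_one] at h0 h1
      have h2 := hpos y (by rw [← hone]; exact h0) h1
      have h3 := dotProduct_self_pos hy
      exact lt_of_lt_of_le (by positivity) h2

/-- Here the Hessian is `3 - L`, and every eigenvalue of `L` is at most `1`. -/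
theorem isOfType_of_sq_eq_one (hN : 3 ≤ N) {l : ℝ} (hl : l ≤ 1) {x : Config N}
    (hx : ∀ j, x j ^ 2 = 1) : IsOfType N ((1 - l) * gammaOne N) x 0 0 (N - 0) := by
  refine isOfType_of_forms (fun i => i.elim0) (fun i => i.elim0)
    (fun c hc => absurd (Subsingleton.elim _ _) hc) (fun y hy _ => ?_)
  have h1 : y ⬝ᵥ mult (symb N l) y ≤ y ⬝ᵥ mult 1 y := dotProduct_mult_mono y fun k => by
    by_cases hk : k = 0
    · rw [hk, symb_zero_right]; rfl
    · exact (symb_le hN hl hk).trans hl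
  rw [mult_one] at h1
  have h2 := dotProduct_self_pos hy
  have h3 : ∑ i, x.ofLp i ^ 2 * (y i * y i) = y ⬝ᵥ y :=
    sum_congr rfl fun i _ => by rw [hx, one_mul]
  rw [dotProduct_hessOp_symb, h3]
  linarith

/-- At the origin the Hessian is `-L`: the constants and the plane of the modes `±1` are negative,
all other modes positive by the spectral gap. -/
theorem eventually_isOfType_zero (hN : 3 ≤ N) : ∀ᶠ l in 𝓝[>] (0 : ℝ),
    IsOfType N ((1 - l) * gammaOne N) 0 3 0 (N - 3) := by
  obtain ⟨κ, hκ, hgap⟩ := exists_gap hN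
  have hNpos : (0 : ℝ) < N := Nat.cast_pos.2 (NeZero.pos N)
  filter_upwards [hgap, eventually_pos_le zero_lt_one] with l hgap hl
  set c := wave N 0 with hc
  set t := wave N (0 + Real.pi / 2) with ht
  have hform : ∀ y, y ⬝ᵥ hessOp ((1 - l) * gammaOne N) (0 : Config N).ofLp y
      = -(y ⬝ᵥ mult (symb N l) y) := by
    intro y
    rw [dotProduct_hessOp_symb]
    simp
  have hcc : c ⬝ᵥ c = N / 2 := by rw [hc, wave_dot_wave hN, sub_self, Real.cos_zero, mul_one]
  have htt : t ⬝ᵥ t = N / 2 := by rw [ht, wave_dot_wave hN, sub_self, Real.cos_zero, mul_one]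
  have hct : c ⬝ᵥ t = 0 := by
    rw [hc, ht, wave_dot_wave hN, sub_add_cancel_left, Real.cos_neg, Real.cos_pi_div_two, mul_zero]
  have h1c : (1 : ZMod N → ℝ) ⬝ᵥ c = 0 := (one_dotProduct _).trans (sum_wave hN _)
  have h1t : (1 : ZMod N → ℝ) ⬝ᵥ t = 0 := (one_dotProduct _).trans (sum_wave hN _)
  have h11 : (1 : ZMod N → ℝ) ⬝ᵥ 1 = N := by simp [ZMod.card]
  refine isOfType_of_forms ![1, c, t] ![1, c, t] (fun a ha => ?_) (fun y hy hφ => ?_)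
  · rw [hform, Fin.sum_univ_three]
    have e0 : (![1, c, t] : Fin 3 → ZMod N → ℝ) 0 = 1 := rfl
    have e1 : (![1, c, t] : Fin 3 → ZMod N → ℝ) 1 = c := rfl
    have e2 : (![1, c, t] : Fin 3 → ZMod N → ℝ) 2 = t := rfl
    rw [e0, e1, e2]
    simp only [map_add, map_smul, mult_symb_const, hc, ht, mult_symb_wave hN]
    rw [← hc, ← ht]
    simp only [add_dotProduct, dotProduct_add, smul_dotProduct, dotProduct_smul, smul_eq_mul, hcc,
      htt, hct, h1c, h1t, h11, dotProduct_comm t c, dotProduct_comm c 1, dotProduct_comm t 1]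
    have hne : 0 < a 0 ^ 2 ∨ 0 < a 1 ^ 2 ∨ 0 < a 2 ^ 2 := by
      by_contra! h
      apply ha
      ext i
      have hz : ∀ r : ℝ, r ^ 2 ≤ 0 → r = 0 := fun r hr =>
        pow_eq_zero_iff two_ne_zero |>.1 (le_antisymm hr (sq_nonneg _))
      fin_cases i
      · exact hz _ h.1
      · exact hz _ h.2.1
      · exact hz _ h.2.2
    have hlN : 0 < l * N := mul_pos hl.1 hNpos
    have p0 := mul_nonneg hNpos.le (sq_nonneg (a 0))
    have p1 := mul_nonneg hlN.le (sq_nonneg (a 1))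
    have p2 := mul_nonneg hlN.le (sq_nonneg (a 2))
    rcases hne with h | h | h
    · nlinarith [mul_pos hNpos h]
    · nlinarith [mul_pos hlN h]
    · nlinarith [mul_pos hlN h]
  · rw [hform]
    have h0 : (1 : ZMod N → ℝ) ⬝ᵥ y = 0 := hφ 0
    have h1 : c ⬝ᵥ y = 0 := hφ 1
    have h2 : t ⬝ᵥ y = 0 := hφ 2
    have hw : ∀ α, wave N α ⬝ᵥ y = 0 := by
      intro α
      rw [show α = 0 + α by ring, wave_add, add_dotProduct, smul_dotProduct, smul_dotProduct,
        ← hc, ← ht, h1, h2]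
      simp
    have h3 := dot_symb_le_neg hgap ((one_dotProduct y).symm.trans h0) hw
    have h4 := mul_pos hκ (dotProduct_self_pos hy)
    linarith

/-! ### Energy of the nonconstant solutions -/

/-- Pairing the equation with `x` shows that the quadratic part of the potential equals `-(1/2) ∑
x⁴`, against `(1/4) ∑ x⁴` for the quartic part. -/
theorem potential_of_sol {l : ℝ} {x : ZMod N → ℝ} (hx : mult (symb N l) x = x ^ 3) :
    potential N ((1 - l) * gammaOne N) (WithLp.toLp 2 x) = -(1 / 4) * (x ⬝ᵥ x ^ 3) := by
  have h1 := sum_sub_mul_sub x x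
  have h2 : x ⬝ᵥ linOp ((1 - l) * gammaOne N) x = x ⬝ᵥ x ^ 3 := by rw [← mult_symb_eq_linOp, hx]
  set γ := (1 - l) * gammaOne N
  have h3 : x ⬝ᵥ linOp γ x
      = ∑ i, x i ^ 2 - γ / 2 * ∑ i, (2 * x i - x (i + 1) - x (i - 1)) * x i := by
    rw [mul_sum, ← sum_sub_distrib]
    exact sum_congr rfl fun i _ => by rw [linOp_apply]; ring
  have h4 : ∑ i, localPotential (x i) = 1 / 4 * (x ⬝ᵥ x ^ 3) - 1 / 2 * ∑ i, x i ^ 2 := by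
    rw [dotProduct, mul_sum, mul_sum, ← sum_sub_distrib]
    exact sum_congr rfl fun i _ => by rw [localPotential, Pi.pow_apply]; ring
  have h5 : ∑ i, (x (i + 1) - x i) ^ 2 = ∑ i, (x (i + 1) - x i) * (x (i + 1) - x i) :=
    sum_congr rfl fun i _ => sq _
  change ∑ i, localPotential (x i) + γ / 4 * ∑ i, (x (i + 1) - x i) ^ 2 = _
  rw [h4, h5, h1]
  linarith

/-- The energy of the solutions of the branches. -/
theorem IsPolar.abs_energy_le {P l ρ θ : ℝ} (hP : 0 < P) (hl : 0 < l) {x : ZMod N → ℝ}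
    (hx : IsPolar N P l ρ θ x) (hsol : mult (symb N l) x = x ^ 3) :
    |potential N ((1 - l) * gammaOne N) (WithLp.toLp 2 x) / N - (-(1 / 6) * l ^ 2)|
      ≤ 17 * P * l ^ 3 := by
  have hNpos : (0 : ℝ) < N := Nat.cast_pos.2 (NeZero.pos N)
  have hρ := hx.pos
  rw [potential_of_sol hsol]
  set w := x - (2 * ρ) • wave N θ with hw
  have e : x ⬝ᵥ x ^ 3 = 2 * ρ * (l * ρ * N) + w ⬝ᵥ x ^ 3 := by
    rw [hw, sub_dotProduct, smul_dotProduct, hx.radial, smul_eq_mul]; ring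
  have h3 : ‖x ^ 3‖ ≤ (4 * ρ) ^ 3 :=
    (norm_pow_le' x (by norm_num)).trans (pow_le_pow_left₀ (norm_nonneg _) hx.norm_le 3)
  have h4 : |w ⬝ᵥ x ^ 3| ≤ N * (P * ρ ^ 3 * (4 * ρ) ^ 3) :=
    (abs_dotProduct_le _ _).trans (mul_le_mul_of_nonneg_left
      (mul_le_mul hx.norm_sub_le h3 (norm_nonneg _) (by positivity)) hNpos.le)
  -- The main term is `-l ρ²/2`, and `ρ² ≈ l/3` turns it into `-l²/6`.
  have e2 : -(1 / 4) * (x ⬝ᵥ x ^ 3) / N - (-(1 / 6) * l ^ 2)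
      = l / 6 * (l - 3 * ρ ^ 2) - 1 / (4 * N) * (w ⬝ᵥ x ^ 3) := by
    rw [e]; field_simp; ring
  rw [e2]
  have h5 : (ρ ^ 2) ^ 2 ≤ l ^ 2 := pow_le_pow_left₀ (sq_nonneg _) hx.sq_le 2
  have h6 : (ρ ^ 2) ^ 3 ≤ l ^ 3 := pow_le_pow_left₀ (sq_nonneg _) hx.sq_le 3
  refine (abs_sub _ _).trans ?_
  rw [abs_mul, abs_mul, abs_of_pos (show 0 < l / 6 by positivity),
    abs_of_pos (show (0 : ℝ) < 1 / (4 * N) by positivity)]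
  have h7 : l / 6 * |l - 3 * ρ ^ 2| ≤ l / 6 * (P * l ^ 2) := by
    refine mul_le_mul_of_nonneg_left (hx.abs_le.trans ?_) (by positivity)
    rw [show ρ ^ 4 = (ρ ^ 2) ^ 2 by ring]; gcongr
  have h8 : 1 / (4 * N) * |w ⬝ᵥ x ^ 3| ≤ 16 * P * l ^ 3 := by
    calc 1 / (4 * N) * |w ⬝ᵥ x ^ 3| ≤ 1 / (4 * N) * (N * (P * ρ ^ 3 * (4 * ρ) ^ 3)) := by gcongr
      _ = 16 * P * (ρ ^ 2) ^ 3 := by field_simp; ring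
      _ ≤ _ := by gcongr
  have h9 : 0 < P * l ^ 3 := by positivity
  linarith

/-! ### Orbits of the symmetry group -/

section Orbits

theorem inversion_apply (x : Config N) : inversion N x = -x := rfl

theorem orbit_zero : MulAction.orbit (symmetryGroup N) (0 : Config N) = {0} := by
  have h : symmetryGroup N ≤ MulAction.stabilizer (Equiv.Perm (Config N)) (0 : Config N) := by
    rw [symmetryGroup, Subgroup.closure_le]
    rintro g (rfl | rfl | rfl)
    · rfl
    · rfl
    · exact neg_zero
  ext y
  rw [Set.mem_singleton_iff]
  constructor
  · rintro ⟨g, rfl⟩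
    exact h g.2
  · rintro rfl
    exact MulAction.mem_orbit_self _

open scoped Pointwise in
theorem orbit_Iplus : MulAction.orbit (symmetryGroup N) (Iplus N) = {Iplus N, -Iplus N} := by
  have h : symmetryGroup N
      ≤ MulAction.stabilizer (Equiv.Perm (Config N)) ({Iplus N, -Iplus N} : Set (Config N)) := by
    rw [symmetryGroup, Subgroup.closure_le]
    have key : ∀ g : Equiv.Perm (Config N), g (Iplus N) = Iplus N → g (-Iplus N) = -Iplus N →
        g ∈ MulAction.stabilizer (Equiv.Perm (Config N)) ({Iplus N, -Iplus N} : Set (Config N)) := by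
      intro g h1 h2
      rw [MulAction.mem_stabilizer_set]
      intro a
      simp only [Equiv.Perm.smul_def, Set.mem_insert_iff, Set.mem_singleton_iff,
        g.injective.eq_iff' h1, g.injective.eq_iff' h2]
    rintro g (rfl | rfl | rfl)
    · exact key _ rfl rfl
    · exact key _ rfl rfl
    · rw [SetLike.mem_coe, MulAction.mem_stabilizer_set]
      intro a
      simp only [Equiv.Perm.smul_def, Set.mem_insert_iff, Set.mem_singleton_iff, inversion_apply,
        neg_eq_iff_eq_neg, neg_neg]
      exact or_comm
  ext y
  constructor
  · rintro ⟨g, rfl⟩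
    exact (MulAction.mem_stabilizer_set.1 (h g.2) _).2 (Set.mem_insert _ _)
  · rintro (rfl | rfl)
    · exact MulAction.mem_orbit_self _
    · exact ⟨⟨inversion N, Subgroup.subset_closure (by simp)⟩, rfl⟩

end Orbits

/-! ### Classification and counting -/

theorem mem_stationary_iff_mult (l : ℝ) (x : Config N) :
    x ∈ stationary N ((1 - l) * gammaOne N) ↔ mult (symb N l) x.ofLp = x.ofLp ^ 3 := by
  rw [mem_stationary_iff, mult_symb_eq_linOp]

theorem const_mem_stationary_iff (l : ℝ) {x : Config N} (hx : ∀ j, x j = x 0) :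
    x ∈ stationary N ((1 - l) * gammaOne N) ↔ x = 0 ∨ x = Iplus N ∨ x = -Iplus N := by
  have hx' : x.ofLp = fun _ => x 0 := funext hx
  rw [mem_stationary_iff_mult, hx']
  constructor
  · intro h
    rcases const_sol h with h | h | h
    · left; ext j; rw [hx, h]; rfl
    · right; left; ext j; rw [hx, h]; rfl
    · right; right; ext j; rw [hx, h]; rfl
  · intro h
    have hc : x 0 = 0 ∨ x 0 = 1 ∨ x 0 = -1 := by
      rcases h with rfl | rfl | rfl
      · exact Or.inl rfl
      · exact Or.inr (Or.inl rfl)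
      · exact Or.inr (Or.inr rfl)
    rw [mult_symb_eq_linOp]
    ext j
    simp only [linOp_apply, Pi.pow_apply]
    rcases hc with h | h | h <;> rw [h] <;> ring

/-- The description of all stationary points and of their types. -/
theorem exists_stationary_classification (hN : 3 ≤ N) (hodd : Odd N) : ∃ K : ℝ,
    ∀ᶠ l in 𝓝[>] (0 : ℝ), ∃ p : ℤ → Config N,
      stationary N ((1 - l) * gammaOne N) = {0, Iplus N, -Iplus N} ∪ Set.range p ∧
      (∀ k k', p k = p k' ↔ (4 * N : ℤ) ∣ k - k') ∧
      IsOfType N ((1 - l) * gammaOne N) 0 3 0 (N - 3) ∧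
      IsOfType N ((1 - l) * gammaOne N) (Iplus N) 0 0 (N - 0) ∧
      IsOfType N ((1 - l) * gammaOne N) (-Iplus N) 0 0 (N - 0) ∧
      (∀ k, IsOfType N ((1 - l) * gammaOne N) (p (2 * k)) 1 0 (N - 1)) ∧
      (∀ k, IsOfType N ((1 - l) * gammaOne N) (p (2 * k + 1)) 2 0 (N - 2)) ∧
      ∀ k, |potential N ((1 - l) * gammaOne N) (p k) / N - (-(1 / 6) * l ^ 2)| ≤ K * l ^ 3 := by
  obtain ⟨P, hP, hb⟩ := exists_branches hN hodd
  refine ⟨17 * P, ?_⟩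
  filter_upwards [hb, eventually_isOfType hN hodd hP, eventually_isOfType_zero hN,
    eventually_pos_le zero_lt_one] with l hb ht h0 hl
  obtain ⟨r, b, hpol, hsol, hnc, hall, hinj⟩ := hb
  obtain ⟨hres, ht⟩ := ht
  have hsq : ∀ x : Config N, x = Iplus N ∨ x = -Iplus N → ∀ j, x j ^ 2 = 1 := by
    rintro x (rfl | rfl) j
    · exact one_pow 2
    · exact (neg_sq _).trans (one_pow 2)
  -- The sign of the resonant coefficient is left undetermined. Shifting the index by `e` arranges
  -- that even indices are the 1-saddles.
  obtain ⟨e, he⟩ : ∃ e : ℤ, resCoeff N l * (-1) ^ e < 0 := by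
    rcases lt_or_gt_of_ne hres with h | h
    · exact ⟨0, by simpa using h⟩
    · exact ⟨1, by simpa using h⟩
  refine ⟨fun k => WithLp.toLp 2 (b (k + e)), ?_, fun k k' => ?_, h0,
    isOfType_of_sq_eq_one hN hl.2 (hsq _ (Or.inl rfl)),
    isOfType_of_sq_eq_one hN hl.2 (hsq _ (Or.inr rfl)), fun k => ?_, fun k => ?_, fun k => ?_⟩
  · ext x
    by_cases hc : ∀ j, x j = x 0
    · rw [const_mem_stationary_iff l hc]
      constructor
      · exact fun h => Or.inl h
      · rintro (h | ⟨k, rfl⟩)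
        · exact h
        · exact absurd hc (hnc _)
    · constructor
      · intro hx
        obtain ⟨k, hk⟩ := hall _ ((mem_stationary_iff_mult l x).1 hx) hc
        refine Or.inr ⟨k - e, ?_⟩
        simp only [sub_add_cancel]
        rw [← hk]
      · rintro (h | ⟨k, rfl⟩)
        · exfalso
          apply hc
          rcases h with rfl | rfl | rfl <;> exact fun j => rfl
        · exact (mem_stationary_iff_mult l _).2 (hsol _)
  · rw [(WithLp.toLp_injective 2).eq_iff, hinj, add_sub_add_right_eq_sub]
  · refine (ht _ _ _ (hpol _)).1 ?_
    rwa [zpow_add₀ (by norm_num), Even.neg_one_zpow (even_two_mul k), one_mul]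
  · refine (ht _ _ _ (hpol _)).2 ?_
    rw [zpow_add₀ (by norm_num), Odd.neg_one_zpow ⟨k, rfl⟩]
    linarith
  · exact (hpol _).abs_energy_le hP hl.1 (hsol _)

/-- A sequence of exact period `4N` has exactly `2N` values along each parity class. -/
theorem range_step_eq_image {p : ℤ → Config N} (hp : ∀ k k', p k = p k' ↔ (4 * N : ℤ) ∣ k - k')
    (c : ℤ) : (Set.range fun k : ℤ => p (2 * k + c))
      = (fun i : ℕ => p (2 * i + c)) '' (range (2 * N) : Finset ℕ) ∧
    (Set.range fun k : ℤ => p (2 * k + c)).ncard = 2 * N ∧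
    (Set.range fun k : ℤ => p (2 * k + c)).Finite := by
  have hN : (0 : ℤ) < 2 * N := by have := NeZero.pos N; omega
  have h1 : (Set.range fun k : ℤ => p (2 * k + c))
      = (fun i : ℕ => p (2 * i + c)) '' (range (2 * N) : Finset ℕ) := by
    ext x
    constructor
    · rintro ⟨k, rfl⟩
      have h2 := Int.emod_nonneg k hN.ne'
      have h3 := Int.emod_lt_of_pos k hN
      refine ⟨(k % (2 * N)).toNat, ?_, ?_⟩
      · simp only [coe_range, Set.mem_Iio]; omega
      · simp only
        rw [hp, Int.toNat_of_nonneg h2]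
        refine ⟨-(k / (2 * N)), ?_⟩
        have := Int.emod_add_mul_ediv k (2 * N)
        linear_combination 2 * this
    · rintro ⟨i, -, rfl⟩
      exact ⟨i, rfl⟩
  refine ⟨h1, ?_, ?_⟩
  · rw [h1, Set.InjOn.ncard_image, Set.ncard_coe_finset, card_range]
    intro i hi j hj h
    simp only [coe_range, Set.mem_Iio] at hi hj
    simp only at h
    rw [hp] at h
    have h2 : (2 * N : ℤ) ∣ i - j := by
      obtain ⟨m, hm⟩ := h
      exact ⟨m, by linarith⟩
    have h3 : (i - j : ℤ) = 0 := by
      refine Int.eq_zero_of_abs_lt_dvd h2 ?_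
      rw [abs_lt]; constructor <;> omega
    omega
  · rw [h1]
    exact (Set.toFinite _).image _

theorem saddles_eq {γ : ℝ} {p : ℤ → Config N}
    (hst : stationary N γ = {0, Iplus N, -Iplus N} ∪ Set.range p)
    (t0 : IsOfType N γ 0 3 0 (N - 3)) (tp : IsOfType N γ (Iplus N) 0 0 (N - 0))
    (tm : IsOfType N γ (-Iplus N) 0 0 (N - 0))
    (t1 : ∀ k, IsOfType N γ (p (2 * k)) 1 0 (N - 1))
    (t2 : ∀ k, IsOfType N γ (p (2 * k + 1)) 2 0 (N - 2)) :
    saddles N γ 0 = {Iplus N, -Iplus N} ∧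
    saddles N γ 1 = (Set.range fun k : ℤ => p (2 * k + 0)) ∧
    saddles N γ 2 = (Set.range fun k : ℤ => p (2 * k + 1)) ∧ saddles N γ 3 = {0} := by
  have hcases : ∀ x ∈ stationary N γ, x = 0 ∨ (x = Iplus N ∨ x = -Iplus N) ∨
      (∃ k, x = p (2 * k)) ∨ ∃ k, x = p (2 * k + 1) := by
    intro x hx
    rw [hst] at hx
    rcases hx with (h | h | h) | ⟨k, rfl⟩
    · exact Or.inl h
    · exact Or.inr (Or.inl (Or.inl h))
    · exact Or.inr (Or.inl (Or.inr h))
    · rcases Int.even_or_odd' k with ⟨m, rfl | rfl⟩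
      · exact Or.inr (Or.inr (Or.inl ⟨m, rfl⟩))
      · exact Or.inr (Or.inr (Or.inr ⟨m, rfl⟩))
  have htype : ∀ x ∈ stationary N γ, ∀ a, IsOfType N γ x a 0 (N - a) →
      (x = 0 ∧ a = 3) ∨ ((x = Iplus N ∨ x = -Iplus N) ∧ a = 0) ∨
      ((∃ k, x = p (2 * k)) ∧ a = 1) ∨ (∃ k, x = p (2 * k + 1)) ∧ a = 2 := by
    intro x hx a ha
    rcases hcases x hx with rfl | (rfl | rfl) | ⟨k, rfl⟩ | ⟨k, rfl⟩
    · exact Or.inl ⟨rfl, ha.unique t0⟩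
    · exact Or.inr (Or.inl ⟨Or.inl rfl, ha.unique tp⟩)
    · exact Or.inr (Or.inl ⟨Or.inr rfl, ha.unique tm⟩)
    · exact Or.inr (Or.inr (Or.inl ⟨⟨k, rfl⟩, ha.unique (t1 k)⟩))
    · exact Or.inr (Or.inr (Or.inr ⟨⟨k, rfl⟩, ha.unique (t2 k)⟩))
  have hmem : ∀ k, p k ∈ stationary N γ := fun k => by rw [hst]; exact Or.inr ⟨k, rfl⟩
  refine ⟨?_, ?_, ?_, ?_⟩ <;> ext x <;> constructor
  · rintro ⟨hx, ha⟩
    rcases htype x hx 0 ha with ⟨-, h⟩ | ⟨h, -⟩ | ⟨-, h⟩ | ⟨-, h⟩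
    · cases h
    · exact h
    · cases h
    · cases h
  · rintro (rfl | rfl)
    · exact ⟨by rw [hst]; simp, tp⟩
    · exact ⟨by rw [hst]; simp, tm⟩
  · rintro ⟨hx, ha⟩
    rcases htype x hx 1 ha with ⟨-, h⟩ | ⟨-, h⟩ | ⟨⟨k, h⟩, -⟩ | ⟨-, h⟩
    · cases h
    · cases h
    · exact ⟨k, by simp [h]⟩
    · cases h
  · rintro ⟨k, rfl⟩
    exact ⟨hmem _, by simpa using t1 k⟩
  · rintro ⟨hx, ha⟩
    rcases htype x hx 2 ha with ⟨-, h⟩ | ⟨-, h⟩ | ⟨-, h⟩ | ⟨⟨k, h⟩, -⟩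
    · cases h
    · cases h
    · cases h
    · exact ⟨k, h.symm⟩
  · rintro ⟨k, rfl⟩
    exact ⟨hmem _, t2 k⟩
  · rintro ⟨hx, ha⟩
    rcases htype x hx 3 ha with ⟨h, -⟩ | ⟨-, h⟩ | ⟨-, h⟩ | ⟨-, h⟩
    · exact h
    · cases h
    · cases h
    · cases h
  · rintro rfl
    exact ⟨by rw [hst]; simp, t0⟩

theorem disjoint_saddles (γ : ℝ) {a b : ℕ} (hab : a ≠ b) :
    Disjoint (saddles N γ a) (saddles N γ b) :=
  Set.disjoint_left.2 fun _ ha hb => hab (ha.2.unique hb.2)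

theorem Iplus_ne_neg : Iplus N ≠ -Iplus N := by
  intro h
  have : (1 : ℝ) = -1 := congrArg (fun x : Config N => x 0) h
  norm_num at this

theorem counting_of_classification {γ l K : ℝ} {p : ℤ → Config N}
    (hst : stationary N γ = {0, Iplus N, -Iplus N} ∪ Set.range p)
    (hp : ∀ k k', p k = p k' ↔ (4 * N : ℤ) ∣ k - k')
    (t0 : IsOfType N γ 0 3 0 (N - 3)) (tp : IsOfType N γ (Iplus N) 0 0 (N - 0))
    (tm : IsOfType N γ (-Iplus N) 0 0 (N - 0))
    (t1 : ∀ k, IsOfType N γ (p (2 * k)) 1 0 (N - 1))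
    (t2 : ∀ k, IsOfType N γ (p (2 * k + 1)) 2 0 (N - 2))
    (hV : ∀ k, |potential N γ (p k) / N - (-(1 / 6) * l ^ 2)| ≤ K * l ^ 3) :
    (∃ ℓ : ℕ, 1 ≤ ℓ ∧ (stationary N γ).ncard = 4 * ℓ * N + 3 ∧
      (saddles N γ 1).ncard = 2 * ℓ * N ∧ (saddles N γ 2).ncard = 2 * ℓ * N) ∧
    stationary N γ = saddles N γ 0 ∪ saddles N γ 1 ∪ saddles N γ 2 ∪ saddles N γ 3 ∧
    saddles N γ 0 = MulAction.orbit (symmetryGroup N) (Iplus N) ∧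
    saddles N γ 0 = {Iplus N, -Iplus N} ∧
    saddles N γ 3 = MulAction.orbit (symmetryGroup N) (0 : Config N) ∧
    saddles N γ 3 = {0} ∧
    ∀ A ∈ saddles N γ 1, |potential N γ A / N - (-(1 / 6) * l ^ 2)| ≤ K * l ^ 3 := by
  obtain ⟨s0, s1, s2, s3⟩ := saddles_eq hst t0 tp tm t1 t2
  obtain ⟨-, c1, f1⟩ := range_step_eq_image hp 0
  obtain ⟨-, c2, f2⟩ := range_step_eq_image hp 1
  rw [← s1] at c1 f1
  rw [← s2] at c2 f2
  have c0 : (saddles N γ 0).ncard = 2 := by rw [s0, Set.ncard_pair Iplus_ne_neg]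
  have c3 : (saddles N γ 3).ncard = 1 := by rw [s3, Set.ncard_singleton]
  have f0 : (saddles N γ 0).Finite := by rw [s0]; exact Set.toFinite _
  have f3 : (saddles N γ 3).Finite := by rw [s3]; exact Set.toFinite _
  have hunion : stationary N γ
      = saddles N γ 0 ∪ saddles N γ 1 ∪ saddles N γ 2 ∪ saddles N γ 3 := by
    refine Set.Subset.antisymm (fun x hx => ?_) ?_
    · rw [hst] at hx
      rcases hx with (h | h) | ⟨k, rfl⟩
      · exact Or.inr (s3 ▸ h)
      · exact Or.inl (Or.inl (Or.inl (s0 ▸ h)))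
      · rcases Int.even_or_odd' k with ⟨m, rfl | rfl⟩
        · exact Or.inl (Or.inl (Or.inr (s1 ▸ ⟨m, by simp⟩)))
        · exact Or.inl (Or.inr (s2 ▸ ⟨m, rfl⟩))
    · rintro x (((h | h) | h) | h) <;> exact h.1
  -- The witness is `ℓ = 1`: one family of `2N` points for each of the two saddle types.
  refine ⟨⟨1, le_rfl, ?_, by rw [c1], by rw [c2]⟩, hunion, by rw [s0, orbit_Iplus], s0,
    by rw [s3, orbit_zero], s3, ?_⟩
  · have hd : ∀ {a b : ℕ}, a ≠ b → Disjoint (saddles N γ a) (saddles N γ b) := disjoint_saddles γ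
    have d1 := hd (show 0 ≠ 1 by norm_num)
    have d2 := (hd (show 0 ≠ 2 by norm_num)).union_left (hd (show 1 ≠ 2 by norm_num))
    have d3 := ((hd (show 0 ≠ 3 by norm_num)).union_left (hd (show 1 ≠ 3 by norm_num))).union_left
      (hd (show 2 ≠ 3 by norm_num))
    rw [hunion, Set.ncard_union_eq d3 ((f0.union f1).union f2) f3,
      Set.ncard_union_eq d2 (f0.union f1) f2, Set.ncard_union_eq d1 f0 f1, c0, c1, c2, c3]
    ring
  · intro A hA
    rw [s1] at hA
    obtain ⟨k, rfl⟩ := hA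
    exact hV _

end BistableRing

theorem mainTheorem2 (N : ℕ) [NeZero N] (hN : 3 ≤ N) (hodd : Odd N) :
    ∃ δ : ℝ, 0 < δ ∧ ∃ K : ℝ, ∀ γ : ℝ,
      BistableRing.gammaOne N - δ < γ → γ < BistableRing.gammaOne N →
        (∃ ℓ : ℕ, 1 ≤ ℓ ∧
          (BistableRing.stationary N γ).ncard = 4 * ℓ * N + 3 ∧
          (BistableRing.saddles N γ 1).ncard = 2 * ℓ * N ∧
          (BistableRing.saddles N γ 2).ncard = 2 * ℓ * N) ∧
        BistableRing.stationary N γ =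
          BistableRing.saddles N γ 0 ∪ BistableRing.saddles N γ 1 ∪
            BistableRing.saddles N γ 2 ∪ BistableRing.saddles N γ 3 ∧
        BistableRing.saddles N γ 0 =
          MulAction.orbit (BistableRing.symmetryGroup N) (BistableRing.Iplus N) ∧
        BistableRing.saddles N γ 0 = {BistableRing.Iplus N, -BistableRing.Iplus N} ∧
        BistableRing.saddles N γ 3 =
          MulAction.orbit (BistableRing.symmetryGroup N) (0 : BistableRing.Config N) ∧
        BistableRing.saddles N γ 3 = {0} ∧
        ∀ A ∈ BistableRing.saddles N γ 1,
          |BistableRing.potential N γ A / N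
              - (-(1 / 6) * (1 - γ / BistableRing.gammaOne N) ^ 2)|
            ≤ K * (1 - γ / BistableRing.gammaOne N) ^ 3 := by
  obtain ⟨K, hK⟩ := BistableRing.exists_stationary_classification hN hodd
  obtain ⟨ε, hε, hsub⟩ := mem_nhdsGT_iff_exists_Ioo_subset.1 hK
  have hg := BistableRing.gammaOne_pos hN
  -- `γ₁ - γ = l γ₁`, so the window `0 < l < ε` has width `ε γ₁` in `γ`.
  refine ⟨ε * BistableRing.gammaOne N, mul_pos hε hg, K, fun γ h1 h2 => ?_⟩
  obtain ⟨l, hl⟩ : ∃ l, l = 1 - γ / BistableRing.gammaOne N := ⟨_, rfl⟩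
  have hγ : γ = (1 - l) * BistableRing.gammaOne N := by rw [hl]; field_simp; ring
  have hl0 : 0 < l := by rw [hl, sub_pos, div_lt_one hg]; exact h2
  have hlε : l < ε := by
    rw [hγ] at h1
    have h3 : l * BistableRing.gammaOne N < ε * BistableRing.gammaOne N := by linarith
    exact lt_of_mul_lt_mul_right h3 hg.le
  rw [← hl, hγ]
  obtain ⟨p, hst, hp, t0, tp, tm, t1, t2, hV⟩ := hsub ⟨hl0, hlε⟩
  exact BistableRing.counting_of_classification hst hp t0 tp tm t1 t2 hV
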